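/- Let $d\in\mathbf N$. For $\alpha\in\mathbf N^d$ let $h_\alpha(x)=\pi^{-d/4}(-1)^{|\alpha|}(2^{|\alpha|}\alpha!)^{-1/2}e^{|x|^2/2}\,\partial^\alpha e^{-|x|^2}$ be the Hermite functions on $\mathbf R^d$, let $e_\alpha(z)=z^\alpha/\sqrt{\alpha!}$ on $\mathbf C^d$, and let $\phi(x)=\pi^{-d/4}e^{-|x|^2/2}$. Let $H=|x|^2-\Delta$ be the harmonic oscillator. The Pilipović space $\boldsymbol\Sigma(\mathbf R^d)$ is the set of all $f\in C^\infty(\mathbf R^d)$ such that $\|f\|_h=\sup_{N\ge 0}\|H^Nf\|_{L^\infty}/(h^N N!)<\infty$ for every $h>0$, with the (projective limit) topology given by the norms $\|\cdot\|_h$, $h>0$. Its dual, with the strong dual topology, is denoted by $\boldsymbol\Sigma'(\mathbf R^d)$. A functional $u\in\boldsymbol\Sigma'(\mathbf R^d)$ is identified with the formal Hermite series $\sum_\alpha\langle u,h_\alpha\rangle h_\alpha$. The space $\mathcal A'(\mathbf C^d)$ is the set of all entire functions $F$ on $\mathbf C^d$ such that $|F(z)|\le Ce^{r|z|^2}$ for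 some $C$ and some $r>0$, with the locally convex inductive limit topology, as $r>0$ varies, of the spaces of entire functions with finite norm $\sup_z|F(z)|e^{-r|z|^2}$. Let $f=\sum_{\alpha\in\mathbf N^d}c_\alpha(f)h_\alpha$ be a formal Hermite series, with arbitrary complex coefficients $c_\alpha(f)$. Its Bargmann transform $\mathfrak V_df$ is the formal power series $\sum_\alpha c_\alpha(f)e_\alpha$; one says that $\mathfrak V_df\in\mathcal A'(\mathbf C^d)$ if this series converges everywhere on $\mathbf C^d$ to an element of $\mathcal A'(\mathbf C^d)$. Its short-time Fourier transform is $V_\phi f(x,\xi)=\sum_\alpha c_\alpha(f)V_\phi h_\alpha(x,\xi)$, where $V_\phi g(x,\xi)=(2\pi)^{-d/2}\int_{\mathbf R^d}g(y)\overline{\phi(y-x)}e^{-i\langle y,\xi\rangle}\,dy$ for a function $g$; an estimate for $V_\phi f$ includes the requirement that the series converges (unconditionally) at every point $(x,\xi)$. **Theorem.** For every formal Hermite series $f$ the following conditions are equivalent: 1. $f\in\boldsymbol\Sigma'(\mathbf R^d)$; 2. $\mathfrak V_df\in\mathcal A'(\mathbf C^d)$; 3. there are $r>0$ and $C$ such that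 $|c_\alpha(f)|\le Ce^{r|\alpha|}$ for all $\alpha\in\mathbf N^d$; 4. there are $r>0$ and $C$ such that $|V_\phi f(x,\xi)|\le Ce^{r(|x|^2+|\xi|^2)}$ for all $x,\xi\in\mathbf R^d$. Furthermore, the Bargmann transform $\mathfrak V_d$ restricts to a continuous bijective (linear) map from $\boldsymbol\Sigma'(\mathbf R^d)$ to $\mathcal A'(\mathbf C^d)$. -/

import Mathlib

open scoped ContDiff InnerProductSpace

noncomputable section

namespace Pilipovic

/-- `ℝᵈ` with its Euclidean norm. -/
abbrev Rd (d : ℕ) : Type := EuclideanSpace ℝ (Fin d)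

/-- `ℂᵈ` with its Hermitian norm. -/
abbrev Cd (d : ℕ) : Type := EuclideanSpace ℂ (Fin d)

/-- Multi-indices `α ∈ ℕᵈ`. -/
abbrev MultiIndex (d : ℕ) : Type := Fin d →₀ ℕ

/-- `|α| = α₁ + ⋯ + α_d`. -/
def order {d : ℕ} (α : MultiIndex d) : ℕ := ∑ i, α i

/-- `α! = α₁! ⋯ α_d!`. -/
def multiFactorial {d : ℕ} (α : MultiIndex d) : ℕ := ∏ i, (α i).factorial

/-! ### Hermite functions -/

/-- The one-dimensional Hermite function
`h_n(t) = π^{-1/4} (-1)ⁿ (2ⁿ n!)^{-1/2} e^{t²/2} (d/dt)ⁿ e^{-t²}`. -/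
def hermiteOne (n : ℕ) (t : ℝ) : ℝ :=
  Real.pi ^ (-(1 / 4 : ℝ)) * (-1) ^ n * ((2 : ℝ) ^ n * n.factorial) ^ (-(1 / 2 : ℝ)) *
    Real.exp (t ^ 2 / 2) * iteratedDeriv n (fun s : ℝ => Real.exp (-s ^ 2)) t

/-- The Hermite function
`h_α(x) = π^{-d/4} (-1)^{|α|} (2^{|α|} α!)^{-1/2} e^{|x|²/2} ∂^α e^{-|x|²}` on `ℝᵈ`, written as
the product of one-dimensional Hermite functions in the coordinates. -/
def hermiteFun {d : ℕ} (α : MultiIndex d) (x : Rd d) : ℂ :=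
  ((∏ i, hermiteOne (α i) (x i) : ℝ) : ℂ)

/-! ### Smooth functions and the harmonic oscillator -/

/-- The smooth complex valued functions on `ℝᵈ`. -/
def smoothFun (d : ℕ) : Submodule ℂ (Rd d → ℂ) where
  carrier := {f | ContDiff ℝ ∞ f}
  add_mem' {f g} (hf : ContDiff ℝ ∞ f) (hg : ContDiff ℝ ∞ g) := hf.add hg
  zero_mem' := show ContDiff ℝ ∞ (fun _ => (0 : ℂ)) from contDiff_const
  smul_mem' c f (hf : ContDiff ℝ ∞ f) := hf.const_smul c

lemma laplacian_smooth {d : ℕ} {f : Rd d → ℂ} (hf : ContDiff ℝ ∞ f) :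
    ContDiff ℝ ∞ (Laplacian.laplacian f) := by
  rw [InnerProductSpace.laplacian_eq_iteratedFDeriv_stdOrthonormalBasis]
  refine ContDiff.sum fun i _ => ?_
  have h : ContDiff ℝ ∞ (iteratedFDeriv ℝ 2 f) := hf.iteratedFDeriv_right (by norm_cast)
  exact (ContinuousMultilinearMap.apply ℝ (fun _ : Fin 2 => Rd d) ℂ
    ![(stdOrthonormalBasis ℝ (Rd d)) i, (stdOrthonormalBasis ℝ (Rd d)) i]).contDiff.comp h

/-- The harmonic oscillator `H f = |x|² f - Δ f` on smooth functions. -/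
def harmonicOsc (d : ℕ) : smoothFun d →ₗ[ℂ] smoothFun d where
  toFun f := ⟨fun x => (((‖x‖ ^ 2 : ℝ)) : ℂ) * (f : Rd d → ℂ) x
      - Laplacian.laplacian (f : Rd d → ℂ) x, by
    have hf : ContDiff ℝ ∞ (f : Rd d → ℂ) := f.2
    refine ContDiff.sub (ContDiff.mul ?_ hf) (laplacian_smooth hf)
    exact Complex.ofRealCLM.contDiff.comp (contDiff_norm_sq ℝ)⟩
  map_add' f g := by
    ext x
    have hf : ContDiff ℝ ∞ (f : Rd d → ℂ) := f.2
    have hg : ContDiff ℝ ∞ (g : Rd d → ℂ) := g.2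
    have := (hf.contDiffAt (x := x)).of_le (m := 2) (by norm_cast) |>.laplacian_add
      ((hg.contDiffAt (x := x)).of_le (m := 2) (by norm_cast))
    simp only [Submodule.coe_add, Pi.add_apply, this]
    ring
  map_smul' c f := by
    ext x
    have hf : ContDiff ℝ ∞ (f : Rd d → ℂ) := f.2
    have := InnerProductSpace.laplacian_smul c
      ((hf.contDiffAt (x := x)).of_le (m := 2) (by norm_cast))
    simp only [Submodule.coe_smul, Pi.smul_apply, this, RingHom.id_apply, smul_eq_mul]
    ring

/-- The value of `Hᴺ f` at `x`. -/
def oscPow {d : ℕ} (N : ℕ) (f : smoothFun d) (x : Rd d) : ℂ :=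
  (((harmonicOsc d) ^ N) f : Rd d → ℂ) x

/-- The seminorm `v ↦ sup_i |(L v)_i| w_i` of a linear map `L` with values in families of complex
numbers, for nonnegative weights `w` for which the supremum is always finite. -/
def supSeminorm {V ι : Type*} [AddCommGroup V] [Module ℂ V] [Nonempty ι] (L : V →ₗ[ℂ] (ι → ℂ))
    (w : ι → ℝ) (hw : ∀ i, 0 ≤ w i)
    (hb : ∀ v, BddAbove (Set.range fun i => ‖L v i‖ * w i)) : Seminorm ℂ V :=
  Seminorm.of (fun v => ⨆ i, ‖L v i‖ * w i)
    (fun u v => ciSup_le fun i => by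
      calc ‖L (u + v) i‖ * w i ≤ (‖L u i‖ + ‖L v i‖) * w i := by
            rw [map_add]; exact mul_le_mul_of_nonneg_right (norm_add_le _ _) (hw i)
        _ = ‖L u i‖ * w i + ‖L v i‖ * w i := add_mul _ _ _
        _ ≤ _ := add_le_add (le_ciSup (hb u) i) (le_ciSup (hb v) i))
    (fun c v => by
      rw [Real.mul_iSup_of_nonneg (norm_nonneg c)]
      simp [mul_assoc])

/-! ### The Pilipović space and its dual -/

/-- The Pilipović space of order `1/2` as a vector space: all smooth `f` such that for every
`h > 0` there is `C` with `|Hᴺ f(x)| ≤ C hᴺ N!` for all `N` and `x`. -/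
def pilSubmodule (d : ℕ) : Submodule ℂ (smoothFun d) where
  carrier := {f | ∀ h : ℝ, 0 < h → ∃ C : ℝ, ∀ (N : ℕ) (x : Rd d),
    ‖oscPow N f x‖ ≤ C * (h ^ N * N.factorial)}
  add_mem' {f g} hf hg h hh := by
    obtain ⟨C, hC⟩ := hf h hh
    obtain ⟨D, hD⟩ := hg h hh
    refine ⟨C + D, fun N x => ?_⟩
    have : oscPow N (f + g) x = oscPow N f x + oscPow N g x := by simp [oscPow]
    rw [this, add_mul]
    exact (norm_add_le _ _).trans (add_le_add (hC N x) (hD N x))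
  zero_mem' h _ := ⟨0, fun N x => by simp [oscPow]⟩
  smul_mem' c f hf h hh := by
    obtain ⟨C, hC⟩ := hf h hh
    refine ⟨‖c‖ * C, fun N x => ?_⟩
    have : oscPow N (c • f) x = c * oscPow N f x := by simp [oscPow]
    rw [this, norm_mul, mul_assoc]
    exact mul_le_mul_of_nonneg_left (hC N x) (norm_nonneg c)

/-- The Pilipović space `𝚺(ℝᵈ)`. (A type of its own, so that it does not carry the topology of
pointwise convergence.) -/
def PilSpace (d : ℕ) : Type := pilSubmodule d

instance (d : ℕ) : AddCommGroup (PilSpace d) := inferInstanceAs (AddCommGroup (pilSubmodule d))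

instance (d : ℕ) : Module ℂ (PilSpace d) := inferInstanceAs (Module ℂ (pilSubmodule d))

/-- The inclusion of `𝚺(ℝᵈ)` into the smooth functions. -/
def PilSpace.toSmooth (d : ℕ) : PilSpace d →ₗ[ℂ] smoothFun d := (pilSubmodule d).subtype

/-- The family of all values `Hᴺ f(x)`. -/
def PilSpace.oscValues (d : ℕ) : PilSpace d →ₗ[ℂ] (ℕ × Rd d → ℂ) where
  toFun f i := oscPow i.1 (PilSpace.toSmooth d f) i.2
  map_add' f g := by ext i; simp [oscPow]
  map_smul' c f := by ext i; simp [oscPow]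

/-- The norm `sup_{N, x} |Hᴺ f(x)| / (hᴺ N!)` on `𝚺(ℝᵈ)`, for `h > 0`. -/
def PilSpace.pilNorm (d : ℕ) (h : {h : ℝ // 0 < h}) : Seminorm ℂ (PilSpace d) :=
  supSeminorm (PilSpace.oscValues d) (fun i => ((h : ℝ) ^ i.1 * i.1.factorial)⁻¹)
    (fun i => by have := h.2; positivity)
    (fun f => by
      obtain ⟨C, hC⟩ := f.2 h h.2
      refine ⟨C, ?_⟩
      rintro _ ⟨i, rfl⟩
      have := h.2
      change _ * _⁻¹ ≤ C
      rw [← div_eq_mul_inv]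
      exact (div_le_iff₀ (by positivity)).2 (hC i.1 i.2))

instance : Nonempty {h : ℝ // 0 < h} := ⟨⟨1, one_pos⟩⟩

/-- The projective limit topology on `𝚺(ℝᵈ)`, given by all the norms above. -/
instance (d : ℕ) : TopologicalSpace (PilSpace d) :=
  (show SeminormFamily ℂ (PilSpace d) {h : ℝ // 0 < h} from
    PilSpace.pilNorm d).moduleFilterBasis.topology

/-- The Pilipović distribution space `𝚺'(ℝᵈ)`: the continuous linear functionals on `𝚺(ℝᵈ)`, with
the strong dual topology. -/
abbrev PilDual (d : ℕ) : Type := StrongDual ℂ (PilSpace d)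

/-! ### Hermite functions belong to the Pilipović space -/

def gaussDeriv (n : ℕ) : ℝ → ℝ := iteratedDeriv n (fun s : ℝ => Real.exp (-s ^ 2))

lemma gauss_smooth : ContDiff ℝ ∞ (fun s : ℝ => Real.exp (-s ^ 2)) := by fun_prop

lemma gaussDeriv_hasDerivAt (n : ℕ) (t : ℝ) :
    HasDerivAt (gaussDeriv n) (gaussDeriv (n + 1) t) t := by
  have h : Differentiable ℝ (gaussDeriv n) :=
    gauss_smooth.differentiable_iteratedDeriv n (by exact_mod_cast WithTop.coe_lt_top _)
  have := (h t).hasDerivAt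
  rwa [gaussDeriv, ← iteratedDeriv_succ] at this

lemma gaussDeriv_rec (n : ℕ) : ∀ t : ℝ,
    gaussDeriv (n + 2) t = -2 * t * gaussDeriv (n + 1) t - 2 * (n + 1) * gaussDeriv n t := by
  induction n with
  | zero =>
    have h1 : ∀ t, gaussDeriv 1 t = -2 * t * gaussDeriv 0 t := fun t => by
      have h : HasDerivAt (gaussDeriv 0) (-2 * t * gaussDeriv 0 t) t := by
        have : HasDerivAt (fun s : ℝ => Real.exp (-s ^ 2)) (Real.exp (-t ^ 2) * (-(2 * t))) t := by
          simpa using ((hasDerivAt_pow 2 t).neg).exp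
        simp only [gaussDeriv, iteratedDeriv_zero]
        convert this using 1
        ring
      exact (gaussDeriv_hasDerivAt 0 t).unique h
    intro t
    have h2 := gaussDeriv_hasDerivAt 1 t
    have h3 : gaussDeriv 1 = fun t => -2 * t * gaussDeriv 0 t := funext h1
    have h4 : HasDerivAt (fun t => -2 * t * gaussDeriv 0 t)
        (-2 * 1 * gaussDeriv 0 t + -2 * t * gaussDeriv 1 t) t :=
      ((hasDerivAt_id t).const_mul (-2)).mul (gaussDeriv_hasDerivAt 0 t)
    rw [← h3] at h4
    rw [h2.unique h4]
    push_cast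
    ring
  | succ n ih =>
    intro t
    have h2 := gaussDeriv_hasDerivAt (n + 2) t
    have h3 : gaussDeriv (n + 2) =
        fun t => -2 * t * gaussDeriv (n + 1) t - 2 * (n + 1) * gaussDeriv n t := funext ih
    have h4 : HasDerivAt
        (fun t => -2 * t * gaussDeriv (n + 1) t - 2 * (n + 1) * gaussDeriv n t)
        (-2 * 1 * gaussDeriv (n + 1) t + -2 * t * gaussDeriv (n + 2) t
          - 2 * (n + 1) * gaussDeriv (n + 1) t) t :=
      (((hasDerivAt_id t).const_mul (-2)).mul (gaussDeriv_hasDerivAt (n + 1) t)).sub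
        ((gaussDeriv_hasDerivAt n t).const_mul _)
    rw [← h3] at h4
    rw [h2.unique h4]
    push_cast
    ring

lemma gaussDeriv_poly (n : ℕ) :
    ∃ P : Polynomial ℝ, ∀ t, gaussDeriv n t = P.eval t * Real.exp (-t ^ 2) := by
  induction n with
  | zero => exact ⟨1, fun t => by simp [gaussDeriv]⟩
  | succ n ih =>
    obtain ⟨P, hP⟩ := ih
    refine ⟨P.derivative - 2 * Polynomial.X * P, fun t => ?_⟩
    have h2 := gaussDeriv_hasDerivAt n t
    rw [funext hP] at h2
    have h3 : HasDerivAt (fun s : ℝ => Real.exp (-s ^ 2)) (Real.exp (-t ^ 2) * (-(2 * t))) t := by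
      simpa using ((hasDerivAt_pow 2 t).neg).exp
    rw [h2.unique ((P.hasDerivAt t).mul h3)]
    simp
    ring

/-- The constant in front of the one-dimensional Hermite function. -/
def hermiteConst (n : ℕ) : ℝ :=
  Real.pi ^ (-(1 / 4 : ℝ)) * (-1) ^ n * ((2 : ℝ) ^ n * n.factorial) ^ (-(1 / 2 : ℝ))

lemma hermiteOne_eq (n : ℕ) (t : ℝ) :
    hermiteOne n t = hermiteConst n * (Real.exp (t ^ 2 / 2) * gaussDeriv n t) := by
  simp only [hermiteOne, hermiteConst, gaussDeriv]
  ring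

lemma hermiteOne_smooth (n : ℕ) : ContDiff ℝ ∞ (hermiteOne n) := by
  have h : ContDiff ℝ ∞ (gaussDeriv n) := by
    induction n with
    | zero => simpa [gaussDeriv] using gauss_smooth
    | succ n ih =>
      rw [gaussDeriv, iteratedDeriv_succ]
      exact (contDiff_infty_iff_deriv.1 ih).2
  rw [funext (hermiteOne_eq n)]
  exact contDiff_const.mul (ContDiff.mul (by fun_prop) h)

lemma hermiteOne_deriv (n : ℕ) (t : ℝ) : HasDerivAt (hermiteOne n)
    (hermiteConst n * (Real.exp (t ^ 2 / 2) * (t * gaussDeriv n t + gaussDeriv (n + 1) t))) t := by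
  have h1 : HasDerivAt (fun s : ℝ => Real.exp (s ^ 2 / 2)) (Real.exp (t ^ 2 / 2) * t) t := by
    have := ((hasDerivAt_pow 2 t).div_const 2).exp
    convert this using 1
    simp
  rw [funext (hermiteOne_eq n)]
  refine ((h1.mul (gaussDeriv_hasDerivAt n t)).const_mul (hermiteConst n)).congr_deriv ?_
  ring

lemma hermiteOne_deriv_two (n : ℕ) (t : ℝ) :
    deriv (deriv (hermiteOne n)) t = (t ^ 2 - (2 * n + 1)) * hermiteOne n t := by
  have h0 : deriv (hermiteOne n) = fun t =>
      hermiteConst n * (Real.exp (t ^ 2 / 2) * (t * gaussDeriv n t + gaussDeriv (n + 1) t)) :=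
    funext fun t => (hermiteOne_deriv n t).deriv
  have h1 : HasDerivAt (fun s : ℝ => Real.exp (s ^ 2 / 2)) (Real.exp (t ^ 2 / 2) * t) t := by
    have := ((hasDerivAt_pow 2 t).div_const 2).exp
    convert this using 1
    simp
  have h2 : HasDerivAt (fun t => t * gaussDeriv n t + gaussDeriv (n + 1) t)
      (1 * gaussDeriv n t + t * gaussDeriv (n + 1) t + gaussDeriv (n + 2) t) t :=
    ((hasDerivAt_id t).mul (gaussDeriv_hasDerivAt n t)).add (gaussDeriv_hasDerivAt (n + 1) t)
  have h3 := ((h1.mul h2).const_mul (hermiteConst n)).deriv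
  rw [h0]
  refine h3.trans ?_
  rw [gaussDeriv_rec, hermiteOne_eq]
  ring

lemma pow_gauss_bdd (P : Polynomial ℝ) :
    ∃ C : ℝ, ∀ t : ℝ, |P.eval t * Real.exp (-t ^ 2 / 2)| ≤ C := by
  induction P using Polynomial.induction_on' with
  | add P Q hP hQ =>
    obtain ⟨C, hC⟩ := hP
    obtain ⟨D, hD⟩ := hQ
    refine ⟨C + D, fun t => ?_⟩
    rw [Polynomial.eval_add, add_mul]
    exact (abs_add_le _ _).trans (add_le_add (hC t) (hD t))
  | monomial k a =>
    refine ⟨|a| * (k.factorial * Real.exp (1 / 2)), fun t => ?_⟩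
    rw [Polynomial.eval_monomial, mul_assoc, abs_mul]
    refine mul_le_mul_of_nonneg_left ?_ (abs_nonneg a)
    rw [abs_mul, abs_pow, Real.abs_exp]
    have h1 : |t| ^ k ≤ k.factorial * Real.exp |t| := by
      have := Real.pow_div_factorial_le_exp |t| (abs_nonneg t) k
      rwa [div_le_iff₀' (by positivity)] at this
    calc |t| ^ k * Real.exp (-t ^ 2 / 2)
        ≤ (k.factorial * Real.exp |t|) * Real.exp (-t ^ 2 / 2) :=
          mul_le_mul_of_nonneg_right h1 (Real.exp_pos _).le
      _ = k.factorial * Real.exp (|t| + -t ^ 2 / 2) := by rw [Real.exp_add]; ring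
      _ ≤ _ := by
        refine mul_le_mul_of_nonneg_left (Real.exp_le_exp.2 ?_) (by positivity)
        nlinarith [sq_nonneg (|t| - 1), sq_abs t]

lemma hermiteOne_bdd (n : ℕ) : ∃ C : ℝ, ∀ t, |hermiteOne n t| ≤ C := by
  obtain ⟨P, hP⟩ := gaussDeriv_poly n
  obtain ⟨C, hC⟩ := pow_gauss_bdd P
  refine ⟨|hermiteConst n| * C, fun t => ?_⟩
  rw [hermiteOne_eq, hP, abs_mul]
  refine mul_le_mul_of_nonneg_left ?_ (abs_nonneg _)
  have h : Real.exp (t ^ 2 / 2) * (P.eval t * Real.exp (-t ^ 2)) =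
      P.eval t * Real.exp (-t ^ 2 / 2) := by
    rw [mul_left_comm, ← Real.exp_add]
    ring_nf
  rw [h]
  exact hC t

/-- The product function `∏ Φ_j(x_j)`. -/
def prodFun {d : ℕ} (Φ : Fin d → ℝ → ℝ) (x : Rd d) : ℂ := ((∏ i, Φ i (x i) : ℝ) : ℂ)

lemma prodFun_smooth {d : ℕ} {Φ : Fin d → ℝ → ℝ} (hΦ : ∀ i, ContDiff ℝ ∞ (Φ i)) :
    ContDiff ℝ ∞ (prodFun Φ) := by
  have h : ContDiff ℝ ∞ (fun x : Rd d => ∏ i, Φ i (x i)) :=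
    contDiff_prod fun i _ => (hΦ i).comp
      (EuclideanSpace.proj i : Rd d →L[ℝ] ℝ).contDiff
  exact Complex.ofRealCLM.contDiff.comp h

lemma prodFun_fderiv {d : ℕ} {Φ : Fin d → ℝ → ℝ} (hΦ : ∀ i, ContDiff ℝ ∞ (Φ i))
    (i : Fin d) (x : Rd d) :
    fderiv ℝ (prodFun Φ) x (EuclideanSpace.basisFun (Fin d) ℝ i) =
      prodFun (Function.update Φ i (deriv (Φ i))) x := by
  have hd : DifferentiableAt ℝ (prodFun Φ) x :=
    (prodFun_smooth hΦ).differentiable (by simp) x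
  rw [← hd.lineDeriv_eq_fderiv, lineDeriv]
  have h1 : (fun t : ℝ => prodFun Φ (x + t • EuclideanSpace.basisFun (Fin d) ℝ i)) =
      fun t : ℝ => ((Φ i (x i + t) * ∏ j ∈ Finset.univ.erase i, Φ j (x j) : ℝ) : ℂ) := by
    ext t
    rw [prodFun, ← Finset.mul_prod_erase _ _ (Finset.mem_univ i)]
    congr 2
    · simp
    · refine Finset.prod_congr rfl fun j hj => ?_
      simp [Finset.ne_of_mem_erase hj]
  have h2 : HasDerivAt (fun t : ℝ => Φ i (x i + t)) (deriv (Φ i) (x i)) 0 := by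
    have h3 : HasDerivAt (Φ i) (deriv (Φ i) (x i + 0)) (x i + 0) :=
      ((hΦ i).differentiable (by simp) _).hasDerivAt
    simpa using h3.comp_const_add (x i) 0
  rw [h1, ((h2.mul_const _).ofReal_comp).deriv, prodFun,
    ← Finset.mul_prod_erase _ _ (Finset.mem_univ i)]
  congr 2
  · simp
  · refine Finset.prod_congr rfl fun j hj => ?_
    simp [Finset.ne_of_mem_erase hj]

lemma prodFun_laplacian {d : ℕ} {Φ : Fin d → ℝ → ℝ} (hΦ : ∀ i, ContDiff ℝ ∞ (Φ i))
    (x : Rd d) : Laplacian.laplacian (prodFun Φ) x =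
      ∑ i, prodFun (Function.update Φ i (deriv (deriv (Φ i)))) x := by
  rw [InnerProductSpace.laplacian_eq_iteratedFDeriv_orthonormalBasis _
    (EuclideanSpace.basisFun (Fin d) ℝ)]
  refine Finset.sum_congr rfl fun i _ => ?_
  rw [iteratedFDeriv_two_apply]
  set e := EuclideanSpace.basisFun (Fin d) ℝ i
  have hΨ : ∀ j, ContDiff ℝ ∞ (Function.update Φ i (deriv (Φ i)) j) := fun j => by
    rcases eq_or_ne j i with rfl | hj
    · simpa using (contDiff_infty_iff_deriv.1 (hΦ j)).2
    · simpa [hj] using hΦ j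
  have hd : DifferentiableAt ℝ (fderiv ℝ (prodFun Φ)) x :=
    (((prodFun_smooth hΦ).fderiv_right (m := 1) (by norm_cast)).differentiable (by simp)) x
  have h1 : fderiv ℝ (fun y => fderiv ℝ (prodFun Φ) y e) x e =
      fderiv ℝ (fderiv ℝ (prodFun Φ)) x e e := by
    rw [fderiv_clm_apply hd (differentiableAt_const e)]
    simp
  have h2 : (fun y => fderiv ℝ (prodFun Φ) y e) =
      prodFun (Function.update Φ i (deriv (Φ i))) := funext fun y => prodFun_fderiv hΦ i y
  have h3 := prodFun_fderiv hΨ i x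
  simp only [Function.update_self, Function.update_idem] at h3
  simp only [Matrix.cons_val_zero, Matrix.cons_val_one]
  rw [← h1, h2, h3]

lemma hermiteFun_smooth {d : ℕ} (α : MultiIndex d) : ContDiff ℝ ∞ (hermiteFun α) :=
  prodFun_smooth fun i => hermiteOne_smooth (α i)

/-- `H h_α = (2|α| + d) h_α`. -/
lemma harmonicOsc_hermiteFun {d : ℕ} (α : MultiIndex d) :
    harmonicOsc d ⟨hermiteFun α, hermiteFun_smooth α⟩ =
      ((2 * order α + d : ℕ) : ℂ) • (⟨hermiteFun α, hermiteFun_smooth α⟩ : smoothFun d) := by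
  ext x
  have h : Laplacian.laplacian (hermiteFun α) x =
      ∑ i : Fin d, (((x i) ^ 2 - (2 * (α i) + 1) : ℝ) : ℂ) * hermiteFun α x := by
    change Laplacian.laplacian (prodFun fun i => hermiteOne (α i)) x = _
    rw [prodFun_laplacian fun i => hermiteOne_smooth (α i)]
    refine Finset.sum_congr rfl fun i _ => ?_
    rw [prodFun, hermiteFun, ← Complex.ofReal_mul,
      ← Finset.mul_prod_erase _ _ (Finset.mem_univ i),
      ← Finset.mul_prod_erase Finset.univ (fun i => hermiteOne (α i) (x i)) (Finset.mem_univ i),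
      Function.update_self, hermiteOne_deriv_two, mul_assoc]
    congr 3
    refine Finset.prod_congr rfl fun j hj => ?_
    simp [Finset.ne_of_mem_erase hj]
  change (((‖x‖ ^ 2 : ℝ)) : ℂ) * hermiteFun α x - Laplacian.laplacian (hermiteFun α) x =
    ((2 * order α + d : ℕ) : ℂ) * hermiteFun α x
  rw [h, ← Finset.sum_mul, ← sub_mul, EuclideanSpace.norm_sq_eq, order]
  congr 1
  push_cast
  simp only [Real.norm_eq_abs, Finset.sum_sub_distrib, Finset.sum_add_distrib, ← Finset.mul_sum,
    Finset.sum_const, Finset.card_univ, Fintype.card_fin, nsmul_eq_mul, mul_one]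
  have h2 : ∀ y : ℝ, ((|y| : ℝ) : ℂ) ^ 2 = (y : ℂ) ^ 2 := fun y => by
    rw [← Complex.ofReal_pow, sq_abs, Complex.ofReal_pow]
  simp only [h2]
  ring

lemma hermiteFun_mem {d : ℕ} (α : MultiIndex d) :
    (⟨hermiteFun α, hermiteFun_smooth α⟩ : smoothFun d) ∈ pilSubmodule d := by
  intro h hh
  have hb : ∃ C : ℝ, ∀ x : Rd d, ‖hermiteFun α x‖ ≤ C := by
    choose C hC using fun n => hermiteOne_bdd n
    refine ⟨∏ i, C (α i), fun x => ?_⟩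
    rw [hermiteFun, Complex.norm_real, Real.norm_eq_abs, Finset.abs_prod]
    exact Finset.prod_le_prod (fun i _ => abs_nonneg _) fun i _ => hC _ _
  obtain ⟨C, hC⟩ := hb
  set l : ℝ := ((2 * order α + d : ℕ) : ℝ) with hl
  have hl0 : 0 ≤ l := by positivity
  have hC0 : 0 ≤ C := (norm_nonneg _).trans (hC 0)
  have hpow : ∀ N : ℕ, ((harmonicOsc d) ^ N) ⟨hermiteFun α, hermiteFun_smooth α⟩ =
      ((l : ℂ) ^ N) • (⟨hermiteFun α, hermiteFun_smooth α⟩ : smoothFun d) := by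
    intro N
    induction N with
    | zero => simp
    | succ N ih =>
      rw [pow_succ', Module.End.mul_apply, ih, map_smul, harmonicOsc_hermiteFun, smul_smul, hl]
      push_cast
      ring_nf
  refine ⟨Real.exp (l / h) * C, fun N x => ?_⟩
  have h1 : oscPow N ⟨hermiteFun α, hermiteFun_smooth α⟩ x = (l : ℂ) ^ N * hermiteFun α x := by
    rw [oscPow, hpow]
    rfl
  rw [h1, norm_mul, norm_pow, Complex.norm_real, Real.norm_of_nonneg hl0]
  have h2 := Real.pow_div_factorial_le_exp (l / h) (by positivity) N
  rw [div_pow, div_div, div_le_iff₀ (by positivity)] at h2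
  calc l ^ N * ‖hermiteFun α x‖ ≤ (Real.exp (l / h) * (h ^ N * N.factorial)) * C :=
        mul_le_mul h2 (hC x) (norm_nonneg _) (by positivity)
    _ = _ := by ring

/-- The Hermite function `h_α` as an element of `𝚺(ℝᵈ)`. -/
def hermitePil {d : ℕ} (α : MultiIndex d) : PilSpace d :=
  ⟨⟨hermiteFun α, hermiteFun_smooth α⟩, hermiteFun_mem α⟩

/-! ### Formal Hermite series and formal power series -/

/-- `𝓗₀'(ℝᵈ)`: a formal Hermite series `∑ c_α h_α` is the family of its coefficients. -/
abbrev FormalHermite (d : ℕ) : Type := MultiIndex d → ℂ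

/-- The Hermite expansion of `u ∈ 𝚺'(ℝᵈ)`, with coefficients `c_α(u) = ⟨u, h_α⟩` (recall that
`h_α` is real valued). It is through this map that `𝚺'(ℝᵈ)` is a subset of `𝓗₀'(ℝᵈ)`. -/
def hermiteExpansion {d : ℕ} (u : PilDual d) : FormalHermite d := fun α => u (hermitePil α)

/-- The Bargmann transform of the formal Hermite series `∑ c_α h_α`: the formal power series
`∑ c_α e_α`, where `e_α(z) = z^α / √(α!)`. -/
def bargmann {d : ℕ} (c : FormalHermite d) : MvPowerSeries (Fin d) ℂ :=
  fun α => c α / (Real.sqrt (multiFactorial α) : ℂ)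

/-- The formal power series `P` converges on all of `ℂᵈ` and its sum is the function `F`. -/
def HasEntireSum {d : ℕ} (P : MvPowerSeries (Fin d) ℂ) (F : Cd d → ℂ) : Prop :=
  ∀ z : Cd d, HasSum (fun α : MultiIndex d => MvPowerSeries.coeff α P * ∏ i, z i ^ α i) (F z)

/-! ### Entire functions of Gaussian growth -/

/-- Entire functions `F` on `ℂᵈ` with `|F(z)| ≤ C e^{r|z|²}` for some `C`. -/
def entireStepSubmodule (d : ℕ) (r : ℝ) : Submodule ℂ (Cd d → ℂ) where
  carrier := {F | Differentiable ℂ F ∧ ∃ C : ℝ, ∀ z, ‖F z‖ ≤ C * Real.exp (r * ‖z‖ ^ 2)}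
  add_mem' := by
    rintro F G ⟨hF, C, hC⟩ ⟨hG, D, hD⟩
    refine ⟨hF.add hG, C + D, fun z => ?_⟩
    rw [add_mul]
    exact (norm_add_le _ _).trans (add_le_add (hC z) (hD z))
  zero_mem' := ⟨differentiable_const (0 : ℂ), 0, fun z => by simp⟩
  smul_mem' := by
    rintro c F ⟨hF, C, hC⟩
    refine ⟨hF.const_smul c, ‖c‖ * C, fun z => ?_⟩
    rw [Pi.smul_apply, norm_smul, mul_assoc]
    exact mul_le_mul_of_nonneg_left (hC z) (norm_nonneg c)

lemma entireStepSubmodule_mono (d : ℕ) {r s : ℝ} (hrs : r ≤ s) :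
    entireStepSubmodule d r ≤ entireStepSubmodule d s := by
  rintro F ⟨hF, C, hC⟩
  refine ⟨hF, |C|, fun z => (hC z).trans ?_⟩
  have h : Real.exp (r * ‖z‖ ^ 2) ≤ Real.exp (s * ‖z‖ ^ 2) :=
    Real.exp_le_exp.2 (mul_le_mul_of_nonneg_right hrs (by positivity))
  exact mul_le_mul (le_abs_self C) h (Real.exp_pos _).le (abs_nonneg C)

/-- The space of entire functions `F` on `ℂᵈ` with `|F(z)| ≲ e^{r|z|²}`, which is normed below. -/
def EntireStep (d : ℕ) (r : ℝ) : Type := entireStepSubmodule d r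

instance (d : ℕ) (r : ℝ) : AddCommGroup (EntireStep d r) :=
  inferInstanceAs (AddCommGroup (entireStepSubmodule d r))

instance (d : ℕ) (r : ℝ) : Module ℂ (EntireStep d r) :=
  inferInstanceAs (Module ℂ (entireStepSubmodule d r))

/-- The norm `sup_z |F(z)| e^{-r|z|²}`. -/
def EntireStep.stepNorm (d : ℕ) (r : ℝ) : Seminorm ℂ (EntireStep d r) :=
  supSeminorm (entireStepSubmodule d r).subtype (fun z => Real.exp (-(r * ‖z‖ ^ 2)))
    (fun z => (Real.exp_pos _).le)
    (fun F => by
      obtain ⟨-, C, hC⟩ := F.2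
      refine ⟨C, ?_⟩
      rintro _ ⟨z, rfl⟩
      have h := mul_le_mul_of_nonneg_right (hC z) (Real.exp_pos (-(r * ‖z‖ ^ 2))).le
      rwa [mul_assoc, ← Real.exp_add, add_neg_cancel, Real.exp_zero, mul_one] at h)

/-- The topology of the norm. -/
instance (d : ℕ) (r : ℝ) : TopologicalSpace (EntireStep d r) :=
  (EntireStep.stepNorm d r).toSeminormedAddCommGroup.toUniformSpace.toTopologicalSpace

/-- Entire functions `F` on `ℂᵈ` with `|F(z)| ≤ C e^{r|z|²}` for some `C` and some `r > 0`. -/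
def APrimeSubmodule (d : ℕ) : Submodule ℂ (Cd d → ℂ) where
  carrier := {F | Differentiable ℂ F ∧
    ∃ r : ℝ, 0 < r ∧ ∃ C : ℝ, ∀ z, ‖F z‖ ≤ C * Real.exp (r * ‖z‖ ^ 2)}
  add_mem' := by
    rintro F G ⟨hF, r, hr, hC⟩ ⟨hG, s, hs, hD⟩
    have h := (entireStepSubmodule d (r + s)).add_mem
      (entireStepSubmodule_mono d (by linarith) ⟨hF, hC⟩)
      (entireStepSubmodule_mono d (by linarith) ⟨hG, hD⟩)
    exact ⟨h.1, r + s, by linarith, h.2⟩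
  zero_mem' := ⟨differentiable_const (0 : ℂ), 1, one_pos, 0, fun z => by simp⟩
  smul_mem' := by
    rintro c F ⟨hF, r, hr, hC⟩
    have h := (entireStepSubmodule d r).smul_mem c ⟨hF, hC⟩
    exact ⟨h.1, r, hr, h.2⟩

/-- The space `𝒜'(ℂᵈ)`. -/
def APrime (d : ℕ) : Type := APrimeSubmodule d

instance (d : ℕ) : AddCommGroup (APrime d) := inferInstanceAs (AddCommGroup (APrimeSubmodule d))

instance (d : ℕ) : Module ℂ (APrime d) := inferInstanceAs (Module ℂ (APrimeSubmodule d))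

instance (d : ℕ) : CoeFun (APrime d) (fun _ => Cd d → ℂ) := ⟨fun F => F.1⟩

/-- The inclusion of the normed space with parameter `r > 0` into `𝒜'(ℂᵈ)`. -/
def EntireStep.toAPrime (d : ℕ) (r : {r : ℝ // 0 < r}) : EntireStep d r →ₗ[ℂ] APrime d :=
  Submodule.inclusion (p := entireStepSubmodule d r) (p' := APrimeSubmodule d)
    fun _ hF => ⟨hF.1, r, r.2, hF.2⟩

/-- The (locally convex) inductive limit topology on `𝒜'(ℂᵈ)`: the finest locally convex vector
space topology for which all the inclusions above are continuous. -/
instance (d : ℕ) : TopologicalSpace (APrime d) :=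
  sInf {t | @IsTopologicalAddGroup (APrime d) t _ ∧ @ContinuousSMul ℂ (APrime d) _ _ t ∧
    @LocallyConvexSpace ℝ (APrime d) _ _ _ _ t ∧
    ∀ r : {r : ℝ // 0 < r}, @Continuous (EntireStep d r) (APrime d) _ t (EntireStep.toAPrime d r)}

/-! ### The short-time Fourier transform -/

/-- The Gaussian window `φ(x) = π^{-d/4} e^{-|x|²/2}`. -/
def gaussWindow (d : ℕ) (x : Rd d) : ℂ :=
  ((Real.pi ^ (-(d / 4 : ℝ)) * Real.exp (-‖x‖ ^ 2 / 2) : ℝ) : ℂ)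

/-- The short-time Fourier transform
`V_φ f(x, ξ) = (2π)^{-d/2} ∫ f(y) conj(φ(y - x)) e^{-i⟨y, ξ⟩} dy` of a function `f`. -/
def stft {d : ℕ} (φ f : Rd d → ℂ) (x ξ : Rd d) : ℂ :=
  (((2 * Real.pi) ^ (-(d / 2 : ℝ)) : ℝ) : ℂ) *
    ∫ y : Rd d, f y * (starRingEnd ℂ) (φ (y - x)) * Complex.exp (-Complex.I * (⟪y, ξ⟫_ℝ : ℝ))

/-- `V` is the short-time Fourier transform, with respect to the Gaussian window, of the formal
Hermite series `∑ c_α h_α`: the series `∑ c_α V_φ h_α(x, ξ)` converges to `V(x, ξ)` at all points. -/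
def IsFormalSTFT {d : ℕ} (c : FormalHermite d) (V : Rd d → Rd d → ℂ) : Prop :=
  ∀ x ξ : Rd d,
    HasSum (fun α : MultiIndex d => c α * stft (gaussWindow d) (hermiteFun α) x ξ) (V x ξ)

end Pilipovic

end

/-! Everything is compared with the coefficient condition (3).

On the side of the Pilipović space, `H h_α = (2|α| + d) h_α` and both the sup norm and the `L¹` norm
of `h_α` are at most `6^d e^{|α|}`. The first fact turns bounds `h^N N!` on `H^N f` into
exponentials: a single term of the exponential series gives `‖h_α‖_h ≤ C_h e^{(1 + 2/h)|α|}`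
(`pilNorm_hermitePil_le`), while summing over `N` gives `|c_α(f)| ≤ C ‖f‖_h e^{(1 - 1/h)|α|}`
(`norm_hermiteCoeff_pil_le`). Hence elements of `𝚺` have coefficients decaying faster than every
exponential, and their Hermite expansions converge in `𝚺` (`hasSum_pilCoeff_smul_hermitePil`). By
duality, `𝚺'` consists of the coefficient families of at most exponential growth, and a functional
is determined by its coefficients. The moment identity `c_α(Hf) = (2|α| + d) c_α(f)` needs care,
since nothing is known about the decay of `f`: it is obtained with cut-off Hermite functions.
Completeness of the Hermite functions follows from their generating function, the Bargmann kernel,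
and Fourier inversion.

On the side of entire functions, `|e_α(z)| ≤ q^{|α|} e^{|z|²/(2q²)}` for every `q > 0`
(`norm_monomialFun_le`), so exponential growth of `c_α` gives Gaussian growth of `∑ c_α e_α`. The
converse is Cauchy's estimate on the polycircle of radii `√(α_i + 1)`, where `|z|² = |α| + d`
(`norm_coeff_le_of_gaussian_growth`). The expansion of an entire function in monomials comes from
its Fourier series on tori.

The short-time Fourier transform is the Bargmann transform in other coordinates: `V_φ h_α(x, ξ)` is
`e_α((x - iξ)/√2)` times a nowhere vanishing factor of Gaussian size (`stft_hermiteFun`).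

For continuity, let `p` be a seminorm on `𝒜'` that is continuous on every normed step. Then `p(e_α)`
decays faster than every geometric sequence, so the vectors `2^{|α|} p(e_α) h_α` form a bounded set
in `𝚺`. Where `|u| < 1` on this set, `p` of the Bargmann transform of `u` is at most `∑ 2^{-|α|}`;
this is a neighbourhood of zero for the strong topology. -/

noncomputable section

namespace Pilipovic

open MeasureTheory Filter Topology

/-! ### One-dimensional Hermite functions -/

/-- The function is a polynomial times the Gaussian `e^{-t²/2}`. -/
def IsPolyGauss (f : ℝ → ℝ) : Prop :=
  ∃ P : Polynomial ℝ, ∀ t, f t = P.eval t * Real.exp (-t ^ 2 / 2)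

/-! ### Calculus and inequalities for a polynomial times a Gaussian. -/

namespace IsPolyGauss

variable {f g : ℝ → ℝ}

lemma bounded (hf : IsPolyGauss f) : ∃ C : ℝ, ∀ t, |f t| ≤ C := by
  obtain ⟨P, hP⟩ := hf
  simpa only [hP] using pow_gauss_bdd P

lemma poly_mul (hf : IsPolyGauss f) (Q : Polynomial ℝ) : IsPolyGauss fun t => Q.eval t * f t := by
  obtain ⟨P, hP⟩ := hf
  exact ⟨Q * P, fun t => by simp only [hP, Polynomial.eval_mul, mul_assoc]⟩

lemma hasDerivAt (hf : IsPolyGauss f) (t : ℝ) : HasDerivAt f (deriv f t) t := by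
  obtain ⟨P, hP⟩ := hf
  rw [funext hP, hasDerivAt_deriv_iff]
  fun_prop

lemma continuous (hf : IsPolyGauss f) : Continuous f :=
  continuous_iff_continuousAt.2 fun t => (hf.hasDerivAt t).continuousAt

lemma deriv (hf : IsPolyGauss f) : IsPolyGauss (deriv f) := by
  obtain ⟨P, hP⟩ := hf
  refine ⟨P.derivative - Polynomial.X * P, fun t => ?_⟩
  have h3 : HasDerivAt (fun s : ℝ => Real.exp (-s ^ 2 / 2)) (Real.exp (-t ^ 2 / 2) * (-t)) t := by
    convert! (((hasDerivAt_pow 2 t).neg).div_const 2).exp using 1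
    simp
    ring
  rw [funext hP]
  refine ((P.hasDerivAt t).mul h3).deriv.trans ?_
  simp
  ring

lemma integrable (hf : IsPolyGauss f) : Integrable f := by
  obtain ⟨C, hC⟩ := (hf.poly_mul (1 + Polynomial.X ^ 2)).bounded
  refine (integrable_inv_one_add_sq.const_mul C).mono' hf.continuous.aestronglyMeasurable
    (Eventually.of_forall fun t => ?_)
  have h := hC t
  simp only [Polynomial.eval_add, Polynomial.eval_one, Polynomial.eval_pow,
    Polynomial.eval_X] at h
  rw [abs_mul, abs_of_pos (by positivity)] at h
  rw [Real.norm_eq_abs, ← div_eq_mul_inv, le_div_iff₀ (by positivity)]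
  linarith

lemma integrable_mul (hf : IsPolyGauss f) (hg : IsPolyGauss g) :
    Integrable fun t => f t * g t := by
  obtain ⟨C, hC⟩ := hf.bounded
  exact hg.integrable.bdd_mul hf.continuous.aestronglyMeasurable (Eventually.of_forall hC)

lemma integral_mul_deriv (hf : IsPolyGauss f) (hg : IsPolyGauss g) :
    ∫ t, f t * _root_.deriv g t = -∫ t, _root_.deriv f t * g t :=
  integral_mul_deriv_eq_deriv_mul_of_integrable (fun t _ => hf.hasDerivAt t)
    (fun t _ => hg.hasDerivAt t) (hf.integrable_mul hg.deriv) (hf.deriv.integrable_mul hg)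
    (hf.integrable_mul hg)

/-- One-dimensional Sobolev inequality: `f²` vanishes at `-∞`, so `f(t)²` is the integral of `2 f
f'` over a half-line, and `2 f f' ≤ f² + f'²`. -/
lemma sq_le (hf : IsPolyGauss f) (t : ℝ) :
    f t ^ 2 ≤ (∫ s, f s ^ 2) + ∫ s, _root_.deriv f s ^ 2 := by
  have hd : ∀ s, HasDerivAt (fun s => f s ^ 2) (2 * (f s * _root_.deriv f s)) s := fun s => by
    convert! (hf.hasDerivAt s).pow 2 using 1
    simp
    ring
  have hi : Integrable fun s => 2 * (f s * _root_.deriv f s) :=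
    (hf.integrable_mul hf.deriv).const_mul 2
  have h2 : Integrable fun s => f s ^ 2 := by simpa only [sq] using hf.integrable_mul hf
  have h3 : Integrable fun s => _root_.deriv f s ^ 2 := by
    simpa only [sq] using hf.deriv.integrable_mul hf.deriv
  have h4 : Tendsto (fun s => f s ^ 2) atBot (𝓝 0) :=
    tendsto_zero_of_hasDerivAt_of_integrableOn_Iic (a := 0) (fun s _ => hd s) hi.integrableOn
      h2.integrableOn
  have h5 := integral_Iic_of_hasDerivAt_of_tendsto' (a := t) (fun s _ => hd s) hi.integrableOn h4
  rw [sub_zero] at h5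
  rw [← h5, ← integral_add h2 h3]
  calc ∫ s in Set.Iic t, 2 * (f s * _root_.deriv f s)
      ≤ ∫ s in Set.Iic t, (f s ^ 2 + _root_.deriv f s ^ 2) :=
        setIntegral_mono hi.integrableOn (h2.add h3).integrableOn fun s => by
          show 2 * (f s * _root_.deriv f s) ≤ f s ^ 2 + _root_.deriv f s ^ 2
          nlinarith [sq_nonneg (f s - _root_.deriv f s)]
    _ ≤ _ := setIntegral_le_integral (h2.add h3) (Eventually.of_forall fun s => by
          show 0 ≤ f s ^ 2 + _root_.deriv f s ^ 2
          positivity)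

/-- Pointwise, `|f| ≤ (1 + t²)⁻¹ + (1 + t²) f²`; the first term integrates to `π`. -/
lemma integral_abs_le (hf : IsPolyGauss f) :
    ∫ t, |f t| ≤ Real.pi + (∫ t, f t ^ 2) + ∫ t, t ^ 2 * f t ^ 2 := by
  have h2 : Integrable fun s => f s ^ 2 := by simpa only [sq] using hf.integrable_mul hf
  have h3 : Integrable fun s => s ^ 2 * f s ^ 2 := by
    have := (hf.poly_mul Polynomial.X).integrable_mul (hf.poly_mul Polynomial.X)
    simp only [Polynomial.eval_X] at this
    exact this.congr (Eventually.of_forall fun s => by ring)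
  rw [← integral_univ_inv_one_add_sq, ← integral_add integrable_inv_one_add_sq h2,
    ← integral_add (f := fun t : ℝ => (1 + t ^ 2)⁻¹ + f t ^ 2)
      (integrable_inv_one_add_sq.add h2) h3]
  refine integral_mono hf.integrable.abs ((integrable_inv_one_add_sq.add h2).add h3) fun t => ?_
  show |f t| ≤ (1 + t ^ 2)⁻¹ + f t ^ 2 + t ^ 2 * f t ^ 2
  have h : (0 : ℝ) < 1 + t ^ 2 := by positivity
  rw [← sub_nonneg]
  -- With `u = (1 + t²)|f|`, the difference times `1 + t²` is `1 - u + u² = (1 - u/2)² + (3/4) u²`.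
  have h5 : (1 + t ^ 2)⁻¹ + f t ^ 2 + t ^ 2 * f t ^ 2 - |f t| =
      (1 + t ^ 2)⁻¹ * ((1 - (1 + t ^ 2) * |f t| / 2) ^ 2 + 3 / 4 * ((1 + t ^ 2) * |f t|) ^ 2) := by
    field_simp
    rw [← sq_abs (f t)]
    ring
  rw [h5]
  positivity

end IsPolyGauss

/-! ### Energy identity, orthonormality and size of the one-dimensional Hermite functions. -/

lemma isPolyGauss_hermiteOne (n : ℕ) : IsPolyGauss (hermiteOne n) := by
  obtain ⟨P, hP⟩ := gaussDeriv_poly n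
  refine ⟨Polynomial.C (hermiteConst n) * P, fun t => ?_⟩
  rw [hermiteOne_eq, hP, Polynomial.eval_mul, Polynomial.eval_C, mul_left_comm (Real.exp _),
    ← Real.exp_add, mul_assoc]
  ring_nf

/-- The equation `h'' = (t² - (2n + 1)) h` is paired with `h` and integrated by parts. It controls
the `L²` norms of `h'` and `t h`, which are what `sq_le` and `integral_abs_le` require. -/
lemma hermiteOne_energy (n : ℕ) :
    (∫ t, deriv (hermiteOne n) t ^ 2) + ∫ t, t ^ 2 * hermiteOne n t ^ 2 =
      (2 * n + 1) * ∫ t, hermiteOne n t ^ 2 := by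
  have hf := isPolyGauss_hermiteOne n
  have h := hf.integral_mul_deriv hf.deriv
  have h2 : Integrable fun s => hermiteOne n s ^ 2 := by
    simpa only [sq] using hf.integrable_mul hf
  have h3 : Integrable fun s => s ^ 2 * hermiteOne n s ^ 2 := by
    have := (hf.poly_mul Polynomial.X).integrable_mul (hf.poly_mul Polynomial.X)
    simp only [Polynomial.eval_X] at this
    exact this.congr (Eventually.of_forall fun s => by ring)
  have h4 : ∀ t, hermiteOne n t * deriv (deriv (hermiteOne n)) t =
      t ^ 2 * hermiteOne n t ^ 2 - (2 * n + 1) * hermiteOne n t ^ 2 := fun t => by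
    rw [hermiteOne_deriv_two]; ring
  simp only [h4, ← sq] at h
  rw [integral_sub h3 (h2.const_mul _), integral_const_mul] at h
  linarith

/-- The second derivative is symmetric, and the two functions belong to different eigenvalues of `t²
- (d/dt)²`. -/
lemma integral_hermiteOne_mul_of_ne {m n : ℕ} (h : m ≠ n) :
    ∫ t, hermiteOne m t * hermiteOne n t = 0 := by
  have hm := isPolyGauss_hermiteOne m
  have hn := isPolyGauss_hermiteOne n
  have h1 := hm.integral_mul_deriv hn.deriv
  have h2 := hn.integral_mul_deriv hm.deriv
  have h5 : ∫ t, (hermiteOne m t * deriv (deriv (hermiteOne n)) t -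
      hermiteOne n t * deriv (deriv (hermiteOne m)) t) = 0 := by
    rw [integral_sub (hm.integrable_mul hn.deriv.deriv) (hn.integrable_mul hm.deriv.deriv), h1, h2]
    simp only [mul_comm, sub_self]
  have h6 : ∀ t, hermiteOne m t * deriv (deriv (hermiteOne n)) t -
      hermiteOne n t * deriv (deriv (hermiteOne m)) t =
      (2 * m - 2 * n : ℝ) * (hermiteOne m t * hermiteOne n t) := fun t => by
    rw [hermiteOne_deriv_two, hermiteOne_deriv_two]; ring
  simp only [h6, integral_const_mul] at h5
  refine (mul_eq_zero.1 h5).resolve_left fun h7 => h ?_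
  have : (m : ℝ) = n := by linarith
  exact_mod_cast this

lemma hermiteConst_sq (n : ℕ) :
    hermiteConst n ^ 2 = (Real.sqrt Real.pi * (2 ^ n * n.factorial))⁻¹ := by
  have h1 : ((2 : ℝ) ^ n * n.factorial) ^ (-(1 / 2 : ℝ)) * ((2 : ℝ) ^ n * n.factorial) ^
      (-(1 / 2 : ℝ)) = ((2 : ℝ) ^ n * n.factorial)⁻¹ := by
    rw [← Real.rpow_add (by positivity), ← Real.rpow_neg_one]; norm_num
  have h2 : Real.pi ^ (-(1 / 4 : ℝ)) * Real.pi ^ (-(1 / 4 : ℝ)) = (Real.sqrt Real.pi)⁻¹ := by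
    rw [← Real.rpow_add Real.pi_pos, Real.sqrt_eq_rpow, ← Real.rpow_neg Real.pi_pos.le]; norm_num
  have h3 : ((-1 : ℝ) ^ n) * (-1) ^ n = 1 := by rw [← mul_pow]; norm_num
  rw [hermiteConst, mul_inv, ← h1, ← h2]
  calc _ = (Real.pi ^ (-(1 / 4 : ℝ)) * Real.pi ^ (-(1 / 4 : ℝ))) * (((-1 : ℝ) ^ n) * (-1) ^ n) *
      (((2 : ℝ) ^ n * n.factorial) ^ (-(1 / 2 : ℝ)) * ((2 : ℝ) ^ n * n.factorial) ^
      (-(1 / 2 : ℝ))) := by ring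
    _ = _ := by rw [h3, mul_one]

/-- By the three-term recurrence, the derivative of `e^{t²} g_{n+1}` is `-2(n + 1) e^{t²} g_n`,
where `g_n` is the `n`-th derivative of `e^{-t²}`. One integration by parts therefore lowers `n` by
one and produces the factor `2(n + 1)`. -/
lemma integral_gaussDeriv_sq (n : ℕ) :
    ∫ t, Real.exp (t ^ 2) * gaussDeriv n t ^ 2 = Real.sqrt Real.pi * (2 ^ n * n.factorial) := by
  have hpg : ∀ n, IsPolyGauss fun t => Real.exp (t ^ 2 / 2) * gaussDeriv n t := fun n => by
    obtain ⟨P, hP⟩ := gaussDeriv_poly n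
    refine ⟨P, fun t => ?_⟩
    simp only [hP]
    rw [mul_left_comm, ← Real.exp_add]
    ring_nf
  have hexp : ∀ t : ℝ, Real.exp (t ^ 2) = Real.exp (t ^ 2 / 2) * Real.exp (t ^ 2 / 2) := fun t => by
    rw [← Real.exp_add, add_halves]
  have hint : ∀ m n, Integrable fun t => Real.exp (t ^ 2) * gaussDeriv m t * gaussDeriv n t :=
    fun m n => ((hpg m).integrable_mul (hpg n)).congr (Eventually.of_forall fun t => by
      simp only [hexp]; ring)
  induction n with
  | zero =>
    have h := integral_gaussian 1
    simp only [gaussDeriv, iteratedDeriv_zero, pow_zero, Nat.factorial_zero, Nat.cast_one, mul_one]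
    rw [div_one] at h
    rw [← h]
    refine integral_congr_ae (Eventually.of_forall fun t => ?_)
    simp only [sq (Real.exp (-t ^ 2)), ← Real.exp_add]
    ring_nf
  | succ n ih =>
    have h1 : ∀ t, HasDerivAt (fun s => Real.exp (s ^ 2) * gaussDeriv (n + 1) s)
        (-(2 * (n + 1)) * (Real.exp (t ^ 2) * gaussDeriv n t)) t := fun t => by
      have h2 : HasDerivAt (fun s : ℝ => Real.exp (s ^ 2)) (Real.exp (t ^ 2) * (2 * t)) t := by
        simpa using (hasDerivAt_pow 2 t).exp
      refine (h2.mul (gaussDeriv_hasDerivAt (n + 1) t)).congr_deriv ?_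
      rw [gaussDeriv_rec]
      ring
    have h3 := integral_mul_deriv_eq_deriv_mul_of_integrable (fun t _ => h1 t)
      (fun t _ => gaussDeriv_hasDerivAt n t) (hint (n + 1) (n + 1))
      (((hint n n).const_mul (-(2 * ((n : ℝ) + 1)))).congr (Eventually.of_forall fun t => by
        simp only [Pi.mul_apply]; ring)) (hint (n + 1) n)
    have h4 : ∀ t, -(2 * ((n : ℝ) + 1)) * (Real.exp (t ^ 2) * gaussDeriv n t) * gaussDeriv n t =
        -(2 * ((n : ℝ) + 1)) * (Real.exp (t ^ 2) * gaussDeriv n t ^ 2) := fun t => by ring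
    simp only [h4, integral_const_mul, ih] at h3
    simp only [sq (gaussDeriv _ _), ← mul_assoc]
    rw [h3, Nat.factorial_succ]
    push_cast
    ring

lemma integral_hermiteOne_sq (n : ℕ) : ∫ t, hermiteOne n t ^ 2 = 1 := by
  have h : ∀ t, hermiteOne n t ^ 2 =
      hermiteConst n ^ 2 * (Real.exp (t ^ 2) * gaussDeriv n t ^ 2) := fun t => by
    have : Real.exp (t ^ 2) = Real.exp (t ^ 2 / 2) ^ 2 := by
      rw [sq (Real.exp _), ← Real.exp_add, add_halves]
    rw [hermiteOne_eq, this]; ring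
  simp only [h, integral_const_mul, integral_gaussDeriv_sq, hermiteConst_sq]
  exact inv_mul_cancel₀ (by positivity)

lemma integral_hermiteOne_mul (m n : ℕ) :
    ∫ t, hermiteOne m t * hermiteOne n t = if m = n then 1 else 0 := by
  split_ifs with h
  · subst h
    simpa only [sq] using integral_hermiteOne_sq m
  · exact integral_hermiteOne_mul_of_ne h

lemma hermiteOne_energy_le (n : ℕ) : (∫ t, deriv (hermiteOne n) t ^ 2) ≤ 2 * n + 1 ∧
    ∫ t, t ^ 2 * hermiteOne n t ^ 2 ≤ 2 * n + 1 := by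
  have h := hermiteOne_energy n
  have h1 : 0 ≤ ∫ t, deriv (hermiteOne n) t ^ 2 := integral_nonneg fun t => sq_nonneg _
  have h2 : 0 ≤ ∫ t, t ^ 2 * hermiteOne n t ^ 2 := integral_nonneg fun t => by positivity
  rw [integral_hermiteOne_sq, mul_one] at h
  constructor <;> linarith

/-- Hermite functions are bounded by an exponential of the degree, in `L^∞`. -/
lemma abs_hermiteOne_le (n : ℕ) (t : ℝ) : |hermiteOne n t| ≤ 6 * Real.exp n := by
  have h := (isPolyGauss_hermiteOne n).sq_le t
  have h1 := (hermiteOne_energy_le n).1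
  rw [integral_hermiteOne_sq] at h
  have h2 := Real.add_one_le_exp (n : ℝ)
  refine abs_le_of_sq_le_sq ?_ (by positivity)
  nlinarith [sq_nonneg (Real.exp n)]

/-- Hermite functions are bounded by an exponential of the degree, in `L¹`. -/
lemma integral_abs_hermiteOne_le (n : ℕ) : ∫ t, |hermiteOne n t| ≤ 6 * Real.exp n := by
  have h := (isPolyGauss_hermiteOne n).integral_abs_le
  have h1 := (hermiteOne_energy_le n).2
  rw [integral_hermiteOne_sq] at h
  have h2 := Real.add_one_le_exp (n : ℝ)
  have := Real.pi_le_four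
  have : (0 : ℝ) ≤ n := by positivity
  linarith

/-! ### The generating function of the Hermite functions on the line. -/

lemma iteratedDeriv_cexp_neg_sq (n : ℕ) (t : ℝ) :
    iteratedDeriv n (fun w : ℂ => Complex.exp (-w ^ 2)) t = (gaussDeriv n t : ℂ) := by
  have hs : ContDiff ℂ ∞ (fun w : ℂ => Complex.exp (-w ^ 2)) := by fun_prop
  induction n generalizing t with
  | zero => simp [gaussDeriv]
  | succ n ih =>
    have hd : Differentiable ℂ (iteratedDeriv n fun w : ℂ => Complex.exp (-w ^ 2)) :=
      hs.differentiable_iteratedDeriv n (by exact_mod_cast WithTop.coe_lt_top _)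
    have h1 := ((hd t).hasDerivAt).comp_ofReal
    rw [funext ih] at h1
    rw [iteratedDeriv_succ]
    exact h1.unique (gaussDeriv_hasDerivAt n t).ofReal_comp

/-- The Taylor series at the real point `t` of the entire function `e^{-w²}`, whose complex
derivatives there are the real ones. The increment has to be complex because the Bargmann variable
is. -/
lemma hasSum_gaussDeriv (t : ℝ) (s : ℂ) :
    HasSum (fun n : ℕ => (n.factorial : ℂ)⁻¹ * s ^ n * (gaussDeriv n t : ℂ))
      (Complex.exp (-(t + s) ^ 2)) := by
  have hs : Differentiable ℂ (fun w : ℂ => Complex.exp (-w ^ 2)) := by fun_prop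
  have h := Complex.hasSum_taylorSeries_of_entire hs t (t + s)
  simpa [iteratedDeriv_cexp_neg_sq, mul_assoc] using h

/-- The one-dimensional Bargmann kernel `π^{-1/4} e^{-(z² + t²)/2 + √2 z t}`. -/
def kernelOne (z : ℂ) (t : ℝ) : ℂ :=
  ((Real.pi ^ (-(1 / 4 : ℝ)) : ℝ) : ℂ) *
    Complex.exp (-(z ^ 2 + t ^ 2) / 2 + (Real.sqrt 2 : ℂ) * z * t)

lemma hermiteConst_div_sqrt (n : ℕ) : hermiteConst n * (Real.sqrt n.factorial)⁻¹ =
    Real.pi ^ (-(1 / 4 : ℝ)) * ((n.factorial : ℝ)⁻¹ * (-(Real.sqrt 2)⁻¹) ^ n) := by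
  have h1 : ((2 : ℝ) ^ n * n.factorial) ^ (-(1 / 2 : ℝ)) =
      ((Real.sqrt 2)⁻¹) ^ n * (Real.sqrt n.factorial)⁻¹ := by
    rw [Real.rpow_neg (by positivity), ← Real.sqrt_eq_rpow, Real.sqrt_mul (by positivity),
      mul_inv, inv_pow]
    congr 2
    rw [Real.sqrt_eq_iff_mul_self_eq (by positivity) (by positivity), ← mul_pow]
    simp
  have h2 : (Real.sqrt n.factorial)⁻¹ * (Real.sqrt n.factorial)⁻¹ = (n.factorial : ℝ)⁻¹ := by
    rw [← mul_inv, Real.mul_self_sqrt (by positivity)]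
  rw [hermiteConst, h1, ← h2, neg_pow (Real.sqrt 2)⁻¹]
  ring

/-- The generating function of the one-dimensional Hermite functions. -/
lemma hasSum_hermiteOne (z : ℂ) (t : ℝ) :
    HasSum (fun n : ℕ => (hermiteOne n t : ℂ) * (z ^ n / (Real.sqrt n.factorial : ℂ)))
      (kernelOne z t) := by
  -- The increment `-z/√2` absorbs the factors `(-1)^n 2^{-n/2}` of the normalisation, and `t²/2 -
  -- (t - z/√2)² = -(z² + t²)/2 + √2 z t`.
  have h := (hasSum_gaussDeriv t (-(Real.sqrt 2 : ℂ)⁻¹ * z)).mul_left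
    (((Real.pi ^ (-(1 / 4 : ℝ)) : ℝ) : ℂ) * Complex.exp (t ^ 2 / 2))
  convert! h using 1
  · funext n
    have h1 := congrArg (fun x : ℝ => (x : ℂ)) (hermiteConst_div_sqrt n)
    simp only [Complex.ofReal_mul, Complex.ofReal_inv, Complex.ofReal_pow, Complex.ofReal_neg,
      Complex.ofReal_natCast] at h1
    rw [hermiteOne_eq, mul_pow]
    push_cast
    linear_combination (Complex.exp (t ^ 2 / 2) * gaussDeriv n t * z ^ n) * h1
  · rw [kernelOne, mul_assoc _ _ (Complex.exp _), ← Complex.exp_add]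
    congr 2
    have h2 : (Real.sqrt 2 : ℂ) * (Real.sqrt 2 : ℂ) = 2 := by
      rw [← Complex.ofReal_mul, Real.mul_self_sqrt (by norm_num)]; norm_num
    have h3 : (Real.sqrt 2 : ℂ) ≠ 0 := fun h => by simp [h] at h2
    field_simp
    linear_combination (2 * (t : ℂ) * z * (Real.sqrt 2 : ℂ) - z ^ 2) * h2

/-! ### Sums over multi-indices -/

section MultiIndexSums

variable {d : ℕ}

/-- Every finite set of indices lies in a cube, and the sum over a cube factors. -/
lemma summable_norm_prod_pi {f : Fin d → ℕ → ℂ} (hf : ∀ i, Summable fun n => ‖f i n‖) :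
    Summable fun a : Fin d → ℕ => ‖∏ i, f i (a i)‖ := by
  refine summable_of_sum_le (c := ∏ i, ∑' n, ‖f i n‖) (fun _ => norm_nonneg _) fun u => ?_
  obtain ⟨N, hN⟩ : ∃ N, ∀ a ∈ u, ∀ i, a i < N := by
    refine ⟨u.sup (fun a => ∑ i, a i) + 1, fun a ha i => Nat.lt_succ_of_le ?_⟩
    exact (Finset.single_le_sum (fun _ _ => Nat.zero_le _) (Finset.mem_univ i)).trans
      (Finset.le_sup (f := fun a : Fin d → ℕ => ∑ i, a i) ha)
  calc ∑ a ∈ u, ‖∏ i, f i (a i)‖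
      ≤ ∑ a ∈ Fintype.piFinset fun _ : Fin d => Finset.range N, ‖∏ i, f i (a i)‖ :=
        Finset.sum_le_sum_of_subset_of_nonneg (fun a ha => by
          simpa [Fintype.mem_piFinset] using hN a ha) fun _ _ _ => norm_nonneg _
    _ = ∏ i, ∑ n ∈ Finset.range N, ‖f i n‖ := by
        simp only [norm_prod]
        rw [Finset.prod_univ_sum]
    _ ≤ _ := Finset.prod_le_prod (fun i _ => Finset.sum_nonneg fun _ _ => norm_nonneg _)
        fun i _ => (hf i).sum_le_tsum _ fun _ _ => norm_nonneg _

/-- As the sum exists unconditionally, its value may be computed along cubes, where the partial sums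
are products. -/
lemma hasSum_prod_pi {f : Fin d → ℕ → ℂ} {S : Fin d → ℂ} (hf : ∀ i, HasSum (f i) (S i)) :
    HasSum (fun a : Fin d → ℕ => ∏ i, f i (a i)) (∏ i, S i) := by
  have h1 := (summable_norm_prod_pi fun i => (hf i).summable.norm).of_norm.hasSum
  have h2 : Tendsto (fun N : ℕ => Fintype.piFinset fun _ : Fin d => Finset.range N) atTop atTop :=
    tendsto_atTop_finset_of_monotone
      (fun M N h => Fintype.piFinset_subset _ _ fun _ => Finset.range_mono h) fun a =>
      ⟨∑ i, a i + 1, by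
        rw [Fintype.mem_piFinset]
        exact fun i => Finset.mem_range.2 (Nat.lt_succ_of_le
          (Finset.single_le_sum (fun _ _ => Nat.zero_le _) (Finset.mem_univ i)))⟩
  have h3 : Tendsto (fun N : ℕ => ∏ i, ∑ n ∈ Finset.range N, f i n) atTop (𝓝 (∏ i, S i)) :=
    tendsto_finsetProd _ fun i _ => (hf i).tendsto_sum_nat
  have h4 := h1.comp h2
  simp only [Function.comp_def, ← Finset.prod_univ_sum] at h4
  rw [tendsto_nhds_unique h3 h4]
  exact h1

lemma hasSum_prod_multiIndex {f : Fin d → ℕ → ℂ} {S : Fin d → ℂ}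
    (hf : ∀ i, HasSum (f i) (S i)) :
    HasSum (fun α : MultiIndex d => ∏ i, f i (α i)) (∏ i, S i) := by
  let e : MultiIndex d ≃ (Fin d → ℕ) := Finsupp.equivFunOnFinite
  have h := e.hasSum_iff (f := fun a => ∏ i, f i (a i)) (a := ∏ i, S i)
  exact h.2 (hasSum_prod_pi hf)

lemma prod_pow_eq_pow_order {R : Type*} [CommMonoid R] (q : R) (α : MultiIndex d) :
    ∏ i, q ^ α i = q ^ order α := by
  rw [order, Finset.prod_pow_eq_pow_sum]

lemma summable_pow_order {q : ℝ} (hq0 : 0 ≤ q) (hq : q < 1) :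
    Summable fun α : MultiIndex d => q ^ order α := by
  have h := (hasSum_prod_multiIndex (d := d) fun _ =>
    hasSum_geometric_of_norm_lt_one (ξ := (q : ℂ)) (by
      rwa [Complex.norm_real, Real.norm_of_nonneg hq0])).summable.norm
  refine h.congr fun α => ?_
  rw [prod_pow_eq_pow_order, norm_pow, Complex.norm_real, Real.norm_of_nonneg hq0]

end MultiIndexSums

/-! ### Normalised monomials -/

/-- The function `e_α(z) = z^α / √(α!)` on `ℂᵈ`. -/
def monomialFun {d : ℕ} (α : MultiIndex d) (z : Cd d) : ℂ :=
  (∏ i, z i ^ α i) / (Real.sqrt (multiFactorial α) : ℂ)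

section Monomial

variable {d : ℕ}

lemma monomialFun_eq_prod (α : MultiIndex d) (z : Cd d) :
    monomialFun α z = ∏ i, (z i ^ α i / (Real.sqrt (α i).factorial : ℂ)) := by
  rw [monomialFun, Finset.prod_div_distrib, multiFactorial, ← Complex.ofReal_prod]
  congr 2
  push_cast
  exact Real.sqrt_prod _ fun i _ => by positivity

lemma hasEntireSum_bargmann_iff {c : FormalHermite d} {F : Cd d → ℂ} :
    HasEntireSum (bargmann c) F ↔ ∀ z, HasSum (fun α => c α * monomialFun α z) (F z) := by
  refine forall_congr' fun z => ?_
  have : ∀ α : MultiIndex d, MvPowerSeries.coeff α (bargmann c) * ∏ i, z i ^ α i =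
      c α * monomialFun α z := fun α => by
    change c α / _ * _ = _
    rw [monomialFun]
    ring
  simp only [this]

/-- After squaring, `(x²/q²)^n / n!` is one term of the series of `e^{x²/q²}`. The free parameter
`q` trades geometric decay in `n` against the Gaussian exponent. -/
lemma pow_div_sqrt_factorial_le (x : ℝ) {q : ℝ} (hq : 0 < q) (n : ℕ) :
    x ^ n / Real.sqrt n.factorial ≤ q ^ n * Real.exp (x ^ 2 / (2 * q ^ 2)) := by
  have h := Real.pow_div_factorial_le_exp (x ^ 2 / q ^ 2) (by positivity) n
  rw [div_le_iff₀ (by positivity)] at h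
  rw [div_le_iff₀ (by positivity)]
  refine le_of_sq_le_sq ?_ (by positivity)
  rw [mul_pow, mul_pow, Real.sq_sqrt (by positivity), ← Real.exp_nat_mul]
  have h1 : ((2 : ℕ) : ℝ) * (x ^ 2 / (2 * q ^ 2)) = x ^ 2 / q ^ 2 := by
    push_cast
    field_simp
  rw [h1]
  have h2 : (x ^ n) ^ 2 = (q ^ n) ^ 2 * (x ^ 2 / q ^ 2) ^ n := by
    rw [div_pow, ← pow_mul, ← pow_mul, ← pow_mul, ← pow_mul, mul_comm n 2]
    field_simp
  rw [h2, mul_assoc]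
  exact mul_le_mul_of_nonneg_left h (by positivity)

lemma norm_monomialFun_le {q : ℝ} (hq : 0 < q) (α : MultiIndex d) (z : Cd d) :
    ‖monomialFun α z‖ ≤ q ^ order α * Real.exp (‖z‖ ^ 2 / (2 * q ^ 2)) := by
  rw [monomialFun_eq_prod, norm_prod, EuclideanSpace.norm_sq_eq, Finset.sum_div, Real.exp_sum,
    ← prod_pow_eq_pow_order, ← Finset.prod_mul_distrib]
  refine Finset.prod_le_prod (fun _ _ => norm_nonneg _) fun i _ => ?_
  rw [norm_div, norm_pow, Complex.norm_real, Real.norm_of_nonneg (Real.sqrt_nonneg _)]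
  exact pow_div_sqrt_factorial_le _ hq _

lemma mul_norm_monomialFun_le {r C : ℝ} {c : FormalHermite d}
    (hc : ∀ α, ‖c α‖ ≤ C * Real.exp (r * order α)) (α : MultiIndex d) (z : Cd d) :
    ‖c α * monomialFun α z‖ ≤
      C * (1 / 2) ^ order α * Real.exp (2 * Real.exp (2 * r) * ‖z‖ ^ 2) := by
  have hC : 0 ≤ C := nonneg_of_mul_nonneg_left ((norm_nonneg _).trans (hc α)) (Real.exp_pos _)
  -- With `q = e^{-r}/2` the growth `e^{r|α|}` cancels, the summable factor `2^{-|α|}` remains, and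
  -- `1/(2q²) = 2 e^{2r}`.
  have h := norm_monomialFun_le (q := 1 / 2 * Real.exp (-r)) (by positivity) α z
  rw [norm_mul]
  refine (mul_le_mul (hc α) h (norm_nonneg _) (by positivity)).trans_eq ?_
  have h1 : ‖z‖ ^ 2 / (2 * (1 / 2 * Real.exp (-r)) ^ 2) = 2 * Real.exp (2 * r) * ‖z‖ ^ 2 := by
    rw [mul_pow, ← Real.exp_nat_mul]
    have : ((2 : ℕ) : ℝ) * -r = -(2 * r) := by push_cast; ring
    rw [this, Real.exp_neg]
    field_simp
  have h2 : Real.exp (r * order α) * Real.exp (-r) ^ order α = 1 := by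
    rw [← Real.exp_nat_mul, ← Real.exp_add, ← Real.exp_zero]
    ring_nf
  rw [h1, mul_pow]
  linear_combination (C * (1 / 2) ^ order α * Real.exp (2 * Real.exp (2 * r) * ‖z‖ ^ 2)) * h2

lemma summable_norm_mul_monomialFun {r C : ℝ} {c : FormalHermite d}
    (hc : ∀ α, ‖c α‖ ≤ C * Real.exp (r * order α)) (z : Cd d) :
    Summable fun α => ‖c α * monomialFun α z‖ :=
  Summable.of_nonneg_of_le (fun _ => norm_nonneg _) (fun α => mul_norm_monomialFun_le hc α z)
    (((summable_pow_order (by norm_num) (by norm_num)).mul_left C).mul_right _)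

end Monomial

/-! ### Hermite functions in several variables -/

section HermiteFun

variable {d : ℕ}

lemma integral_prod_euclidean {𝕜 : Type*} [RCLike 𝕜] (f : Fin d → ℝ → 𝕜) :
    ∫ x : Rd d, ∏ i, f i (x i) = ∏ i, ∫ t, f i t := by
  rw [← integral_fintype_prod_volume_eq_prod (fun i : Fin d => f i),
    ← (EuclideanSpace.volume_preserving_symm_measurableEquiv_toLp (Fin d)).integral_comp'
      (fun y : Fin d → ℝ => ∏ i, f i (y i))]
  rfl

lemma integrable_prod_euclidean {𝕜 : Type*} [RCLike 𝕜] {f : Fin d → ℝ → 𝕜}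
    (hf : ∀ i, Integrable (f i)) : Integrable fun x : Rd d => ∏ i, f i (x i) := by
  have h := Integrable.fintype_prod (μ := fun _ : Fin d => volume) hf
  exact (EuclideanSpace.volume_preserving_symm_measurableEquiv_toLp (Fin d)).integrable_comp_emb
    (MeasurableEquiv.measurableEmbedding _) |>.2 h

lemma prodFun_eq (Φ : Fin d → ℝ → ℝ) (x : Rd d) : prodFun Φ x = ∏ i, (Φ i (x i) : ℂ) := by
  rw [prodFun, Complex.ofReal_prod]

lemma integrable_prodFun {Φ : Fin d → ℝ → ℝ} (hΦ : ∀ i, Integrable (Φ i)) :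
    Integrable (prodFun Φ) := by
  rw [funext (prodFun_eq Φ)]
  exact integrable_prod_euclidean fun i => (hΦ i).ofReal

lemma continuous_hermiteFun (α : MultiIndex d) : Continuous (hermiteFun α) :=
  (hermiteFun_smooth α).continuous

lemma integrable_hermiteFun (α : MultiIndex d) : Integrable (hermiteFun α) :=
  integrable_prodFun fun i => (isPolyGauss_hermiteOne (α i)).integrable

lemma prod_six_mul_exp (α : MultiIndex d) :
    ∏ i, (6 * Real.exp (α i)) = 6 ^ d * Real.exp (order α) := by
  rw [Finset.prod_mul_distrib, ← Real.exp_sum, order]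
  simp

lemma norm_hermiteFun_le (α : MultiIndex d) (x : Rd d) :
    ‖hermiteFun α x‖ ≤ 6 ^ d * Real.exp (order α) := by
  rw [hermiteFun, Complex.norm_real, Real.norm_eq_abs, Finset.abs_prod, ← prod_six_mul_exp]
  exact Finset.prod_le_prod (fun _ _ => abs_nonneg _) fun i _ => abs_hermiteOne_le _ _

lemma integral_norm_hermiteFun_le (α : MultiIndex d) :
    ∫ x, ‖hermiteFun α x‖ ≤ 6 ^ d * Real.exp (order α) := by
  simp only [hermiteFun, Complex.norm_real, Real.norm_eq_abs, Finset.abs_prod]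
  rw [integral_prod_euclidean (fun i t => |hermiteOne (α i) t|), ← prod_six_mul_exp]
  exact Finset.prod_le_prod (fun _ _ => integral_nonneg fun _ => abs_nonneg _)
    fun i _ => integral_abs_hermiteOne_le _

lemma integral_hermiteFun_mul (α β : MultiIndex d) :
    ∫ x, hermiteFun α x * hermiteFun β x = if α = β then 1 else 0 := by
  have h : ∀ x : Rd d, hermiteFun α x * hermiteFun β x =
      ((∏ i, (hermiteOne (α i) (x i) * hermiteOne (β i) (x i)) : ℝ) : ℂ) := fun x => by
    rw [hermiteFun, hermiteFun, ← Complex.ofReal_mul, Finset.prod_mul_distrib]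
  simp only [h]
  rw [integral_complex_ofReal, integral_prod_euclidean (fun i t => hermiteOne (α i) t * hermiteOne (β i) t)]
  simp only [integral_hermiteOne_mul]
  split_ifs with hαβ
  · simp [hαβ]
  · obtain ⟨i, hi⟩ : ∃ i, α i ≠ β i := by
      by_contra! h
      exact hαβ (Finsupp.ext h)
    rw [Finset.prod_eq_zero (Finset.mem_univ i) (if_neg hi), Complex.ofReal_zero]

/-- The Bargmann kernel. -/
def bargmannKernel (z : Cd d) (x : Rd d) : ℂ := ∏ i, kernelOne (z i) (x i)

/-- The Hermite functions have the Bargmann kernel as their generating function. -/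
lemma hasSum_hermiteFun (z : Cd d) (x : Rd d) :
    HasSum (fun α => hermiteFun α x * monomialFun α z) (bargmannKernel z x) := by
  refine (hasSum_prod_multiIndex fun i => hasSum_hermiteOne (z i) (x i)).congr_fun ?_
  intro α
  rw [Finset.prod_mul_distrib, monomialFun_eq_prod, hermiteFun, Complex.ofReal_prod]

lemma integrable_bounded_mul_hermiteFun {f : Rd d → ℂ} (hf : Continuous f) {M : ℝ}
    (hM : ∀ x, ‖f x‖ ≤ M) (α : MultiIndex d) : Integrable fun x => f x * hermiteFun α x :=
  (integrable_hermiteFun α).bdd_mul hf.aestronglyMeasurable (Eventually.of_forall hM)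

lemma integral_norm_bounded_mul_hermiteFun_le {f : Rd d → ℂ} (hf : Continuous f) {M : ℝ}
    (hM : ∀ x, ‖f x‖ ≤ M) (α : MultiIndex d) :
    ∫ x, ‖f x * hermiteFun α x‖ ≤ M * (6 ^ d * Real.exp (order α)) := by
  have hM0 : 0 ≤ M := (norm_nonneg _).trans (hM 0)
  calc ∫ x, ‖f x * hermiteFun α x‖ ≤ ∫ x, M * ‖hermiteFun α x‖ :=
        integral_mono (integrable_bounded_mul_hermiteFun hf hM α).norm
          ((integrable_hermiteFun α).norm.const_mul M) fun x => by
            simp only [norm_mul]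
            exact mul_le_mul_of_nonneg_right (hM x) (norm_nonneg _)
    _ ≤ _ := by
      rw [integral_const_mul]
      exact mul_le_mul_of_nonneg_left (integral_norm_hermiteFun_le α) hM0

/-- The Bargmann transform of a bounded continuous function, as an integral and as a series. -/
lemma hasSum_integral_mul_bargmannKernel {f : Rd d → ℂ} (hf : Continuous f) {M : ℝ}
    (hM : ∀ x, ‖f x‖ ≤ M) (z : Cd d) :
    HasSum (fun α => (∫ x, f x * hermiteFun α x) * monomialFun α z)
      (∫ x, f x * bargmannKernel z x) := by
  have h1 : ∀ α : MultiIndex d, Integrable fun x => f x * hermiteFun α x * monomialFun α z :=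
    fun α => (integrable_bounded_mul_hermiteFun hf hM α).mul_const _
  -- The `L¹` norms of the `h_α` grow at most like `e^{|α|}`, so they are admissible coefficients
  -- with `r = 1`, and sum and integral may be interchanged.
  have h2 : Summable fun α : MultiIndex d =>
      ∫ x, ‖f x * hermiteFun α x * monomialFun α z‖ := by
    refine Summable.of_nonneg_of_le (fun α => integral_nonneg fun x => norm_nonneg _) (fun α => ?_)
      (summable_norm_mul_monomialFun (r := 1) (C := M * 6 ^ d)
        (c := fun α : MultiIndex d => (M * 6 ^ d * Real.exp (order α) : ℝ)) (fun α => ?_) z)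
    · simp only [norm_mul _ (monomialFun α z)]
      rw [integral_mul_const]
      refine mul_le_mul_of_nonneg_right ?_ (norm_nonneg _)
      refine (integral_norm_bounded_mul_hermiteFun_le hf hM α).trans ?_
      rw [Complex.norm_real, ← mul_assoc]
      exact le_abs_self _
    · have hM0 : 0 ≤ M := (norm_nonneg _).trans (hM 0)
      rw [Complex.norm_real, Real.norm_of_nonneg (by positivity), one_mul]
  have h3 := hasSum_integral_of_summable_integral_norm h1 h2
  simp only [integral_mul_const] at h3
  convert! h3 using 3
  simp only [mul_assoc]
  rw [tsum_mul_left, (hasSum_hermiteFun z _).tsum_eq]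

/-- The Bargmann transform of `h_α` is `e_α`. -/
lemma integral_hermiteFun_mul_bargmannKernel (α : MultiIndex d) (z : Cd d) :
    ∫ x, hermiteFun α x * bargmannKernel z x = monomialFun α z := by
  have h := hasSum_integral_mul_bargmannKernel (continuous_hermiteFun α) (norm_hermiteFun_le α) z
  simp only [integral_hermiteFun_mul, ite_mul, one_mul, zero_mul] at h
  refine h.unique ?_
  convert! hasSum_ite_eq α (monomialFun α z) using 2 with β
  by_cases hβ : β = α
  · simp [hβ]
  · simp [hβ, Ne.symm hβ]

end HermiteFun

/-! ### Symmetry of the harmonic oscillator -/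

section Symmetry

variable {d : ℕ}

lemma contDiff_fderiv_apply {f : Rd d → ℂ} (hf : ContDiff ℝ ∞ f) (v : Rd d) :
    ContDiff ℝ ∞ fun x => fderiv ℝ f x v :=
  (hf.fderiv_right (m := ∞) (by norm_cast)).clm_apply contDiff_const

lemma laplacian_eq_sum_fderiv {f : Rd d → ℂ} (hf : ContDiff ℝ ∞ f) (x : Rd d) :
    Laplacian.laplacian f x = ∑ i : Fin d,
      fderiv ℝ (fun y => fderiv ℝ f y (EuclideanSpace.basisFun (Fin d) ℝ i)) x
        (EuclideanSpace.basisFun (Fin d) ℝ i) := by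
  rw [InnerProductSpace.laplacian_eq_iteratedFDeriv_orthonormalBasis _
    (EuclideanSpace.basisFun (Fin d) ℝ)]
  refine Finset.sum_congr rfl fun i _ => ?_
  have hd : DifferentiableAt ℝ (fderiv ℝ f) x :=
    ((hf.fderiv_right (m := 1) (by norm_cast)).differentiable (by simp)) x
  rw [iteratedFDeriv_two_apply, fderiv_clm_apply hd (differentiableAt_const _)]
  simp

lemma integrable_mul_of_hasCompactSupport {f g : Rd d → ℂ} (hf : Continuous f)
    (hg : Continuous g) (hgc : HasCompactSupport g) : Integrable fun x => f x * g x :=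
  (hf.mul hg).integrable_of_hasCompactSupport hgc.mul_left

lemma hasCompactSupport_fderiv_apply {g : Rd d → ℂ} (hgc : HasCompactSupport g) (v : Rd d) :
    HasCompactSupport fun x => fderiv ℝ g x v :=
  (hgc.fderiv ℝ).comp_left (g := fun L : Rd d →L[ℝ] ℂ => L v) rfl

/-- Two integrations by parts; the compact support of `g` makes every product integrable whatever
the growth of `f`. -/
lemma integral_mul_fderiv_fderiv {f g : Rd d → ℂ} (hf : ContDiff ℝ ∞ f) (hg : ContDiff ℝ ∞ g)
    (hgc : HasCompactSupport g) (v : Rd d) :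
    ∫ x, f x * fderiv ℝ (fun y => fderiv ℝ g y v) x v =
      ∫ x, fderiv ℝ (fun y => fderiv ℝ f y v) x v * g x := by
  have hf1 := contDiff_fderiv_apply hf v
  have hg1 := contDiff_fderiv_apply hg v
  have hgc1 := hasCompactSupport_fderiv_apply hgc v
  rw [integral_mul_fderiv_eq_neg_fderiv_mul_of_integrable
    (integrable_mul_of_hasCompactSupport hf1.continuous hg1.continuous hgc1)
    (integrable_mul_of_hasCompactSupport hf.continuous (contDiff_fderiv_apply hg1 v).continuous
      (hasCompactSupport_fderiv_apply hgc1 v))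
    (integrable_mul_of_hasCompactSupport hf.continuous hg1.continuous hgc1)
    (fun x _ => hf.differentiable (by simp) x) (fun x _ => hg1.differentiable (by simp) x),
    integral_mul_fderiv_eq_neg_fderiv_mul_of_integrable
    (integrable_mul_of_hasCompactSupport (contDiff_fderiv_apply hf1 v).continuous hg.continuous hgc)
    (integrable_mul_of_hasCompactSupport hf1.continuous hg1.continuous hgc1)
    (integrable_mul_of_hasCompactSupport hf1.continuous hg.continuous hgc)
    (fun x _ => hf1.differentiable (by simp) x) (fun x _ => hg.differentiable (by simp) x), neg_neg]

lemma integral_mul_laplacian {f g : Rd d → ℂ} (hf : ContDiff ℝ ∞ f) (hg : ContDiff ℝ ∞ g)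
    (hgc : HasCompactSupport g) :
    ∫ x, f x * Laplacian.laplacian g x = ∫ x, Laplacian.laplacian f x * g x := by
  simp only [laplacian_eq_sum_fderiv hf, laplacian_eq_sum_fderiv hg, Finset.mul_sum,
    Finset.sum_mul]
  rw [integral_finsetSum, integral_finsetSum]
  · exact Finset.sum_congr rfl fun i _ => integral_mul_fderiv_fderiv hf hg hgc _
  · exact fun i _ => integrable_mul_of_hasCompactSupport
      (contDiff_fderiv_apply (contDiff_fderiv_apply hf _) _).continuous hg.continuous hgc
  · exact fun i _ => integrable_mul_of_hasCompactSupport hf.continuous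
      (contDiff_fderiv_apply (contDiff_fderiv_apply hg _) _).continuous
      (hasCompactSupport_fderiv_apply (hasCompactSupport_fderiv_apply hgc _) _)

/-- The harmonic oscillator on arbitrary functions. -/
def oscFun (f : Rd d → ℂ) (x : Rd d) : ℂ :=
  ((‖x‖ ^ 2 : ℝ) : ℂ) * f x - Laplacian.laplacian f x

lemma integral_mul_oscFun {f g : Rd d → ℂ} (hf : ContDiff ℝ ∞ f) (hg : ContDiff ℝ ∞ g)
    (hgc : HasCompactSupport g) :
    ∫ x, f x * oscFun g x = ∫ x, oscFun f x * g x := by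
  have hn : Continuous fun x : Rd d => ((‖x‖ ^ 2 : ℝ) : ℂ) := by fun_prop
  have hlg : HasCompactSupport (Laplacian.laplacian g) := by
    refine HasCompactSupport.intro' hgc (isClosed_tsupport g) fun x hx => ?_
    have h0 : g =ᶠ[𝓝 x] 0 := notMem_tsupport_iff_eventuallyEq.1 hx
    rw [(InnerProductSpace.laplacian_congr_nhds h0).eq_of_nhds]
    have := InnerProductSpace.laplacian_const (E := Rd d) (F := ℂ) (c := 0)
    exact congrFun this x
  have h1 : Integrable fun x => ((‖x‖ ^ 2 : ℝ) : ℂ) * f x * g x :=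
    integrable_mul_of_hasCompactSupport (hn.mul hf.continuous) hg.continuous hgc
  have h2 := integrable_mul_of_hasCompactSupport hf.continuous
    (laplacian_smooth hg).continuous hlg
  have h3 := integrable_mul_of_hasCompactSupport (laplacian_smooth hf).continuous
    hg.continuous hgc
  have e1 : ∀ x, f x * oscFun g x = ((‖x‖ ^ 2 : ℝ) : ℂ) * f x * g x -
    f x * Laplacian.laplacian g x := fun x => by rw [oscFun]; ring
  have e2 : ∀ x, oscFun f x * g x = ((‖x‖ ^ 2 : ℝ) : ℂ) * f x * g x -
    Laplacian.laplacian f x * g x := fun x => by rw [oscFun]; ring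
  simp only [e1, e2]
  rw [integral_sub h1 h2, integral_sub h1 h3, integral_mul_laplacian hf hg hgc]

/-- The harmonic oscillator is a sum of one-variable oscillators. This reduces the majorant for
cut-off Hermite functions to estimates in one variable. -/
lemma oscFun_prodFun {Φ : Fin d → ℝ → ℝ} (hΦ : ∀ i, ContDiff ℝ ∞ (Φ i)) (x : Rd d) :
    oscFun (prodFun Φ) x = ∑ i, prodFun (Function.update Φ i
      fun t => t ^ 2 * Φ i t - deriv (deriv (Φ i)) t) x := by
  rw [oscFun, prodFun_laplacian hΦ, EuclideanSpace.norm_sq_eq, Complex.ofReal_sum,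
    Finset.sum_mul, ← Finset.sum_sub_distrib]
  refine Finset.sum_congr rfl fun i _ => ?_
  have h : ∀ Ψ : ℝ → ℝ, prodFun (Function.update Φ i Ψ) x =
      ((Ψ (x i) * ∏ j ∈ Finset.univ.erase i, Φ j (x j) : ℝ) : ℂ) := fun Ψ => by
    rw [prodFun, ← Finset.mul_prod_erase _ _ (Finset.mem_univ i), Function.update_self]
    congr 2
    exact Finset.prod_congr rfl fun j hj => by simp [Finset.ne_of_mem_erase hj]
  have h0 : prodFun Φ x = ((Φ i (x i) * ∏ j ∈ Finset.univ.erase i, Φ j (x j) : ℝ) : ℂ) := by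
    rw [prodFun, ← Finset.mul_prod_erase _ _ (Finset.mem_univ i)]
  rw [h, h, h0, Real.norm_eq_abs, sq_abs]
  push_cast
  ring

/-- A smooth cutoff function, equal to `1` on `[-1, 1]` and supported in `[-2, 2]`. -/
def cutoffBump : ContDiffBump (0 : ℝ) := ⟨1, 2, one_pos, one_lt_two⟩

/-- The cutoff function at scale `k + 1`. -/
def cutoff (k : ℕ) (t : ℝ) : ℝ := cutoffBump (((k : ℝ) + 1)⁻¹ * t)

lemma contDiff_cutoff (k : ℕ) : ContDiff ℝ ∞ (cutoff k) :=
  cutoffBump.contDiff.comp (contDiff_const.mul contDiff_id)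

lemma cutoff_eventually_eq_one {k : ℕ} {t : ℝ} (h : |t| < k + 1) :
    ∀ᶠ s in 𝓝 t, cutoff k s = 1 := by
  filter_upwards [(isOpen_lt continuous_abs continuous_const).mem_nhds h] with s hs
  refine cutoffBump.one_of_mem_closedBall ?_
  have hk : (0 : ℝ) < k + 1 := by positivity
  rw [mem_closedBall_zero_iff, Real.norm_eq_abs, abs_mul, abs_of_pos (by positivity),
    inv_mul_le_iff₀ hk]
  change |s| < k + 1 at hs
  change |s| ≤ (k + 1) * 1
  linarith

lemma hasCompactSupport_cutoff (k : ℕ) : HasCompactSupport (cutoff k) := by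
  have hk : ((k : ℝ) + 1)⁻¹ ≠ 0 := by positivity
  exact cutoffBump.hasCompactSupport.comp_homeomorph (Homeomorph.mulLeft₀ _ hk)

lemma abs_cutoff_le (k : ℕ) (t : ℝ) : |cutoff k t| ≤ 1 := by
  rw [cutoff, abs_of_nonneg cutoffBump.nonneg]
  exact cutoffBump.le_one

/-- Each derivative of the rescaled bump brings out a factor `1/(k + 1) ≤ 1`, so the bounds for the
bump itself serve every scale. -/
lemma exists_abs_deriv_cutoff_le : ∃ A : ℝ, 0 ≤ A ∧ ∀ k t, |deriv (cutoff k) t| ≤ A ∧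
    |deriv (deriv (cutoff k)) t| ≤ A := by
  have hs : ContDiff ℝ ∞ (cutoffBump : ℝ → ℝ) := cutoffBump.contDiff
  have hs1 := (contDiff_infty_iff_deriv.1 hs).2
  have hs2 := (contDiff_infty_iff_deriv.1 hs1).2
  obtain ⟨A, hA⟩ := cutoffBump.hasCompactSupport.deriv.exists_bound_of_continuous hs1.continuous
  obtain ⟨B, hB⟩ :=
    cutoffBump.hasCompactSupport.deriv.deriv.exists_bound_of_continuous hs2.continuous
  have hA0 := (norm_nonneg _).trans (hA 0)
  have hB0 := (norm_nonneg _).trans (hB 0)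
  refine ⟨A + B, by positivity, fun k t => ?_⟩
  have hk : |((k : ℝ) + 1)⁻¹| ≤ 1 := by
    rw [abs_of_pos (by positivity)]
    exact inv_le_one_of_one_le₀ (by linarith [(Nat.cast_nonneg k : (0 : ℝ) ≤ k)])
  have h1 : deriv (cutoff k) = fun t => ((k : ℝ) + 1)⁻¹ *
      deriv (cutoffBump : ℝ → ℝ) (((k : ℝ) + 1)⁻¹ * t) :=
    funext fun t => by
      change deriv (fun s => cutoffBump (((k : ℝ) + 1)⁻¹ * s)) t = _
      simpa using deriv_comp_mul_left ((k : ℝ) + 1)⁻¹ (cutoffBump : ℝ → ℝ) t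
  have h2 : deriv (deriv (cutoff k)) t = ((k : ℝ) + 1)⁻¹ * (((k : ℝ) + 1)⁻¹ *
      deriv (deriv (cutoffBump : ℝ → ℝ)) (((k : ℝ) + 1)⁻¹ * t)) := by
    rw [h1, deriv_const_mul_field]
    congr 1
    simpa using deriv_comp_mul_left ((k : ℝ) + 1)⁻¹ (deriv (cutoffBump : ℝ → ℝ)) t
  constructor
  · rw [h1, abs_mul]
    have := mul_le_mul hk (hA (((k : ℝ) + 1)⁻¹ * t)) (norm_nonneg _) zero_le_one
    rw [Real.norm_eq_abs] at this
    linarith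
  · rw [h2, abs_mul, abs_mul]
    have := mul_le_mul hk (mul_le_mul hk (hB (((k : ℝ) + 1)⁻¹ * t)) (norm_nonneg _) zero_le_one)
      (by positivity) zero_le_one
    rw [Real.norm_eq_abs] at this
    linarith

/-- The Hermite function, cut off at scale `k + 1`. -/
def cutHermite (α : MultiIndex d) (k : ℕ) : Rd d → ℂ :=
  prodFun fun i t => cutoff k t * hermiteOne (α i) t

lemma contDiff_cutHermite (α : MultiIndex d) (k : ℕ) : ContDiff ℝ ∞ (cutHermite α k) :=
  prodFun_smooth fun i => (contDiff_cutoff k).mul (hermiteOne_smooth (α i))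

lemma hasCompactSupport_cutHermite (α : MultiIndex d) (k : ℕ) :
    HasCompactSupport (cutHermite α k) := by
  have hK : IsCompact ((EuclideanSpace.equiv (Fin d) ℝ).symm ''
      (Set.univ.pi fun _ : Fin d => tsupport (cutoff k))) :=
    (isCompact_univ_pi fun _ => hasCompactSupport_cutoff k).image
      (EuclideanSpace.equiv (Fin d) ℝ).symm.continuous
  refine HasCompactSupport.intro hK fun x hx => ?_
  obtain ⟨i, hi⟩ : ∃ i, x i ∉ tsupport (cutoff k) := by
    by_contra! h
    exact hx ⟨fun i => x i, fun i _ => h i, rfl⟩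
  rw [cutHermite, prodFun, Finset.prod_eq_zero (Finset.mem_univ i), Complex.ofReal_zero]
  rw [image_eq_zero_of_notMem_tsupport hi, zero_mul]

/-- Agreement on a neighbourhood, rather than at `x` alone, is what makes the Laplacians agree at
`x` too. -/
lemma cutHermite_eventually_eq (α : MultiIndex d) (x : Rd d) :
    ∀ᶠ k in atTop, cutHermite α k =ᶠ[𝓝 x] hermiteFun α := by
  obtain ⟨K, hK⟩ := exists_nat_gt ‖x‖
  filter_upwards [eventually_ge_atTop K] with k hk
  have h1 : ∀ i : Fin d, ∀ᶠ y : Rd d in 𝓝 x, cutoff k (y i) = 1 := fun i => by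
    have hc : Tendsto (fun y : Rd d => y i) (𝓝 x) (𝓝 (x i)) :=
      (EuclideanSpace.proj i : Rd d →L[ℝ] ℝ).continuous.tendsto x
    refine hc.eventually (cutoff_eventually_eq_one ?_)
    have h2 : |x i| ≤ ‖x‖ := PiLp.norm_apply_le x i
    have h3 : (K : ℝ) ≤ k := by exact_mod_cast hk
    linarith
  filter_upwards [eventually_all.2 h1] with y hy
  simp only [cutHermite, prodFun, hermiteFun, hy, one_mul]

lemma norm_cutHermite_le (α : MultiIndex d) (k : ℕ) (x : Rd d) :
    ‖cutHermite α k x‖ ≤ ‖hermiteFun α x‖ := by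
  rw [cutHermite, prodFun, hermiteFun, Complex.norm_real, Complex.norm_real, Real.norm_eq_abs,
    Real.norm_eq_abs, Finset.abs_prod, Finset.abs_prod]
  refine Finset.prod_le_prod (fun _ _ => abs_nonneg _) fun i _ => ?_
  rw [abs_mul]
  exact mul_le_of_le_one_left (abs_nonneg _) (abs_cutoff_le _ _)

/-- A majorant independent of the scale `k`, for dominated convergence. -/
lemma exists_norm_oscFun_cutHermite_le (α : MultiIndex d) :
    ∃ G : Rd d → ℝ, Integrable G ∧ ∀ k x, ‖oscFun (cutHermite α k) x‖ ≤ G x := by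
  obtain ⟨A, hA0, hA⟩ := exists_abs_deriv_cutoff_le
  -- By Leibniz, `t² χh - (χh)''` consists of `t² χh`, `χ''h`, `2χ'h'` and `χh''`, which account for
  -- the last four terms. The first term dominates the factors on which the oscillator does not act.
  set G : Fin d → ℝ → ℝ := fun i t =>
    |hermiteOne (α i) t| + |t ^ 2 * hermiteOne (α i) t| + A * |hermiteOne (α i) t| +
      2 * A * |deriv (hermiteOne (α i)) t| + |deriv (deriv (hermiteOne (α i))) t| with hG
  have hGi : ∀ i, Integrable (G i) := fun i => by
    have h := isPolyGauss_hermiteOne (α i)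
    have h2 := (h.poly_mul (Polynomial.X ^ 2)).integrable
    simp only [Polynomial.eval_pow, Polynomial.eval_X] at h2
    exact (((h.integrable.abs.add h2.abs).add (h.integrable.abs.const_mul A)).add
      (h.deriv.integrable.abs.const_mul (2 * A))).add h.deriv.deriv.integrable.abs
  refine ⟨fun x => ∑ _i : Fin d, ∏ j, G j (x j),
    integrable_finsetSum _ fun _ _ => integrable_prod_euclidean hGi, fun k x => ?_⟩
  have hs : ∀ i, ContDiff ℝ ∞ fun t => cutoff k t * hermiteOne (α i) t := fun i =>
    (contDiff_cutoff k).mul (hermiteOne_smooth (α i))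
  rw [cutHermite, oscFun_prodFun hs]
  refine (norm_sum_le _ _).trans (Finset.sum_le_sum fun i _ => ?_)
  rw [prodFun, Complex.norm_real, Real.norm_eq_abs, Finset.abs_prod]
  refine Finset.prod_le_prod (fun _ _ => abs_nonneg _) fun j _ => ?_
  have hcut : |cutoff k (x j) * hermiteOne (α j) (x j)| ≤ |hermiteOne (α j) (x j)| := by
    rw [abs_mul]
    exact mul_le_of_le_one_left (abs_nonneg _) (abs_cutoff_le _ _)
  rcases eq_or_ne j i with rfl | hj
  · rw [Function.update_self]
    have hc : ∀ t, HasDerivAt (cutoff k) (deriv (cutoff k) t) t := fun t =>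
      ((contDiff_cutoff k).differentiable (by simp) t).hasDerivAt
    have hc1 : ∀ t, HasDerivAt (deriv (cutoff k)) (deriv (deriv (cutoff k)) t) t := fun t =>
      ((contDiff_infty_iff_deriv.1 (contDiff_cutoff k)).2.differentiable (by simp) t).hasDerivAt
    have h := isPolyGauss_hermiteOne (α j)
    have d1 : deriv (fun t => cutoff k t * hermiteOne (α j) t) = fun t =>
        deriv (cutoff k) t * hermiteOne (α j) t + cutoff k t * deriv (hermiteOne (α j)) t :=
      funext fun t => ((hc t).mul (h.hasDerivAt t)).deriv
    have d2 : deriv (deriv fun t => cutoff k t * hermiteOne (α j) t) (x j) =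
        (deriv (deriv (cutoff k)) (x j) * hermiteOne (α j) (x j) +
          deriv (cutoff k) (x j) * deriv (hermiteOne (α j)) (x j)) +
        (deriv (cutoff k) (x j) * deriv (hermiteOne (α j)) (x j) +
          cutoff k (x j) * deriv (deriv (hermiteOne (α j))) (x j)) := by
      rw [d1]
      exact (((hc1 (x j)).mul (h.hasDerivAt (x j))).add
        ((hc (x j)).mul (h.deriv.hasDerivAt (x j)))).deriv
    rw [d2, hG]
    have b1 : |(x j) ^ 2 * (cutoff k (x j) * hermiteOne (α j) (x j))| ≤
        |(x j) ^ 2 * hermiteOne (α j) (x j)| := by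
      rw [abs_mul, abs_mul (_ ^ 2)]
      exact mul_le_mul_of_nonneg_left hcut (abs_nonneg _)
    have b2 : |deriv (deriv (cutoff k)) (x j) * hermiteOne (α j) (x j)| ≤
        A * |hermiteOne (α j) (x j)| := by
      rw [abs_mul]
      exact mul_le_mul_of_nonneg_right (hA k (x j)).2 (abs_nonneg _)
    have b3 : |deriv (cutoff k) (x j) * deriv (hermiteOne (α j)) (x j)| ≤
        A * |deriv (hermiteOne (α j)) (x j)| := by
      rw [abs_mul]
      exact mul_le_mul_of_nonneg_right (hA k (x j)).1 (abs_nonneg _)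
    have b4 : |cutoff k (x j) * deriv (deriv (hermiteOne (α j))) (x j)| ≤
        |deriv (deriv (hermiteOne (α j))) (x j)| := by
      rw [abs_mul]
      exact mul_le_of_le_one_left (abs_nonneg _) (abs_cutoff_le _ _)
    have t1 := abs_sub ((x j) ^ 2 * (cutoff k (x j) * hermiteOne (α j) (x j)))
      ((deriv (deriv (cutoff k)) (x j) * hermiteOne (α j) (x j) +
          deriv (cutoff k) (x j) * deriv (hermiteOne (α j)) (x j)) +
        (deriv (cutoff k) (x j) * deriv (hermiteOne (α j)) (x j) +
          cutoff k (x j) * deriv (deriv (hermiteOne (α j))) (x j)))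
    have t2 := abs_add_le (deriv (deriv (cutoff k)) (x j) * hermiteOne (α j) (x j) +
          deriv (cutoff k) (x j) * deriv (hermiteOne (α j)) (x j))
        (deriv (cutoff k) (x j) * deriv (hermiteOne (α j)) (x j) +
          cutoff k (x j) * deriv (deriv (hermiteOne (α j))) (x j))
    have t3 := abs_add_le (deriv (deriv (cutoff k)) (x j) * hermiteOne (α j) (x j))
          (deriv (cutoff k) (x j) * deriv (hermiteOne (α j)) (x j))
    have t4 := abs_add_le (deriv (cutoff k) (x j) * deriv (hermiteOne (α j)) (x j))
          (cutoff k (x j) * deriv (deriv (hermiteOne (α j))) (x j))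
    have n1 := abs_nonneg (hermiteOne (α j) (x j))
    simp only
    linarith
  · rw [Function.update_of_ne hj]
    refine hcut.trans ?_
    simp only [hG]
    have n1 := abs_nonneg ((x j) ^ 2 * hermiteOne (α j) (x j))
    have n2 := mul_nonneg hA0 (abs_nonneg (hermiteOne (α j) (x j)))
    have n3 := mul_nonneg hA0 (abs_nonneg (deriv (hermiteOne (α j)) (x j)))
    have n4 := abs_nonneg (deriv (deriv (hermiteOne (α j))) (x j))
    linarith

lemma oscFun_hermiteFun (α : MultiIndex d) (x : Rd d) :
    oscFun (hermiteFun α) x = ((2 * order α + d : ℕ) : ℂ) * hermiteFun α x :=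
  congrFun (congrArg (fun f : smoothFun d => (f : Rd d → ℂ)) (harmonicOsc_hermiteFun α)) x

/-- The Hermite coefficients `∫ f h_α`. -/
def hermiteCoeff (f : Rd d → ℂ) (α : MultiIndex d) : ℂ := ∫ x, f x * hermiteFun α x

/-- Only `f` and `Hf` are known to be bounded, and the first derivatives of `f` are not controlled,
so integration by parts against `h_α` itself is not available. Symmetry is used with the cut-off
Hermite functions, and both sides pass to the limit by dominated convergence. -/
lemma hermiteCoeff_oscFun {f : Rd d → ℂ} (hf : ContDiff ℝ ∞ f) {M M' : ℝ}
    (hM : ∀ x, ‖f x‖ ≤ M) (hM' : ∀ x, ‖oscFun f x‖ ≤ M') (α : MultiIndex d) :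
    hermiteCoeff (oscFun f) α = ((2 * order α + d : ℕ) : ℂ) * hermiteCoeff f α := by
  have hM0 : 0 ≤ M := (norm_nonneg _).trans (hM 0)
  have hM0' : 0 ≤ M' := (norm_nonneg _).trans (hM' 0)
  have hn : Continuous fun x : Rd d => ((‖x‖ ^ 2 : ℝ) : ℂ) := by fun_prop
  have hosc : ∀ {g : Rd d → ℂ}, ContDiff ℝ ∞ g → Continuous (oscFun g) := fun hg =>
    (hn.mul hg.continuous).sub (laplacian_smooth hg).continuous
  obtain ⟨G, hG, hGb⟩ := exists_norm_oscFun_cutHermite_le α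
  have h1 : Tendsto (fun k => ∫ x, oscFun f x * cutHermite α k x) atTop
      (𝓝 (∫ x, oscFun f x * hermiteFun α x)) := by
    refine tendsto_integral_of_dominated_convergence (fun x => M' * ‖hermiteFun α x‖)
      (fun k => ((hosc hf).mul (contDiff_cutHermite α k).continuous).aestronglyMeasurable)
      ((integrable_hermiteFun α).norm.const_mul M') (fun k => Eventually.of_forall fun x => ?_)
      (Eventually.of_forall fun x => ?_)
    · rw [norm_mul]
      exact mul_le_mul (hM' x) (norm_cutHermite_le α k x) (norm_nonneg _) hM0'
    · refine tendsto_const_nhds.congr' ?_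
      filter_upwards [cutHermite_eventually_eq α x] with k hk
      rw [hk.eq_of_nhds]
  have h2 : Tendsto (fun k => ∫ x, f x * oscFun (cutHermite α k) x) atTop
      (𝓝 (∫ x, f x * oscFun (hermiteFun α) x)) := by
    refine tendsto_integral_of_dominated_convergence (fun x => M * G x)
      (fun k => (hf.continuous.mul (hosc (contDiff_cutHermite α k))).aestronglyMeasurable)
      (hG.const_mul M) (fun k => Eventually.of_forall fun x => ?_)
      (Eventually.of_forall fun x => ?_)
    · rw [norm_mul]
      exact mul_le_mul (hM x) (hGb k x) (norm_nonneg _) hM0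
    · refine tendsto_const_nhds.congr' ?_
      filter_upwards [cutHermite_eventually_eq α x] with k hk
      rw [oscFun, oscFun, hk.eq_of_nhds, (InnerProductSpace.laplacian_congr_nhds hk).eq_of_nhds]
  have h3 : ∀ k, ∫ x, f x * oscFun (cutHermite α k) x = ∫ x, oscFun f x * cutHermite α k x :=
    fun k => integral_mul_oscFun hf (contDiff_cutHermite α k) (hasCompactSupport_cutHermite α k)
  simp only [h3] at h2
  rw [hermiteCoeff, tendsto_nhds_unique h1 h2, hermiteCoeff, ← integral_const_mul]
  refine integral_congr_ae (Eventually.of_forall fun x => ?_)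
  simp only [oscFun_hermiteFun]
  ring

end Symmetry

/-! ### The norms of the Pilipović space and Hermite coefficients -/

section PilNorm

variable {d : ℕ}

lemma norm_oscPow_le (f : PilSpace d) (h : {h : ℝ // 0 < h}) (N : ℕ) (x : Rd d) :
    ‖oscPow N (PilSpace.toSmooth d f) x‖ ≤
      PilSpace.pilNorm d h f * ((h : ℝ) ^ N * N.factorial) := by
  have hh := h.2
  have hb : BddAbove (Set.range fun i : ℕ × Rd d => ‖PilSpace.oscValues d f i‖ *
      ((h : ℝ) ^ i.1 * i.1.factorial)⁻¹) := by
    obtain ⟨C, hC⟩ := f.2 h h.2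
    refine ⟨C, ?_⟩
    rintro _ ⟨i, rfl⟩
    change _ * _⁻¹ ≤ C
    rw [← div_eq_mul_inv]
    exact (div_le_iff₀ (by positivity)).2 (hC i.1 i.2)
  have h1 := le_ciSup hb (N, x)
  rw [← div_eq_mul_inv, div_le_iff₀ (by positivity)] at h1
  exact h1

lemma pilNorm_le {f : PilSpace d} {h : {h : ℝ // 0 < h}} {C : ℝ}
    (hC : ∀ N x, ‖oscPow N (PilSpace.toSmooth d f) x‖ ≤ C * ((h : ℝ) ^ N * N.factorial)) :
    PilSpace.pilNorm d h f ≤ C := by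
  have hh := h.2
  refine ciSup_le fun i => ?_
  rw [← div_eq_mul_inv]
  exact (div_le_iff₀ (by positivity)).2 (hC i.1 i.2)

lemma pilNorm_anti {h k : {h : ℝ // 0 < h}} (hk : h ≤ k) (f : PilSpace d) :
    PilSpace.pilNorm d k f ≤ PilSpace.pilNorm d h f := by
  refine pilNorm_le fun N x => (norm_oscPow_le f h N x).trans ?_
  have hh := h.2
  have h0 : (0 : ℝ) ≤ PilSpace.pilNorm d h f := apply_nonneg _ _
  have h1 : (h : ℝ) ≤ k := hk
  gcongr

/-- The function `f` of the Pilipović space, after applying the harmonic oscillator `N` times. -/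
lemma contDiff_oscPow (N : ℕ) (f : smoothFun d) : ContDiff ℝ ∞ (oscPow N f) :=
  (((harmonicOsc d) ^ N) f).2

lemma oscPow_succ (N : ℕ) (f : smoothFun d) : oscPow (N + 1) f = oscFun (oscPow N f) := by
  funext x
  rw [oscPow, pow_succ', Module.End.mul_apply]
  rfl

lemma hermiteCoeff_oscPow (f : PilSpace d) (N : ℕ) (α : MultiIndex d) :
    hermiteCoeff (oscPow N (PilSpace.toSmooth d f)) α = ((2 * order α + d : ℕ) : ℂ) ^ N *
      hermiteCoeff (oscPow 0 (PilSpace.toSmooth d f)) α := by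
  induction N with
  | zero => simp
  | succ N ih =>
    have h1 := norm_oscPow_le f ⟨1, one_pos⟩ N
    have h2 := norm_oscPow_le f ⟨1, one_pos⟩ (N + 1)
    rw [oscPow_succ] at h2 ⊢
    rw [hermiteCoeff_oscFun (contDiff_oscPow N _) h1 h2, ih, pow_succ']
    ring

lemma norm_hermiteCoeff_le {f : Rd d → ℂ} (hf : Continuous f) {M : ℝ} (hM : ∀ x, ‖f x‖ ≤ M)
    (α : MultiIndex d) : ‖hermiteCoeff f α‖ ≤ M * (6 ^ d * Real.exp (order α)) :=
  (norm_integral_le_integral_norm _).trans (integral_norm_bounded_mul_hermiteFun_le hf hM α)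

/-- With `l = 2|α| + d`, the coefficient `a` satisfies `l^N a ≤ h^N N! K` for all `N`. Division by
`(2h)^N N!` and summation over `N` give `e^{l/(2h)} a ≤ 2K`, and `l/(2h) ≥ |α|/h`. The `1` in the
exponent comes from the `L¹` norm of `h_α` contained in `K`. -/
lemma norm_hermiteCoeff_pil_le (f : PilSpace d) (h : {h : ℝ // 0 < h}) (α : MultiIndex d) :
    ‖hermiteCoeff (oscPow 0 (PilSpace.toSmooth d f)) α‖ ≤
      2 * 6 ^ d * PilSpace.pilNorm d h f * Real.exp ((1 - (h : ℝ)⁻¹) * order α) := by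
  set l : ℝ := ((2 * order α + d : ℕ) : ℝ) with hl
  set a := ‖hermiteCoeff (oscPow 0 (PilSpace.toSmooth d f)) α‖ with ha
  set K := PilSpace.pilNorm d h f * (6 ^ d * Real.exp (order α)) with hK
  have hh := h.2
  have hp : (0 : ℝ) ≤ PilSpace.pilNorm d h f := apply_nonneg _ _
  have h1 : ∀ N : ℕ, l ^ N * a ≤ (h : ℝ) ^ N * N.factorial * K := fun N => by
    have h2 := norm_hermiteCoeff_le (contDiff_oscPow N _).continuous (norm_oscPow_le f h N) α
    rw [hermiteCoeff_oscPow, norm_mul, norm_pow, Complex.norm_natCast] at h2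
    refine h2.trans_eq ?_
    rw [hK]
    ring
  have h3 : HasSum (fun N : ℕ => (l / (2 * h)) ^ N / N.factorial) (Real.exp (l / (2 * h))) := by
    rw [Real.exp_eq_exp_ℝ]
    exact NormedSpace.expSeries_div_hasSum_exp _
  have h4 := hasSum_le (fun N : ℕ => ?_) (h3.mul_right a)
    ((hasSum_geometric_two).mul_right K)
  swap
  · have h5 : (l / (2 * h)) ^ N / N.factorial * a =
        (1 / 2) ^ N * ((l ^ N * a) / ((h : ℝ) ^ N * N.factorial)) := by
      rw [div_pow, mul_pow, div_pow, one_pow]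
      field_simp
    rw [h5]
    refine mul_le_mul_of_nonneg_left ?_ (by positivity)
    rw [div_le_iff₀ (by positivity)]
    exact (h1 N).trans_eq (by ring)
  have h6 : (h : ℝ)⁻¹ * order α ≤ l / (2 * h) := by
    rw [hl, inv_mul_eq_div, div_le_div_iff₀ hh (by positivity)]
    push_cast
    nlinarith [(Nat.cast_nonneg d : (0 : ℝ) ≤ d)]
  have h7 : Real.exp ((h : ℝ)⁻¹ * order α) * a ≤ 2 * K :=
    (mul_le_mul_of_nonneg_right (Real.exp_le_exp.2 h6) (norm_nonneg _)).trans h4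
  rw [sub_mul, one_mul, Real.exp_sub, ← mul_div_assoc, le_div_iff₀ (Real.exp_pos _), mul_comm a]
  refine h7.trans_eq ?_
  rw [hK]
  ring

end PilNorm

/-! ### The short-time Fourier transform and the Bargmann kernel -/

section STFT

variable {d : ℕ}

/-- The point `(x - iξ)/√2` of `ℂᵈ`. -/
def bargmannPoint (x ξ : Rd d) : Cd d :=
  WithLp.toLp 2 fun i => ((x i : ℂ) - Complex.I * ξ i) / (Real.sqrt 2 : ℂ)

/-- The factor between the short-time Fourier transform and the Bargmann transform. -/
def stftFactor (x ξ : Rd d) : ℂ :=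
  (((2 * Real.pi) ^ (-(d / 2 : ℝ)) : ℝ) : ℂ) *
    Complex.exp (∑ i, ((bargmannPoint x ξ i) ^ 2 / 2 - (x i : ℂ) ^ 2 / 2))

lemma ofReal_sqrt_two_sq : (Real.sqrt 2 : ℂ) ^ 2 = 2 := by
  rw [← Complex.ofReal_pow, Real.sq_sqrt (by norm_num)]
  norm_num

lemma ofReal_sqrt_two_ne : (Real.sqrt 2 : ℂ) ≠ 0 := fun h => by
  have := ofReal_sqrt_two_sq
  simp [h] at this

lemma bargmannPoint_apply_sq (x ξ : Rd d) (i : Fin d) :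
    bargmannPoint x ξ i ^ 2 = ((x i : ℂ) - Complex.I * ξ i) ^ 2 / 2 := by
  rw [bargmannPoint, PiLp.toLp_apply, div_pow, ofReal_sqrt_two_sq]

lemma norm_sq_bargmannPoint (x ξ : Rd d) :
    ‖bargmannPoint x ξ‖ ^ 2 = (‖x‖ ^ 2 + ‖ξ‖ ^ 2) / 2 := by
  simp only [EuclideanSpace.norm_sq_eq]
  rw [← Finset.sum_add_distrib, Finset.sum_div]
  refine Finset.sum_congr rfl fun i _ => ?_
  have h : Complex.normSq ((x i : ℂ) - Complex.I * ξ i) = x i ^ 2 + ξ i ^ 2 := by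
    rw [Complex.normSq_apply]
    simp
    ring
  rw [← norm_pow, bargmannPoint_apply_sq, norm_div, norm_pow, Complex.sq_norm, h,
    Real.norm_eq_abs, Real.norm_eq_abs, sq_abs, sq_abs]
  simp

lemma norm_stftFactor (x ξ : Rd d) :
    ‖stftFactor x ξ‖ = (2 * Real.pi) ^ (-(d / 2 : ℝ)) *
      Real.exp (-(1 / 4) * (‖x‖ ^ 2 + ‖ξ‖ ^ 2)) := by
  rw [stftFactor, norm_mul, Complex.norm_real, Real.norm_of_nonneg (by positivity),
    Complex.norm_exp, EuclideanSpace.norm_sq_eq, EuclideanSpace.norm_sq_eq,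
    ← Finset.sum_add_distrib, Finset.mul_sum, Complex.re_sum]
  congr 2
  refine Finset.sum_congr rfl fun i _ => ?_
  rw [bargmannPoint_apply_sq, Real.norm_eq_abs, Real.norm_eq_abs, sq_abs, sq_abs]
  have h : ((x i : ℂ) - Complex.I * ξ i) ^ 2 / 2 / 2 - (x i : ℂ) ^ 2 / 2 =
      ((-(1 / 4) * (x i ^ 2 + ξ i ^ 2) : ℝ) : ℂ) - ((x i * ξ i / 2 : ℝ) : ℂ) * Complex.I := by
    push_cast
    linear_combination ((ξ i : ℂ) ^ 2 / 4) * Complex.I_sq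
  rw [h]
  simp [-Complex.ofReal_pow]

lemma stftFactor_ne_zero (x ξ : Rd d) : stftFactor x ξ ≠ 0 := by
  rw [← norm_ne_zero_iff, norm_stftFactor]
  positivity

lemma exists_bargmannPoint_eq (z : Cd d) : ∃ x ξ : Rd d, bargmannPoint x ξ = z := by
  refine ⟨WithLp.toLp 2 fun i => Real.sqrt 2 * (z i).re,
    WithLp.toLp 2 fun i => -(Real.sqrt 2 * (z i).im), ?_⟩
  ext i
  have h := ofReal_sqrt_two_ne
  simp only [bargmannPoint, PiLp.toLp_apply]
  rw [div_eq_iff h]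
  conv_rhs => rw [← Complex.re_add_im (z i)]
  push_cast
  ring

/-- With `z = (x - iξ)/√2`, expanding the square gives `-|y - x|²/2 - i⟨y, ξ⟩ = -|y|²/2 - |x|²/2 +
√2 ∑ z_i y_i`. This differs from the exponent of the Bargmann kernel by `∑ (z_i² - x_i²)/2`, which
does not involve `y`. -/
lemma gaussWindow_mul_exp (x ξ y : Rd d) :
    (starRingEnd ℂ) (gaussWindow d (y - x)) * Complex.exp (-Complex.I * (⟪y, ξ⟫_ℝ : ℝ)) =
      Complex.exp (∑ i, ((bargmannPoint x ξ i) ^ 2 / 2 - (x i : ℂ) ^ 2 / 2)) *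
        bargmannKernel (bargmannPoint x ξ) y := by
  have h1 : (((Real.pi ^ (-(d / 4 : ℝ)) : ℝ)) : ℂ) =
      ∏ _i : Fin d, ((Real.pi ^ (-(1 / 4 : ℝ)) : ℝ) : ℂ) := by
    rw [Finset.prod_const, Finset.card_univ, Fintype.card_fin, ← Complex.ofReal_pow,
      ← Real.rpow_natCast, ← Real.rpow_mul Real.pi_pos.le]
    congr 2
    ring
  rw [gaussWindow, Complex.conj_ofReal, bargmannKernel, Complex.ofReal_mul, h1,
    Complex.ofReal_exp, mul_assoc, ← Complex.exp_add]
  simp only [kernelOne]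
  rw [Finset.prod_mul_distrib, ← Complex.exp_sum, mul_left_comm, ← Complex.exp_add,
    ← Finset.sum_add_distrib]
  congr 2
  rw [EuclideanSpace.norm_sq_eq, PiLp.inner_apply]
  push_cast
  rw [neg_div, Finset.sum_div, Finset.mul_sum, ← Finset.sum_neg_distrib,
    ← Finset.sum_add_distrib]
  refine Finset.sum_congr rfl fun i _ => ?_
  have h3 : ((‖(y - x) i‖ : ℝ) : ℂ) ^ 2 = ((y i : ℂ) - x i) ^ 2 := by
    rw [← Complex.ofReal_pow, Real.norm_eq_abs, sq_abs]
    simp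
  have h4 : (Real.sqrt 2 : ℂ) * bargmannPoint x ξ i = (x i : ℂ) - Complex.I * ξ i := by
    rw [bargmannPoint, PiLp.toLp_apply, mul_div_cancel₀ _ ofReal_sqrt_two_ne]
  rw [h3, h4]
  simp
  ring

lemma stft_eq (f : Rd d → ℂ) (x ξ : Rd d) : stft (gaussWindow d) f x ξ =
    stftFactor x ξ * ∫ y, f y * bargmannKernel (bargmannPoint x ξ) y := by
  rw [stft, stftFactor, mul_assoc]
  congr 1
  rw [← integral_const_mul]
  congr 1
  funext y
  rw [mul_assoc, gaussWindow_mul_exp]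
  ring

lemma stft_hermiteFun (α : MultiIndex d) (x ξ : Rd d) :
    stft (gaussWindow d) (hermiteFun α) x ξ =
      stftFactor x ξ * monomialFun α (bargmannPoint x ξ) := by
  rw [stft_eq, integral_hermiteFun_mul_bargmannKernel]

end STFT

/-! ### Completeness of the Hermite functions -/

section Completeness

variable {d : ℕ}

/-- By the generating function, vanishing coefficients annihilate the integral of `f` against every
Bargmann kernel. For the points with `x = 0` these integrals are, up to nonzero factors, the values
of the Fourier transform of `f` times a Gaussian, and Fourier inversion applies. -/
lemma eq_zero_of_hermiteCoeff_eq_zero {f : Rd d → ℂ} (hf : Continuous f) {M : ℝ}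
    (hM : ∀ x, ‖f x‖ ≤ M) (h : ∀ α, hermiteCoeff f α = 0) : f = 0 := by
  set g : Rd d → ℂ := fun y => f y * (starRingEnd ℂ) (gaussWindow d (y - 0)) with hg
  have hgauss : Continuous fun y : Rd d => (starRingEnd ℂ) (gaussWindow d (y - 0)) := by
    unfold gaussWindow
    fun_prop
  have hgc : Continuous g := hf.mul hgauss
  have hgi : Integrable g := by
    -- The kernel at the origin is the Gaussian in product form, so its integrability reduces to one
    -- variable.
    have h0 : (fun y : Rd d => (starRingEnd ℂ) (gaussWindow d (y - 0))) = fun y =>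
        Complex.exp (∑ i, ((bargmannPoint (0 : Rd d) 0 i) ^ 2 / 2 -
          (((0 : Rd d) i : ℝ) : ℂ) ^ 2 / 2)) * bargmannKernel (bargmannPoint 0 0) y := by
      funext y
      rw [← gaussWindow_mul_exp]
      simp
    have hi : Integrable fun y : Rd d => bargmannKernel (bargmannPoint 0 0) y := by
      refine integrable_prod_euclidean fun i => ?_
      have h1 := ((integrable_exp_neg_mul_sq (b := 1 / 2) (by norm_num)).const_mul
        (Real.pi ^ (-(1 / 4 : ℝ)))).ofReal (𝕜 := ℂ)
      refine h1.congr (Eventually.of_forall fun t => ?_)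
      simp [kernelOne, bargmannPoint]
      left
      ring_nf
    refine Integrable.bdd_mul (c := M) ?_ hf.aestronglyMeasurable (Eventually.of_forall hM)
    rw [h0]
    exact hi.const_mul _
  have hF : FourierTransform.fourier g = 0 := by
    funext w
    -- The factor `2π` passes from the frequency convention `e^{-i⟨y, ξ⟩}` to `e^{-2πi⟨y, w⟩}`.
    have h1 : ∫ y, f y * bargmannKernel (bargmannPoint 0 ((2 * Real.pi) • w)) y = 0 := by
      refine (hasSum_integral_mul_bargmannKernel hf hM _).unique ?_
      simp only [hermiteCoeff] at h
      simp only [h, zero_mul]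
      exact hasSum_zero
    have h2 := stft_eq f 0 ((2 * Real.pi) • w)
    rw [h1, mul_zero, stft] at h2
    have h3 : (((2 * Real.pi) ^ (-(d / 2 : ℝ)) : ℝ) : ℂ) ≠ 0 :=
      Complex.ofReal_ne_zero.2 (by positivity)
    have h4 := (mul_eq_zero.1 h2).resolve_left h3
    rw [Real.fourier_eq', Pi.zero_apply, ← h4]
    refine integral_congr_ae (Eventually.of_forall fun y => ?_)
    simp only [hg, smul_eq_mul]
    rw [mul_comm, inner_smul_right]
    congr 2
    push_cast
    ring
  have h5 := hgc.fourierInv_fourier_eq hgi (by rw [hF]; exact integrable_zero _ _ _)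
  rw [hF] at h5
  funext y
  have h6 : g y = 0 := by
    rw [← h5, Real.fourierInv_eq']
    simp
  refine (mul_eq_zero.1 h6).resolve_right ?_
  refine (map_ne_zero (starRingEnd ℂ)).2 ?_
  rw [gaussWindow]
  exact Complex.ofReal_ne_zero.2 (by positivity)

/-- A bounded continuous function with rapidly decaying Hermite coefficients is the sum of its
Hermite expansion. -/
lemma hasSum_hermiteCoeff_mul_hermiteFun {f : Rd d → ℂ} (hf : Continuous f) {M : ℝ}
    (hM : ∀ x, ‖f x‖ ≤ M)
    (hs : Summable fun α : MultiIndex d => ‖hermiteCoeff f α‖ * (6 ^ d * Real.exp (order α)))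
    (x : Rd d) : HasSum (fun α => hermiteCoeff f α * hermiteFun α x) (f x) := by
  have hb : ∀ (α : MultiIndex d) x, ‖hermiteCoeff f α * hermiteFun α x‖ ≤
      ‖hermiteCoeff f α‖ * (6 ^ d * Real.exp (order α)) := fun α x => by
    rw [norm_mul]
    exact mul_le_mul_of_nonneg_left (norm_hermiteFun_le α x) (norm_nonneg _)
  -- The series converges uniformly, so `g` is bounded and continuous. Termwise integration shows
  -- that `g` has the coefficients of `f`, and completeness identifies the two.
  set g : Rd d → ℂ := fun x => ∑' α, hermiteCoeff f α * hermiteFun α x with hg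
  have hgs : ∀ x, HasSum (fun α => hermiteCoeff f α * hermiteFun α x) (g x) := fun x =>
    (Summable.of_norm_bounded hs fun α => hb α x).hasSum
  have hgc : Continuous g :=
    continuous_tsum (fun α => continuous_const.mul (continuous_hermiteFun α)) hs hb
  have hgb : ∀ x, ‖g x‖ ≤ ∑' α : MultiIndex d,
      ‖hermiteCoeff f α‖ * (6 ^ d * Real.exp (order α)) := fun x =>
    tsum_of_norm_bounded hs.hasSum fun α => hb α x
  have hcoeff : ∀ β, hermiteCoeff g β = hermiteCoeff f β := fun β => by
    have h1 : ∀ α, Integrable fun x => hermiteCoeff f α * hermiteFun α x * hermiteFun β x :=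
      fun α => integrable_bounded_mul_hermiteFun
        (continuous_const.mul (continuous_hermiteFun α)) (hb α) β
    have h2 : Summable fun α => ∫ x, ‖hermiteCoeff f α * hermiteFun α x * hermiteFun β x‖ :=
      Summable.of_nonneg_of_le (fun α => integral_nonneg fun _ => norm_nonneg _)
        (fun α => integral_norm_bounded_mul_hermiteFun_le
          (continuous_const.mul (continuous_hermiteFun α)) (hb α) β) (hs.mul_right _)
    have h3 := hasSum_integral_of_summable_integral_norm h1 h2
    have h4 : ∀ α, ∫ x, hermiteCoeff f α * hermiteFun α x * hermiteFun β x =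
        if α = β then hermiteCoeff f β else 0 := fun α => by
      simp only [mul_assoc]
      rw [integral_const_mul, integral_hermiteFun_mul]
      split_ifs with h
      · rw [h, mul_one]
      · rw [mul_zero]
    simp only [h4, tsum_mul_right] at h3
    exact h3.unique (hasSum_ite_eq β _)
  have h0 : (fun x => f x - g x) = 0 := by
    refine eq_zero_of_hermiteCoeff_eq_zero (hf.sub hgc)
      (fun x => (norm_sub_le _ _).trans (add_le_add (hM x) (hgb x))) fun β => ?_
    simp only [hermiteCoeff, sub_mul]
    rw [integral_sub (integrable_bounded_mul_hermiteFun hf hM β)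
      (integrable_bounded_mul_hermiteFun hgc hgb β)]
    exact sub_eq_zero.2 (hcoeff β).symm
  rw [sub_eq_zero.1 (congrFun h0 x)]
  exact hgs x

end Completeness

/-! ### Hermite expansions in the Pilipović space -/

section PilExpansion

variable {d : ℕ}

lemma oscPow_hermitePil (N : ℕ) (α : MultiIndex d) (x : Rd d) :
    oscPow N (PilSpace.toSmooth d (hermitePil α)) x =
      ((2 * order α + d : ℕ) : ℂ) ^ N * hermiteFun α x := by
  have hpow : ((harmonicOsc d) ^ N) ⟨hermiteFun α, hermiteFun_smooth α⟩ =
      (((2 * order α + d : ℕ) : ℂ) ^ N) •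
        (⟨hermiteFun α, hermiteFun_smooth α⟩ : smoothFun d) := by
    induction N with
    | zero => simp
    | succ N ih =>
      rw [pow_succ', Module.End.mul_apply, ih, map_smul, harmonicOsc_hermiteFun, smul_smul,
        pow_succ]
  rw [oscPow]
  change (((harmonicOsc d ^ N) ⟨hermiteFun α, hermiteFun_smooth α⟩ : smoothFun d) :
    Rd d → ℂ) x = _
  rw [hpow]
  rfl

/-- One term of an exponential series is at most its sum. -/
lemma eigenvalue_pow_le {h : ℝ} (hh : 0 < h) (N : ℕ) (α : MultiIndex d) :
    ((2 * order α + d : ℕ) : ℝ) ^ N ≤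
      h ^ N * N.factorial * Real.exp ((2 * order α + d) / h) := by
  have h2 := Real.pow_div_factorial_le_exp (((2 * order α + d : ℕ) : ℝ) / h) (by positivity) N
  rw [div_pow, div_div, div_le_iff₀ (by positivity)] at h2
  push_cast at h2 ⊢
  linarith

lemma pilNorm_hermitePil_le (h : {h : ℝ // 0 < h}) (α : MultiIndex d) :
    PilSpace.pilNorm d h (hermitePil α) ≤
      6 ^ d * Real.exp (d / h) * Real.exp ((1 + 2 / h) * order α) := by
  have hh := h.2
  refine pilNorm_le fun N x => ?_
  rw [oscPow_hermitePil, norm_mul, norm_pow, Complex.norm_natCast]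
  refine (mul_le_mul (eigenvalue_pow_le hh N α) (norm_hermiteFun_le α x) (norm_nonneg _)
    (by positivity)).trans_eq ?_
  have : Real.exp ((2 * order α + d) / h) * Real.exp (order α) =
      Real.exp (d / h) * Real.exp ((1 + 2 / h) * order α) := by
    rw [← Real.exp_add, ← Real.exp_add]
    ring_nf
  linear_combination ((h : ℝ) ^ N * N.factorial * 6 ^ d) * this

lemma withSeminorms_pilNorm (d : ℕ) : WithSeminorms (PilSpace.pilNorm d) := ⟨rfl⟩

/-- The Hermite coefficients of an element of the Pilipović space. -/
def pilCoeff (f : PilSpace d) (α : MultiIndex d) : ℂ :=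
  hermiteCoeff (oscPow 0 (PilSpace.toSmooth d f)) α

lemma summable_pilCoeff_mul_exp (f : PilSpace d) (r : ℝ) :
    Summable fun α => ‖pilCoeff f α‖ * Real.exp (r * order α) := by
  -- This `h` gives `1 - 1/h + r ≤ -1`, so the terms are dominated by a multiple of `e^{-|α|}`.
  set h : {h : ℝ // 0 < h} := ⟨(2 + |r|)⁻¹, by positivity⟩ with hh
  have h1 : (1 - (h : ℝ)⁻¹) + r ≤ -1 := by
    rw [hh, inv_inv]
    linarith [le_abs_self r]
  have hq : Summable fun α : MultiIndex d => Real.exp (-1) ^ order α :=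
    summable_pow_order (Real.exp_pos _).le (by rw [Real.exp_lt_one_iff]; norm_num)
  refine Summable.of_nonneg_of_le (fun α => by positivity) (fun α => ?_)
    (hq.mul_left (2 * 6 ^ d * PilSpace.pilNorm d h f))
  have hp : (0 : ℝ) ≤ PilSpace.pilNorm d h f := apply_nonneg _ _
  refine (mul_le_mul_of_nonneg_right (norm_hermiteCoeff_pil_le f h α)
    (Real.exp_pos _).le).trans ?_
  rw [mul_assoc, ← Real.exp_add, ← add_mul, ← Real.exp_nat_mul]
  refine mul_le_mul_of_nonneg_left (Real.exp_le_exp.2 ?_) (by positivity)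
  nlinarith [(Nat.cast_nonneg (order α) : (0 : ℝ) ≤ order α)]

/-- The summable majorant of the Hermite expansion, for the norm with parameter `h`. -/
def pilMajorant (f : PilSpace d) (h : ℝ) (α : MultiIndex d) : ℝ :=
  6 ^ d * Real.exp (d / h) * (‖pilCoeff f α‖ * Real.exp ((1 + 2 / h) * order α))

lemma summable_pilMajorant (f : PilSpace d) (h : ℝ) : Summable (pilMajorant f h) :=
  (summable_pilCoeff_mul_exp f _).mul_left _

lemma norm_pilCoeff_mul_le (f : PilSpace d) (h : {h : ℝ // 0 < h}) (N : ℕ) (x : Rd d)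
    (α : MultiIndex d) :
    ‖pilCoeff f α * oscPow N (PilSpace.toSmooth d (hermitePil α)) x‖ ≤
      pilMajorant f h α * ((h : ℝ) ^ N * N.factorial) := by
  rw [norm_mul]
  have hh := h.2
  refine (mul_le_mul_of_nonneg_left ((norm_oscPow_le (hermitePil α) h N x).trans
    (mul_le_mul_of_nonneg_right (pilNorm_hermitePil_le h α) (by positivity)))
    (norm_nonneg _)).trans_eq ?_
  rw [pilMajorant]
  ring

/-- The expansion theorem is applied to `H^N f` itself, whose coefficients are `(2|α| + d)^N
c_α(f)`. No series has to be differentiated term by term. -/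
lemma hasSum_oscPow (f : PilSpace d) (N : ℕ) (x : Rd d) :
    HasSum (fun α => pilCoeff f α * oscPow N (PilSpace.toSmooth d (hermitePil α)) x)
      (oscPow N (PilSpace.toSmooth d f) x) := by
  have h1 := norm_oscPow_le f ⟨1, one_pos⟩ N
  have h2 := hasSum_hermiteCoeff_mul_hermiteFun (contDiff_oscPow N _).continuous h1 ?_ x
  · refine h2.congr_fun fun α => ?_
    rw [hermiteCoeff_oscPow, oscPow_hermitePil, pilCoeff]
    ring
  · refine Summable.of_nonneg_of_le (fun α => by positivity) (fun α => ?_)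
      (((summable_pilCoeff_mul_exp f (1 + 2)).mul_left
        ((1 : ℝ) ^ N * N.factorial * Real.exp d * 6 ^ d)))
    rw [hermiteCoeff_oscPow, norm_mul, norm_pow, Complex.norm_natCast]
    have h3 := eigenvalue_pow_le one_pos N α
    rw [div_one] at h3
    refine (mul_le_mul_of_nonneg_right (mul_le_mul_of_nonneg_right h3 (norm_nonneg _))
      (by positivity)).trans_eq ?_
    have : Real.exp (2 * order α + d) * Real.exp (order α) =
        Real.exp d * Real.exp ((1 + 2) * order α) := by
      rw [← Real.exp_add, ← Real.exp_add]
      ring_nf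
    rw [pilCoeff]
    linear_combination ((1 : ℝ) ^ N * N.factorial * 6 ^ d *
      ‖hermiteCoeff (oscPow 0 (PilSpace.toSmooth d f)) α‖) * this

/-- Elements of the Pilipović space are the sums of their Hermite expansions. -/
lemma hasSum_pilCoeff_smul_hermitePil (f : PilSpace d) :
    HasSum (fun α => pilCoeff f α • hermitePil α) f := by
  rw [HasSum, SummationFilter.unconditional_filter, (withSeminorms_pilNorm d).tendsto_nhds]
  intro h ε hε
  have h1 := tendsto_tsum_compl_atTop_zero (pilMajorant f h)
  filter_upwards [h1.eventually_lt_const hε] with s hs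
  refine lt_of_le_of_lt ?_ hs
  rw [map_sub_rev]
  refine pilNorm_le fun N x => ?_
  -- The remainder is the series over the complement of `s`. Its majorant is `h^N N!` times the tail
  -- of a fixed summable family, which bounds the norm uniformly in `N` and `x`.
  have h2 := s.hasSum_compl_iff
    (f := fun α => pilCoeff f α * oscPow N (PilSpace.toSmooth d (hermitePil α)) x)
    (a := oscPow N (PilSpace.toSmooth d (f - ∑ α ∈ s, pilCoeff f α • hermitePil α)) x)
  have h3 : oscPow N (PilSpace.toSmooth d (f - ∑ α ∈ s, pilCoeff f α • hermitePil α)) x +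
      ∑ α ∈ s, pilCoeff f α * oscPow N (PilSpace.toSmooth d (hermitePil α)) x =
      oscPow N (PilSpace.toSmooth d f) x := by
    have h4 : ∀ g, oscPow N (PilSpace.toSmooth d g) x = PilSpace.oscValues d g (N, x) :=
      fun _ => rfl
    simp only [h4]
    simp only [map_sub, map_sum, map_smul, Pi.sub_apply, Finset.sum_apply, Pi.smul_apply,
      smul_eq_mul]
    ring
  rw [h3] at h2
  rw [← (h2.2 (hasSum_oscPow f N x)).tsum_eq]
  exact tsum_of_norm_bounded
    (((summable_pilMajorant f h).comp_injective Subtype.val_injective).hasSum.mul_right _)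
    fun α => norm_pilCoeff_mul_le f h N x α

end PilExpansion

/-! ### Power series expansions of entire functions of several variables -/

section Torus

open AddCircle

/-- For `n ≠ 0` a suitable translation changes the sign of the integrand, while the measure is
invariant. -/
lemma integral_fourier_haar (n : ℤ) :
    ∫ φ : UnitAddCircle, fourier n φ ∂haarAddCircle = if n = 0 then 1 else 0 := by
  split_ifs with h
  · subst h
    simp
  · exact integral_eq_zero_of_add_right_eq_neg (μ := haarAddCircle)
      (fourier_add_half_inv_index h one_pos)

lemma norm_fourier (n : ℤ) (φ : UnitAddCircle) : ‖fourier n φ‖ = 1 := by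
  rw [fourier_apply, Circle.norm_coe]

lemma fourier_pow (k : ℕ) (φ : UnitAddCircle) : fourier 1 φ ^ k = fourier (k : ℤ) φ := by
  induction k with
  | zero => simp
  | succ k ih => rw [pow_succ, ih, ← fourier_add, Nat.cast_succ]

/-- The Fourier coefficients of an entire function on a circle of radius `|w|`. -/
lemma integral_entire_mul_fourier {g : ℂ → ℂ} (hg : Differentiable ℂ g) (w : ℂ) (m : ℤ) :
    ∫ φ : UnitAddCircle, fourier (-m) φ * g (w * fourier 1 φ) ∂haarAddCircle =
      if 0 ≤ m then w ^ m.toNat * ((m.toNat.factorial : ℂ)⁻¹ * iteratedDeriv m.toNat g 0)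
      else 0 := by
  set c : ℕ → ℂ := fun k => (k.factorial : ℂ)⁻¹ * iteratedDeriv k g 0 with hc
  have hs : ∀ z, HasSum (fun k : ℕ => c k * z ^ k) (g z) := fun z => by
    refine (Complex.hasSum_taylorSeries_of_entire hg 0 z).congr_fun fun k => ?_
    simp only [hc, sub_zero, smul_eq_mul]
    ring
  have h1 : ∀ k : ℕ, Integrable (fun φ : UnitAddCircle =>
      c k * w ^ k * fourier ((k : ℤ) - m) φ) haarAddCircle := fun k =>
    (Continuous.integrable_of_hasCompactSupport (by fun_prop)
      (HasCompactSupport.of_compactSpace _)).const_mul _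
  have h2 : Summable fun k : ℕ => ∫ φ : UnitAddCircle,
      ‖c k * w ^ k * fourier ((k : ℤ) - m) φ‖ ∂haarAddCircle := by
    simp only [norm_mul _ (fourier _ _), norm_fourier]
    simpa using (hs w).summable.norm
  have h3 := hasSum_integral_of_summable_integral_norm h1 h2
  have h4 : ∀ φ : UnitAddCircle, ∑' k : ℕ, c k * w ^ k * fourier ((k : ℤ) - m) φ =
      fourier (-m) φ * g (w * fourier 1 φ) := fun φ => by
    rw [← ((hs (w * fourier 1 φ)).mul_left (fourier (-m) φ)).tsum_eq]
    refine tsum_congr fun k => ?_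
    rw [sub_eq_add_neg, fourier_add, mul_pow, fourier_pow]
    ring
  simp only [h4, integral_const_mul, integral_fourier_haar] at h3
  refine h3.unique ?_
  split_ifs with hm
  · obtain ⟨k, rfl⟩ := Int.eq_ofNat_of_zero_le hm
    convert! hasSum_ite_eq k (w ^ k * c k) using 2 with j
    by_cases hj : j = k
    · subst hj
      simp [mul_comm]
    · have : (j : ℤ) - k ≠ 0 := by omega
      simp [hj, this]
  · convert! hasSum_zero using 2 with j
    have : (j : ℤ) - m ≠ 0 := by omega
    simp [this]

variable {d : ℕ}

/-- The normalised Haar measure on the torus. -/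
abbrev torusMeasure (d : ℕ) : Measure (UnitAddTorus (Fin d)) :=
  Measure.pi fun _ => (haarAddCircle : Measure UnitAddCircle)

/-- The point `(ζ_j e^{2πi θ_j})_j`. -/
def rotate (ζ : Fin d → ℂ) (θ : UnitAddTorus (Fin d)) : Fin d → ℂ := fun j => ζ j * fourier 1 (θ j)

lemma continuous_rotate (ζ : Fin d → ℂ) : Continuous (rotate ζ) := by
  unfold rotate
  fun_prop

/-- The Fourier coefficients of the function `F` on the torus through `ζ`. -/
def torusCoeff (F : (Fin d → ℂ) → ℂ) (n : Fin d → ℤ) (ζ : Fin d → ℂ) : ℂ :=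
  ∫ θ, UnitAddTorus.mFourier (-n) θ * F (rotate ζ θ) ∂torusMeasure d

lemma norm_mFourier (n : Fin d → ℤ) (θ : UnitAddTorus (Fin d)) :
    ‖UnitAddTorus.mFourier n θ‖ = 1 := by
  simp only [UnitAddTorus.mFourier, ContinuousMap.coe_mk, norm_prod, norm_fourier,
    Finset.prod_const_one]

lemma norm_torusCoeff_le {F : (Fin d → ℂ) → ℂ} {ζ : Fin d → ℂ} {M : ℝ}
    (hM : ∀ θ, ‖F (rotate ζ θ)‖ ≤ M) (n : Fin d → ℤ) : ‖torusCoeff F n ζ‖ ≤ M := by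
  refine (norm_integral_le_of_norm_le_const (C := M) (Eventually.of_forall fun θ => ?_)).trans ?_
  · rw [norm_mul, norm_mFourier, one_mul]
    exact hM θ
  · simp

lemma mFourier_add_single (n : Fin d → ℤ) (θ : UnitAddTorus (Fin d)) (i : Fin d)
    (φ : UnitAddCircle) : UnitAddTorus.mFourier n (θ + Pi.single i φ) =
      UnitAddTorus.mFourier n θ * fourier (n i) φ := by
  simp only [UnitAddTorus.mFourier, ContinuousMap.coe_mk, Pi.add_apply]
  rw [← Finset.mul_prod_erase _ _ (Finset.mem_univ i),
    ← Finset.mul_prod_erase Finset.univ (fun j => fourier (n j) (θ j)) (Finset.mem_univ i),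
    Pi.single_eq_same]
  have h : ∏ j ∈ Finset.univ.erase i, (fourier (n j) (θ j + (Pi.single i φ : _ → _) j) : ℂ) =
      ∏ j ∈ Finset.univ.erase i, (fourier (n j) (θ j) : ℂ) :=
    Finset.prod_congr rfl fun j hj => by simp [Pi.single_eq_of_ne (Finset.ne_of_mem_erase hj)]
  rw [h]
  simp only [fourier_apply, smul_add, toCircle_add, Circle.coe_mul]
  ring

lemma rotate_add_single (ζ : Fin d → ℂ) (θ : UnitAddTorus (Fin d)) (i : Fin d)
    (φ : UnitAddCircle) : rotate ζ (θ + Pi.single i φ) =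
      Function.update (rotate ζ θ) i (ζ i * fourier 1 (θ i) * fourier 1 φ) := by
  funext j
  rcases eq_or_ne j i with rfl | hj
  · simp only [rotate, Pi.add_apply, Pi.single_eq_same, Function.update_self]
    simp only [fourier_apply, smul_add, toCircle_add, Circle.coe_mul]
    ring
  · simp [rotate, hj]

/-- By invariance of the Haar measure the integrand may be averaged over an additional rotation of
the `i`-th coordinate. After Fubini the inner integral is a Fourier coefficient of an entire
function of one variable. The outcome isolates `ζ i`: the function being differentiated has its
`i`-th coordinate overwritten, so `ζ i` occurs only in the displayed power. -/
lemma torusCoeff_eq_integral {F : (Fin d → ℂ) → ℂ} (hF : Differentiable ℂ F) (n : Fin d → ℤ)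
    (ζ : Fin d → ℂ) (i : Fin d) : torusCoeff F n ζ = ∫ θ, UnitAddTorus.mFourier (-n) θ *
      (if 0 ≤ n i then (ζ i * fourier 1 (θ i)) ^ (n i).toNat * (((n i).toNat.factorial : ℂ)⁻¹ *
        iteratedDeriv (n i).toNat (fun w => F (Function.update (rotate ζ θ) i w)) 0) else 0)
      ∂torusMeasure d := by
  set H : UnitAddTorus (Fin d) → ℂ := fun θ => UnitAddTorus.mFourier (-n) θ * F (rotate ζ θ) with hH
  have hHc : Continuous H :=
    (UnitAddTorus.mFourier (-n)).continuous.mul (hF.continuous.comp (continuous_rotate ζ))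
  have h1 : ∀ φ : UnitAddCircle, ∫ θ, H (θ + Pi.single i φ) ∂torusMeasure d =
      torusCoeff F n ζ := fun φ => integral_add_right_eq_self H _
  have h2 : torusCoeff F n ζ = ∫ φ : UnitAddCircle, (∫ θ, H (θ + Pi.single i φ) ∂torusMeasure d)
      ∂haarAddCircle := by
    simp [h1]
  have hc : Continuous (Function.uncurry fun (φ : UnitAddCircle) (θ : UnitAddTorus (Fin d)) =>
      H (θ + Pi.single i φ)) :=
    hHc.comp (continuous_snd.add ((continuous_single i).comp continuous_fst))
  rw [h2, integral_integral_swap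
    (hc.integrable_of_hasCompactSupport (HasCompactSupport.of_compactSpace _))]
  refine integral_congr_ae (Eventually.of_forall fun θ => ?_)
  have hg : Differentiable ℂ fun w => F (Function.update (rotate ζ θ) i w) :=
    hF.comp (by
      rw [differentiable_pi]
      intro j
      rcases eq_or_ne j i with rfl | hj
      · simp
      · simp [hj])
  simp only
  rw [← integral_entire_mul_fourier hg, ← integral_const_mul]
  refine integral_congr_ae (Eventually.of_forall fun φ => ?_)
  simp only [hH, mFourier_add_single, rotate_add_single, Pi.neg_apply]
  ring

lemma torusCoeff_eq_zero {F : (Fin d → ℂ) → ℂ} (hF : Differentiable ℂ F) {n : Fin d → ℤ}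
    {i : Fin d} (hi : n i < 0) (ζ : Fin d → ℂ) : torusCoeff F n ζ = 0 := by
  rw [torusCoeff_eq_integral hF n ζ i]
  simp [not_le.2 hi]

/-- Homogeneity in each variable separately, read off from `torusCoeff_eq_integral`; `t = 0` is
allowed. -/
lemma torusCoeff_update {F : (Fin d → ℂ) → ℂ} (hF : Differentiable ℂ F) (a : Fin d → ℕ)
    (ζ : Fin d → ℂ) (i : Fin d) (t : ℂ) :
    torusCoeff F (fun j => (a j : ℤ)) (Function.update ζ i t) =
      t ^ a i * torusCoeff F (fun j => (a j : ℤ)) (Function.update ζ i 1) := by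
  rw [torusCoeff_eq_integral hF _ _ i, torusCoeff_eq_integral hF _ _ i, ← integral_const_mul]
  refine integral_congr_ae (Eventually.of_forall fun θ => ?_)
  have h : ∀ s w : ℂ, Function.update (rotate (Function.update ζ i s) θ) i w =
      Function.update (rotate ζ θ) i w := fun s w => by
    funext j
    rcases eq_or_ne j i with rfl | hj
    · simp
    · simp [hj, rotate]
  simp only [h, Function.update_self, Int.natCast_nonneg, if_true, Int.toNat_natCast, mul_pow]
  ring

lemma torusCoeff_eq_pow_mul {F : (Fin d → ℂ) → ℂ} (hF : Differentiable ℂ F) (a : Fin d → ℕ)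
    (ζ : Fin d → ℂ) : torusCoeff F (fun j => (a j : ℤ)) ζ =
      (∏ i, ζ i ^ a i) * torusCoeff F (fun j => (a j : ℤ)) 1 := by
  -- The coordinates of the point `1` are replaced by those of `ζ` one at a time.
  have h : ∀ s : Finset (Fin d), torusCoeff F (fun j => (a j : ℤ)) (s.piecewise ζ 1) =
      (∏ i ∈ s, ζ i ^ a i) * torusCoeff F (fun j => (a j : ℤ)) 1 := fun s => by
    induction s using Finset.induction_on with
    | empty => simp
    | insert i s hi ih =>
      rw [Finset.piecewise_insert, torusCoeff_update hF, Finset.prod_insert hi, mul_assoc, ← ih]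
      congr 3
      rw [Function.update_eq_self_iff]
      simp [hi]
  simpa using h Finset.univ

/-- Entire functions of several variables are the sums of their Taylor series. -/
lemma hasSum_torusCoeff {F : (Fin d → ℂ) → ℂ} (hF : Differentiable ℂ F) (ζ : Fin d → ℂ) :
    HasSum (fun α : MultiIndex d => torusCoeff F (fun j => (α j : ℤ)) 1 * ∏ i, ζ i ^ α i)
      (F ζ) := by
  set f : C(UnitAddTorus (Fin d), ℂ) :=
    ⟨fun θ => F (rotate ζ θ), hF.continuous.comp (continuous_rotate ζ)⟩ with hf
  have hcoeff : ∀ n, UnitAddTorus.mFourierCoeff f n = torusCoeff F n ζ := fun n => rfl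
  set e : MultiIndex d → (Fin d → ℤ) := fun α j => (α j : ℤ) with he
  have hinj : Function.Injective e := fun α β h => Finsupp.ext fun j => by
    have := congrFun h j
    simpa [he] using this
  have hzero : ∀ n, n ∉ Set.range e → torusCoeff F n ζ = 0 := fun n hn => by
    by_contra hne
    refine hn ⟨Finsupp.equivFunOnFinite.symm fun j => (n j).toNat, funext fun j => ?_⟩
    have : 0 ≤ n j := by
      by_contra hj
      exact hne (torusCoeff_eq_zero hF (not_le.1 hj) ζ)
    simp [he, this]
  -- A bound on the torus of doubled radii gives, by homogeneity, the factor `2^{-|α|}` for the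
  -- coefficients at `ζ`.
  obtain ⟨M, hM⟩ : ∃ M : ℝ, ∀ θ, ‖F (rotate ((2 : ℂ) • ζ) θ)‖ ≤ M := by
    have hc : Continuous fun θ => F (rotate ((2 : ℂ) • ζ) θ) :=
      hF.continuous.comp (continuous_rotate _)
    obtain ⟨M, hM⟩ := isCompact_univ.exists_bound_of_continuousOn hc.continuousOn
    exact ⟨M, fun θ => hM θ (Set.mem_univ _)⟩
  have hsum : Summable fun α : MultiIndex d => torusCoeff F (e α) ζ := by
    refine Summable.of_norm_bounded
      ((summable_pow_order (q := 1 / 2) (by norm_num) (by norm_num)).mul_right M) fun α => ?_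
    have h1 := norm_torusCoeff_le hM (e α)
    rw [torusCoeff_eq_pow_mul hF] at h1 ⊢
    simp only [Pi.smul_apply, smul_eq_mul, mul_pow, Finset.prod_mul_distrib] at h1
    rw [prod_pow_eq_pow_order, mul_assoc, norm_mul, norm_pow, Complex.norm_ofNat] at h1
    rw [one_div, inv_pow, ← div_eq_inv_mul, le_div_iff₀' (by positivity)]
    exact h1
  have hsum' : Summable (UnitAddTorus.mFourierCoeff f) :=
    (hinj.summable_iff (f := UnitAddTorus.mFourierCoeff f)
      fun n hn => (hcoeff n).trans (hzero n hn)).1 hsum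
  -- At `θ = 0` the summable Fourier series represents `F ζ`; only nonnegative frequencies
  -- contribute.
  have h := UnitAddTorus.hasSum_mFourier_series_apply_of_summable hsum' 0
  rw [← hinj.hasSum_iff (fun n hn => by rw [hcoeff, hzero n hn, zero_smul])] at h
  have h0 : f 0 = F ζ := by
    change F (rotate ζ 0) = F ζ
    congr 1
    funext j
    simp [rotate]
  rw [h0] at h
  refine h.congr_fun fun α => ?_
  simp only [Function.comp_apply, hcoeff]
  rw [he, torusCoeff_eq_pow_mul hF α ζ]
  simp [UnitAddTorus.mFourier, mul_comm]

/-- Cauchy's estimates for convergent power series. -/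
lemma norm_coeff_mul_prod_le {a : MultiIndex d → ℂ} {F : (Fin d → ℂ) → ℂ}
    (h : ∀ ζ : Fin d → ℂ, HasSum (fun α : MultiIndex d => a α * ∏ i, ζ i ^ α i) (F ζ))
    (α : MultiIndex d) {R : Fin d → ℝ} (hR : ∀ i, 0 ≤ R i) {M : ℝ}
    (hM : ∀ ζ : Fin d → ℂ, (∀ i, ‖ζ i‖ = R i) → ‖F ζ‖ ≤ M) : ‖a α‖ * ∏ i, R i ^ α i ≤ M := by
  set ζ : Fin d → ℂ := fun i => (R i : ℂ) with hζ
  have hrot : ∀ θ, ‖F (rotate ζ θ)‖ ≤ M := fun θ => hM _ fun i => by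
    rw [rotate, norm_mul, norm_fourier, mul_one, hζ, Complex.norm_real,
      Real.norm_of_nonneg (hR i)]
  have hint : ∀ n : Fin d → ℤ, ∫ θ, UnitAddTorus.mFourier n θ ∂torusMeasure d =
      if n = 0 then 1 else 0 := fun n => by
    simp only [UnitAddTorus.mFourier, ContinuousMap.coe_mk]
    rw [integral_fintype_prod_eq_prod]
    simp only [integral_fourier_haar]
    split_ifs with hn
    · simp [hn]
    · obtain ⟨i, hi⟩ := Function.ne_iff.1 hn
      exact Finset.prod_eq_zero (Finset.mem_univ i) (if_neg hi)
  have hterm : ∀ (β : MultiIndex d) θ, UnitAddTorus.mFourier (-fun j => (α j : ℤ)) θ *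
      (a β * ∏ i, rotate ζ θ i ^ β i) = a β * (∏ i, ζ i ^ β i) *
        UnitAddTorus.mFourier ((fun j => (β j : ℤ)) + -fun j => (α j : ℤ)) θ := fun β θ => by
    rw [UnitAddTorus.mFourier_add]
    have : UnitAddTorus.mFourier (fun j => (β j : ℤ)) θ = ∏ i, fourier 1 (θ i) ^ β i := by
      simp only [UnitAddTorus.mFourier, ContinuousMap.coe_mk, fourier_pow]
    simp only [this, rotate, mul_pow, Finset.prod_mul_distrib]
    ring
  have h1 : ∀ β : MultiIndex d, Integrable (fun θ => a β * (∏ i, ζ i ^ β i) *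
      UnitAddTorus.mFourier ((fun j => (β j : ℤ)) + -fun j => (α j : ℤ)) θ) (torusMeasure d) :=
    fun β => (Continuous.integrable_of_hasCompactSupport (by fun_prop)
      (HasCompactSupport.of_compactSpace _)).const_mul _
  -- The series at `ζ` converges absolutely and rotations preserve moduli, so termwise integration
  -- is legitimate without any regularity assumption on `F`.
  have h2 : Summable fun β : MultiIndex d => ∫ θ, ‖a β * (∏ i, ζ i ^ β i) *
      UnitAddTorus.mFourier ((fun j => (β j : ℤ)) + -fun j => (α j : ℤ)) θ‖ ∂torusMeasure d := by
    simp only [norm_mul _ (UnitAddTorus.mFourier _ _), norm_mFourier]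
    simpa using (h ζ).summable.norm
  have h3 := hasSum_integral_of_summable_integral_norm h1 h2
  have h4 : ∀ θ, ∑' β : MultiIndex d, a β * (∏ i, ζ i ^ β i) *
      UnitAddTorus.mFourier ((fun j => (β j : ℤ)) + -fun j => (α j : ℤ)) θ =
      UnitAddTorus.mFourier (-fun j => (α j : ℤ)) θ * F (rotate ζ θ) := fun θ => by
    rw [← ((h (rotate ζ θ)).mul_left _).tsum_eq]
    exact tsum_congr fun β => (hterm β θ).symm
  simp only [h4, integral_const_mul, hint] at h3
  have h5 : torusCoeff F (fun j => (α j : ℤ)) ζ = a α * ∏ i, ζ i ^ α i := by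
    refine h3.unique ?_
    convert! hasSum_ite_eq α (a α * ∏ i, ζ i ^ α i) using 2 with β
    by_cases hβ : β = α
    · subst hβ
      simp
    · have : (fun j => (β j : ℤ)) + -(fun j => (α j : ℤ)) ≠ 0 := fun h0 => hβ
        (Finsupp.ext fun j => by
          have := congrFun h0 j
          simp only [Pi.add_apply, Pi.neg_apply, Pi.zero_apply] at this
          omega)
      simp [hβ, this]
  have h6 := norm_torusCoeff_le hrot fun j => (α j : ℤ)
  rw [h5, norm_mul, norm_prod] at h6
  refine le_trans (le_of_eq ?_) h6
  congr 1
  refine Finset.prod_congr rfl fun i _ => ?_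
  rw [norm_pow, hζ, Complex.norm_real, Real.norm_of_nonneg (hR i)]

end Torus

/-! ### Sums of entire functions -/

section Entire

/-- Cauchy's one-variable estimate on the unit circle of each complex line through `z`. -/
lemma norm_fderiv_le_of_forall_norm_le {E : Type*} [NormedAddCommGroup E] [NormedSpace ℂ E]
    {f : E → ℂ} (hf : Differentiable ℂ f) {z : E} {M : ℝ}
    (hM : ∀ w, ‖w - z‖ ≤ 1 → ‖f w‖ ≤ M) : ‖fderiv ℂ f z‖ ≤ M := by
  have hM0 : 0 ≤ M := (norm_nonneg _).trans (hM z (by simp))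
  refine ContinuousLinearMap.opNorm_le_of_unit_norm hM0 fun v hv => ?_
  have hline : ∀ t : ℂ, HasDerivAt (fun t : ℂ => z + t • v) v t := fun t => by
    simpa using ((hasDerivAt_id t).smul_const v).const_add z
  have hd : Differentiable ℂ fun t : ℂ => f (z + t • v) :=
    hf.comp fun t => (hline t).differentiableAt
  have h1 : HasDerivAt (fun t : ℂ => f (z + t • v)) (fderiv ℂ f z v) 0 := by
    have h2 := (hf (z + (0 : ℂ) • v)).hasFDerivAt.comp_hasDerivAt (0 : ℂ) (hline 0)
    simp only [zero_smul, add_zero] at h2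
    exact h2
  rw [← h1.deriv]
  have h3 := Complex.norm_deriv_le_of_forall_mem_sphere_norm_le (C := M) one_pos hd.diffContOnCl
    (c := 0) fun t ht => hM _ (by
      rw [mem_sphere_zero_iff_norm] at ht
      simp [norm_smul, ht, hv])
  simpa using h3

/-- Cauchy's estimate transfers summable bounds from the functions to their derivatives, at the
price of enlarging the ball by one; hence the radius `‖z‖ + 1 + 1`. -/
lemma differentiable_tsum_of_norm_le {ι E : Type*} [NormedAddCommGroup E] [NormedSpace ℂ E]
    {f : ι → E → ℂ} (hf : ∀ i, Differentiable ℂ (f i)) {u : ℝ → ι → ℝ}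
    (hu : ∀ R, Summable (u R)) (hb : ∀ R i z, ‖z‖ ≤ R → ‖f i z‖ ≤ u R i) :
    Differentiable ℂ fun z => ∑' i, f i z := fun z => by
  have hz : z ∈ Metric.ball (0 : E) (‖z‖ + 1) := by simp
  let _ : NormedSpace ℝ E := NormedSpace.restrictScalars ℝ ℂ E
  refine (hasFDerivAt_tsum_of_isPreconnected (hu (‖z‖ + 1 + 1)) Metric.isOpen_ball
    (convex_ball (0 : E) (‖z‖ + 1)).isPreconnected (fun i w _ => (hf i w).hasFDerivAt)
    (fun i w hw => norm_fderiv_le_of_forall_norm_le (hf i) fun y hy => hb _ i y ?_) hz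
    (Summable.of_norm_bounded (hu ‖z‖) fun i => hb _ i z le_rfl) hz).differentiableAt
  rw [mem_ball_zero_iff] at hw
  have := norm_le_norm_sub_add y w
  linarith

variable {d : ℕ}

lemma differentiable_monomialFun (α : MultiIndex d) :
    Differentiable ℂ (monomialFun α : Cd d → ℂ) := by
  unfold monomialFun
  fun_prop

/-- The sum of the series `∑ c_α e_α`. -/
def bargmannSum (c : FormalHermite d) (z : Cd d) : ℂ := ∑' α, c α * monomialFun α z

lemma hasSum_bargmannSum {r C : ℝ} {c : FormalHermite d}
    (hc : ∀ α, ‖c α‖ ≤ C * Real.exp (r * order α)) (z : Cd d) :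
    HasSum (fun α => c α * monomialFun α z) (bargmannSum c z) :=
  (summable_norm_mul_monomialFun hc z).of_norm.hasSum

lemma summable_half_pow_order : Summable fun α : MultiIndex d => (1 / 2 : ℝ) ^ order α :=
  summable_pow_order (by norm_num) (by norm_num)

lemma bargmannSum_mem {r C : ℝ} {c : FormalHermite d}
    (hc : ∀ α, ‖c α‖ ≤ C * Real.exp (r * order α)) :
    bargmannSum c ∈ entireStepSubmodule d (2 * Real.exp (2 * r)) := by
  have hC : 0 ≤ C := nonneg_of_mul_nonneg_left ((norm_nonneg _).trans (hc 0)) (Real.exp_pos _)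
  have hs : Summable fun α : MultiIndex d => C * (1 / 2 : ℝ) ^ order α :=
    summable_half_pow_order.mul_left C
  refine ⟨differentiable_tsum_of_norm_le
    (fun α => (differentiable_const _).mul (differentiable_monomialFun α))
    (u := fun R α => C * (1 / 2) ^ order α * Real.exp (2 * Real.exp (2 * r) * R ^ 2))
    (fun R => hs.mul_right _) fun R α z hz => (mul_norm_monomialFun_le hc α z).trans ?_,
    ∑' α : MultiIndex d, C * (1 / 2 : ℝ) ^ order α, fun z => ?_⟩
  · gcongr
  · exact tsum_of_norm_bounded (hs.hasSum.mul_right _) fun α => mul_norm_monomialFun_le hc α z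

/-- One Gaussian exponent serves all partial sums, so the series converges in the norm of a single
step of the inductive limit. -/
lemma sub_sum_monomialFun_le {r C : ℝ} {c : FormalHermite d}
    (hc : ∀ α, ‖c α‖ ≤ C * Real.exp (r * order α)) (s : Finset (MultiIndex d)) (z : Cd d) :
    ‖bargmannSum c z - ∑ α ∈ s, c α * monomialFun α z‖ ≤
      (∑' α : {α // α ∉ s}, C * (1 / 2 : ℝ) ^ order (α : MultiIndex d)) *
        Real.exp (2 * Real.exp (2 * r) * ‖z‖ ^ 2) := by
  have h := (s.hasSum_compl_iff (f := fun α => c α * monomialFun α z)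
    (a := bargmannSum c z - ∑ α ∈ s, c α * monomialFun α z)).2
    (by rw [sub_add_cancel]; exact hasSum_bargmannSum hc z)
  rw [← h.tsum_eq]
  exact tsum_of_norm_bounded
    (((summable_half_pow_order.mul_left C).comp_injective
      Subtype.val_injective).hasSum.mul_right _) fun α => mul_norm_monomialFun_le hc α z

/-- The coefficients of a power series whose sum has Gaussian growth grow exponentially. -/
lemma norm_coeff_le_of_gaussian_growth {c : FormalHermite d} {F : Cd d → ℂ} {r C : ℝ}
    (hF : ∀ z, HasSum (fun α => c α * monomialFun α z) (F z))
    (hC : ∀ z, ‖F z‖ ≤ C * Real.exp (r * ‖z‖ ^ 2)) (α : MultiIndex d) :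
    ‖c α‖ ≤ C * Real.exp (r * d) * Real.exp (r * order α) := by
  have h1 : ∀ ζ : Fin d → ℂ, HasSum (fun α : MultiIndex d =>
      (c α / (Real.sqrt (multiFactorial α) : ℂ)) * ∏ i, ζ i ^ α i) (F (WithLp.toLp 2 ζ)) :=
    fun ζ => (hF (WithLp.toLp 2 ζ)).congr_fun fun α => by
      rw [monomialFun]
      ring
  -- On this polycircle `|z|² = |α| + d`, so the Gaussian bound becomes exponential in `|α|`. The
  -- monomial compensates the normalisation because `n! ≤ (n + 1)^n`.
  have h2 := norm_coeff_mul_prod_le h1 α (R := fun i => Real.sqrt (α i + 1))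
    (fun i => Real.sqrt_nonneg _) (M := C * Real.exp (r * (order α + d))) fun ζ hζ => by
      refine (hC _).trans_eq ?_
      rw [EuclideanSpace.norm_sq_eq]
      simp only [hζ]
      congr 3
      have : ∀ i : Fin d, Real.sqrt ((α i : ℝ) + 1) ^ 2 = α i + 1 := fun i =>
        Real.sq_sqrt (by positivity)
      simp [this, order, Finset.sum_add_distrib]
  have h3 : Real.sqrt (multiFactorial α) ≤ ∏ i, Real.sqrt ((α i : ℝ) + 1) ^ α i := by
    rw [multiFactorial, Nat.cast_prod, Real.sqrt_prod _ fun i _ => by positivity]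
    refine Finset.prod_le_prod (fun i _ => Real.sqrt_nonneg _) fun i _ => ?_
    refine Real.sqrt_le_iff.2 ⟨by positivity, ?_⟩
    rw [← pow_mul, mul_comm, pow_mul, Real.sq_sqrt (by positivity)]
    exact_mod_cast (Nat.factorial_le_pow (α i)).trans (Nat.pow_le_pow_left (Nat.le_succ _) _)
  have h4 : 0 < Real.sqrt (multiFactorial α) := by
    refine Real.sqrt_pos.2 ?_
    rw [multiFactorial]
    exact_mod_cast Finset.prod_pos fun i _ => Nat.factorial_pos _
  rw [norm_div, Complex.norm_real, Real.norm_of_nonneg h4.le] at h2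
  have h5 : ‖c α‖ ≤ ‖c α‖ / Real.sqrt (multiFactorial α) *
      ∏ i, Real.sqrt ((α i : ℝ) + 1) ^ α i := by
    rw [div_mul_eq_mul_div, le_div_iff₀ h4]
    exact mul_le_mul_of_nonneg_left h3 (norm_nonneg _)
  refine (h5.trans h2).trans_eq ?_
  rw [mul_assoc, ← Real.exp_add]
  ring_nf

/-- The Hermite coefficients whose Bargmann transform is the given entire function. -/
lemma exists_bargmann_eq {F : Cd d → ℂ} (hF : Differentiable ℂ F) :
    ∃ c : FormalHermite d, ∀ z, HasSum (fun α => c α * monomialFun α z) (F z) := by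
  have hG : Differentiable ℂ fun ζ : Fin d → ℂ => F (WithLp.toLp 2 ζ) :=
    hF.comp (EuclideanSpace.equiv (Fin d) ℂ).symm.differentiable
  refine ⟨fun α => torusCoeff (fun ζ => F (WithLp.toLp 2 ζ)) (fun j => (α j : ℤ)) 1 *
    (Real.sqrt (multiFactorial α) : ℂ), fun z => ?_⟩
  refine (hasSum_torusCoeff hG (WithLp.ofLp z)).congr_fun fun α => ?_
  have h4 : (Real.sqrt (multiFactorial α) : ℂ) ≠ 0 := by
    refine Complex.ofReal_ne_zero.2 (Real.sqrt_pos.2 ?_).ne'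
    rw [multiFactorial]
    exact_mod_cast Finset.prod_pos fun i _ => Nat.factorial_pos _
  rw [monomialFun]
  field_simp

end Entire

/-! ### Hermite expansions of distributions -/

section Dual

variable {d : ℕ}

/-- A continuous functional is bounded by finitely many of the norms, hence by one of them since
they increase as `h` decreases; this norm of `h_α` grows at most exponentially. -/
lemma exists_norm_hermiteExpansion_le (u : PilDual d) : ∃ r : ℝ, 0 < r ∧ ∃ C : ℝ,
    ∀ α, ‖hermiteExpansion u α‖ ≤ C * Real.exp (r * order α) := by
  obtain ⟨s, C, -, hC⟩ := Seminorm.bound_of_continuous (withSeminorms_pilNorm d)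
    ((normSeminorm ℂ ℂ).comp u.toLinearMap) (continuous_norm.comp u.continuous)
  -- The smallest parameter gives the strongest norm; for the empty family any value will do.
  obtain ⟨h, hs⟩ : ∃ h : {h : ℝ // 0 < h}, ∀ i ∈ s, h ≤ i := by
    rcases s.eq_empty_or_nonempty with rfl | hne
    · exact ⟨⟨1, one_pos⟩, by simp⟩
    · exact ⟨s.min' hne, fun i hi => s.min'_le i hi⟩
  have hh := h.2
  refine ⟨1 + 2 / h, by positivity, C * (6 ^ d * Real.exp (d / h)), fun α => ?_⟩
  have h1 : ‖u (hermitePil α)‖ ≤ C * s.sup (PilSpace.pilNorm d) (hermitePil α) :=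
    hC (hermitePil α)
  have h2 : s.sup (PilSpace.pilNorm d) (hermitePil α) ≤ PilSpace.pilNorm d h (hermitePil α) :=
    Seminorm.finset_sup_apply_le (apply_nonneg _ _) fun i hi => pilNorm_anti (hs i hi) _
  refine h1.trans ?_
  rw [mul_assoc]
  exact mul_le_mul_of_nonneg_left (h2.trans (pilNorm_hermitePil_le h α)) C.2

lemma pilCoeff_add (f g : PilSpace d) (α : MultiIndex d) :
    pilCoeff (f + g) α = pilCoeff f α + pilCoeff g α := by
  have hi : ∀ f : PilSpace d,
      Integrable fun x => oscPow 0 (PilSpace.toSmooth d f) x * hermiteFun α x := fun f =>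
    integrable_bounded_mul_hermiteFun (contDiff_oscPow 0 _).continuous
      (norm_oscPow_le f ⟨1, one_pos⟩ 0) α
  simp only [pilCoeff, hermiteCoeff]
  rw [← integral_add (hi f) (hi g)]
  refine integral_congr_ae (Eventually.of_forall fun x => ?_)
  simp [oscPow, add_mul]

lemma pilCoeff_smul (a : ℂ) (f : PilSpace d) (α : MultiIndex d) :
    pilCoeff (a • f) α = a * pilCoeff f α := by
  simp only [pilCoeff, hermiteCoeff]
  rw [← integral_const_mul]
  refine integral_congr_ae (Eventually.of_forall fun x => ?_)
  simp [oscPow, mul_assoc]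

lemma pilCoeff_hermitePil (α β : MultiIndex d) :
    pilCoeff (hermitePil α) β = if α = β then 1 else 0 := by
  simp only [pilCoeff, hermiteCoeff, oscPow_hermitePil, pow_zero, one_mul]
  exact integral_hermiteFun_mul α β

/-- The distribution with given Hermite coefficients. -/
lemma exists_hermiteExpansion_eq {c : FormalHermite d} {r C : ℝ}
    (hc : ∀ α, ‖c α‖ ≤ C * Real.exp (r * order α)) :
    ∃ u : PilDual d, hermiteExpansion u = c := by
  have hC : 0 ≤ C := nonneg_of_mul_nonneg_left ((norm_nonneg _).trans (hc 0)) (Real.exp_pos _)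
  -- With this `h` the decay `e^{(1 - 1/h)|α|}` of the coefficients of `f` outweighs `e^{r|α|}` by
  -- `e^{-|α|}`. The pairing series thus converges and is bounded by a multiple of `‖f‖_h`.
  set h : {h : ℝ // 0 < h} := ⟨(2 + |r|)⁻¹, by positivity⟩ with hh
  have hb : ∀ (f : PilSpace d) α, ‖c α * pilCoeff f α‖ ≤
      C * (2 * 6 ^ d * PilSpace.pilNorm d h f) * Real.exp (-1) ^ order α := fun f α => by
    have hp : (0 : ℝ) ≤ PilSpace.pilNorm d h f := apply_nonneg _ _
    rw [norm_mul]
    refine (mul_le_mul (hc α) (norm_hermiteCoeff_pil_le f h α) (norm_nonneg _)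
      (by positivity)).trans ?_
    have h1 : Real.exp (r * order α) * Real.exp ((1 - (h : ℝ)⁻¹) * order α) ≤
        Real.exp (-1) ^ order α := by
      rw [← Real.exp_add, ← Real.exp_nat_mul, ← add_mul]
      refine Real.exp_le_exp.2 ?_
      have h2 : r + (1 - (h : ℝ)⁻¹) ≤ -1 := by
        rw [hh, inv_inv]
        linarith [le_abs_self r]
      nlinarith [(Nat.cast_nonneg (order α) : (0 : ℝ) ≤ order α)]
    calc _ = C * (2 * 6 ^ d * PilSpace.pilNorm d h f) *
          (Real.exp (r * order α) * Real.exp ((1 - (h : ℝ)⁻¹) * order α)) := by ring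
      _ ≤ _ := mul_le_mul_of_nonneg_left h1 (by positivity)
  have hq : Summable fun α : MultiIndex d => Real.exp (-1) ^ order α :=
    summable_pow_order (Real.exp_pos _).le (by rw [Real.exp_lt_one_iff]; norm_num)
  have hs : ∀ f : PilSpace d, Summable fun α => c α * pilCoeff f α := fun f =>
    Summable.of_norm_bounded (hq.mul_left _) (hb f)
  let L : PilSpace d →ₗ[ℂ] ℂ :=
    { toFun := fun f => ∑' α, c α * pilCoeff f α
      map_add' := fun f g => by
        simp only [pilCoeff_add, mul_add]
        exact (hs f).tsum_add (hs g)
      map_smul' := fun a f => by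
        simp only [pilCoeff_smul, mul_left_comm, RingHom.id_apply, smul_eq_mul]
        exact tsum_mul_left }
  have hL : Continuous L := by
    have := (withSeminorms_pilNorm d).topologicalAddGroup
    refine WithSeminorms.continuous_normedSpace_rng ℂ (withSeminorms_pilNorm d) L
      ⟨{h}, ⟨C * (2 * 6 ^ d) * ∑' α : MultiIndex d, Real.exp (-1) ^ order α, ?_⟩, fun f => ?_⟩
    · have : 0 ≤ ∑' α : MultiIndex d, Real.exp (-1) ^ order α :=
        tsum_nonneg fun α => by positivity
      positivity
    · have h3 := tsum_of_norm_bounded (hq.hasSum.mul_left _) (hb f)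
      rw [Finset.sup_singleton]
      change ‖∑' α, c α * pilCoeff f α‖ ≤ C * (2 * 6 ^ d) *
        (∑' α : MultiIndex d, Real.exp (-1) ^ order α) * PilSpace.pilNorm d h f
      refine h3.trans_eq ?_
      ring
  refine ⟨⟨L, hL⟩, funext fun α => ?_⟩
  change ∑' β, c β * pilCoeff (hermitePil α) β = c α
  rw [tsum_eq_single α fun β hβ => by rw [pilCoeff_hermitePil, if_neg hβ.symm, mul_zero],
    pilCoeff_hermitePil, if_pos rfl, mul_one]

/-- Continuous functionals may be applied termwise to the Hermite expansion, which converges in the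
topology of `𝚺`. -/
lemma eq_of_hermiteExpansion_eq {u v : PilDual d} (h : hermiteExpansion u = hermiteExpansion v) :
    u = v := by
  ext f
  have hu := (hasSum_pilCoeff_smul_hermitePil f).map u u.continuous
  have hv := (hasSum_pilCoeff_smul_hermitePil f).map v v.continuous
  refine hu.unique (hv.congr_fun fun α => ?_)
  have h1 : u (hermitePil α) = v (hermitePil α) := congrFun h α
  simp [h1]

end Dual

/-! ### Continuity of the Bargmann transform -/

section Continuity

variable {d : ℕ}

lemma stepNorm_le {r : ℝ} {F : EntireStep d r} {C : ℝ}
    (hC : ∀ z, ‖F.1 z‖ ≤ C * Real.exp (r * ‖z‖ ^ 2)) : EntireStep.stepNorm d r F ≤ C := by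
  refine ciSup_le fun z => ?_
  have h := mul_le_mul_of_nonneg_right (hC z) (Real.exp_pos (-(r * ‖z‖ ^ 2))).le
  rwa [mul_assoc, ← Real.exp_add, add_neg_cancel, Real.exp_zero, mul_one] at h

/-- A continuous seminorm on one of the normed spaces is bounded by a multiple of the norm. -/
lemma exists_le_stepNorm {r : ℝ} (q : Seminorm ℂ (EntireStep d r)) (hq : Continuous q) :
    ∃ K : ℝ, 0 < K ∧ ∀ F, q F ≤ K * EntireStep.stepNorm d r F := by
  let _ : SeminormedAddCommGroup (EntireStep d r) :=
    (EntireStep.stepNorm d r).toSeminormedAddCommGroup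
  let _ : NormedSpace ℂ (EntireStep d r) :=
    { norm_smul_le := fun a F => le_of_eq (map_smul_eq_mul (EntireStep.stepNorm d r) a F) }
  exact Seminorm.bound_of_continuous_normedSpace q hq

lemma APrime.ext {F G : APrime d} (h : ∀ z, F z = G z) : F = G := Subtype.ext (funext h)

/-- The function `e_α` as an element of the normed space with parameter `r > 0`. -/
def monomialStep (r : {r : ℝ // 0 < r}) (α : MultiIndex d) : EntireStep d r :=
  ⟨monomialFun α, differentiable_monomialFun α, (Real.sqrt (2 * r))⁻¹ ^ order α, fun z => by
    have hr := r.2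
    refine (norm_monomialFun_le (q := (Real.sqrt (2 * r))⁻¹) (by positivity) α z).trans_eq ?_
    congr 2
    rw [inv_pow, Real.sq_sqrt (by positivity)]
    field_simp⟩

/-- The function `e_α` as an element of `𝒜'(ℂᵈ)`. -/
def monomialAPrime (α : MultiIndex d) : APrime d :=
  EntireStep.toAPrime d ⟨1, one_pos⟩ (monomialStep _ α)

lemma toAPrime_monomialStep (r : {r : ℝ // 0 < r}) (α : MultiIndex d) :
    EntireStep.toAPrime d r (monomialStep r α) = monomialAPrime α := rfl

/-- In the step with `r = 1/(2q²)` the norm of `e_α` is at most `q^{|α|}`. All steps are available,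
so `q` is arbitrary. -/
lemma exists_seminorm_monomialAPrime_le {p : Seminorm ℂ (APrime d)}
    (hp : ∀ r : {r : ℝ // 0 < r}, ∃ K : ℝ, 0 < K ∧
      ∀ F, p (EntireStep.toAPrime d r F) ≤ K * EntireStep.stepNorm d r F) {q : ℝ} (hq : 0 < q) :
    ∃ K : ℝ, 0 < K ∧ ∀ α, p (monomialAPrime α) ≤ K * q ^ order α := by
  obtain ⟨K, hK, h⟩ := hp ⟨(2 * q ^ 2)⁻¹, by positivity⟩
  refine ⟨K, hK, fun α => ?_⟩
  rw [← toAPrime_monomialStep ⟨(2 * q ^ 2)⁻¹, by positivity⟩]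
  refine (h _).trans (mul_le_mul_of_nonneg_left (stepNorm_le fun z => ?_) hK.le)
  refine (norm_monomialFun_le hq α z).trans_eq ?_
  congr 2
  rw [div_eq_inv_mul]

/-- The Bargmann transform on the Pilipović distributions. -/
def bargmannLinear (d : ℕ) : PilDual d →ₗ[ℂ] APrime d where
  toFun u := ⟨bargmannSum (hermiteExpansion u), by
    obtain ⟨r, -, C, hC⟩ := exists_norm_hermiteExpansion_le u
    have h := bargmannSum_mem hC
    exact ⟨h.1, _, by positivity, h.2⟩⟩
  map_add' u v := APrime.ext fun z => by
    obtain ⟨r, -, C, hC⟩ := exists_norm_hermiteExpansion_le u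
    obtain ⟨s, -, D, hD⟩ := exists_norm_hermiteExpansion_le v
    refine (((hasSum_bargmannSum hC z).add (hasSum_bargmannSum hD z)).congr_fun
      fun α => ?_).tsum_eq
    change (u (hermitePil α) + v (hermitePil α)) * monomialFun α z =
      u (hermitePil α) * monomialFun α z + v (hermitePil α) * monomialFun α z
    ring
  map_smul' a u := APrime.ext fun z => by
    obtain ⟨r, -, C, hC⟩ := exists_norm_hermiteExpansion_le u
    refine (((hasSum_bargmannSum hC z).mul_left a).congr_fun fun α => ?_).tsum_eq
    change a * u (hermitePil α) * monomialFun α z = a * (u (hermitePil α) * monomialFun α z)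
    ring

lemma hasSum_bargmannLinear (u : PilDual d) (z : Cd d) :
    HasSum (fun α => hermiteExpansion u α * monomialFun α z) (bargmannLinear d u z) := by
  obtain ⟨r, -, C, hC⟩ := exists_norm_hermiteExpansion_le u
  exact hasSum_bargmannSum hC z

/-- A seminorm on `𝒜'(ℂᵈ)` which is continuous on the normed spaces can be evaluated termwise. -/
lemma seminorm_bargmannLinear_le {p : Seminorm ℂ (APrime d)}
    (hp : ∀ r : {r : ℝ // 0 < r}, ∃ K : ℝ, 0 < K ∧
      ∀ F, p (EntireStep.toAPrime d r F) ≤ K * EntireStep.stepNorm d r F) (u : PilDual d) {M : ℝ}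
    (hM : ∀ s : Finset (MultiIndex d),
      ∑ α ∈ s, ‖hermiteExpansion u α‖ * p (monomialAPrime α) ≤ M) :
    p (bargmannLinear d u) ≤ M := by
  obtain ⟨r, hr, C, hC⟩ := exists_norm_hermiteExpansion_le u
  set ρ : {r : ℝ // 0 < r} := ⟨2 * Real.exp (2 * r), by positivity⟩ with hρ
  obtain ⟨K, hK, h⟩ := hp ρ
  set tail : Finset (MultiIndex d) → ℝ := fun s =>
    ∑' α : {α // α ∉ s}, C * (1 / 2 : ℝ) ^ order (α : MultiIndex d) with htail
  set U : EntireStep d ρ := ⟨bargmannSum (hermiteExpansion u), bargmannSum_mem hC⟩ with hU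
  -- The remainder after a finite partial sum lies in the step `ρ`, where its norm is at most `tail
  -- s`, which tends to `0`; the partial sum is handled by subadditivity.
  have hle : ∀ s, p (bargmannLinear d u) ≤ K * tail s + M := fun s => by
    have hsplit : bargmannLinear d u = EntireStep.toAPrime d ρ
        (U - ∑ α ∈ s, hermiteExpansion u α • monomialStep ρ α) +
        ∑ α ∈ s, hermiteExpansion u α • monomialAPrime α := by
      simp only [map_sub, map_sum, map_smul, toAPrime_monomialStep, sub_add_cancel]
      rfl
    rw [hsplit]
    refine (map_add_le_add p _ _).trans (add_le_add ?_ ?_)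
    · refine (h _).trans (mul_le_mul_of_nonneg_left (stepNorm_le fun z => ?_) hK.le)
      have hval : (U - ∑ α ∈ s, hermiteExpansion u α • monomialStep ρ α).1 z =
          bargmannSum (hermiteExpansion u) z -
            ∑ α ∈ s, hermiteExpansion u α * monomialFun α z := by
        have hev : ∀ F : EntireStep d ρ, F.1 z =
          (LinearMap.proj z ∘ₗ (entireStepSubmodule d ρ).subtype :
            EntireStep d ρ →ₗ[ℂ] ℂ) F := fun F => rfl
        rw [hev, map_sub, map_sum]
        simp only [map_smul, smul_eq_mul]
        rfl
      rw [hval]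
      exact sub_sum_monomialFun_le hC s z
    · refine (Finset.le_sum_of_subadditive p (map_zero p).le (map_add_le_add p) s _).trans ?_
      simp only [map_smul_eq_mul]
      exact hM s
  have hlim : Tendsto (fun s => K * tail s + M) atTop (𝓝 (K * 0 + M)) :=
    ((tendsto_tsum_compl_atTop_zero fun α : MultiIndex d =>
      C * (1 / 2 : ℝ) ^ order α).const_mul K).add_const M
  rw [mul_zero, zero_add] at hlim
  exact ge_of_tendsto' hlim hle

/-- The strong dual topology is used through one bounded set, made of the vectors `2^{|α|} p(e_α)
h_α`. The rapid decay of `p(e_α)` beats the growth of every norm of `h_α`, which makes the set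
bounded; the weights `2^{|α|}` make the resulting estimate summable. -/
lemma continuous_seminorm_comp_bargmannLinear {p : Seminorm ℂ (APrime d)}
    (hp : ∀ r : {r : ℝ // 0 < r}, ∃ K : ℝ, 0 < K ∧
      ∀ F, p (EntireStep.toAPrime d r F) ≤ K * EntireStep.stepNorm d r F) :
    Continuous (p.comp (bargmannLinear d)) := by
  set B : Set (PilSpace d) := Set.range fun α : MultiIndex d =>
    ((2 ^ order α * p (monomialAPrime α) : ℝ) : ℂ) • hermitePil α with hB
  have hBb : Bornology.IsVonNBounded ℂ B := by
    refine ((withSeminorms_pilNorm d).isVonNBounded_iff_seminorm_bounded).2 fun h => ?_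
    have hh := h.2
    obtain ⟨K, hK, hKle⟩ := exists_seminorm_monomialAPrime_le hp
      -- This `q` cancels both the weight `2^{|α|}` and the growth `e^{(1 + 2/h)|α|}` of the norm of
      -- `h_α`.
      (q := 1 / 2 * Real.exp (-(1 + 2 / h))) (by positivity)
    refine ⟨K * (6 ^ d * Real.exp (d / h)) + 1, by positivity, ?_⟩
    rintro _ ⟨α, rfl⟩
    refine lt_of_le_of_lt ?_ (lt_add_one _)
    have hp0 : (0 : ℝ) ≤ p (monomialAPrime α) := apply_nonneg _ _
    rw [map_smul_eq_mul, Complex.norm_real, Real.norm_of_nonneg (by positivity)]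
    refine (mul_le_mul (mul_le_mul_of_nonneg_left (hKle α) (by positivity))
      (pilNorm_hermitePil_le h α) (apply_nonneg _ _) (by positivity)).trans_eq ?_
    have e1 : Real.exp (-(1 + 2 / h)) ^ order α * Real.exp ((1 + 2 / h) * order α) = 1 := by
      rw [← Real.exp_nat_mul, ← Real.exp_add, ← Real.exp_zero]
      ring_nf
    have e2 : (2 : ℝ) ^ order α * (1 / 2) ^ order α = 1 := by
      rw [← mul_pow]
      norm_num
    rw [mul_pow]
    calc _ = ((2 : ℝ) ^ order α * (1 / 2) ^ order α) * (Real.exp (-(1 + 2 / h)) ^ order α *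
          Real.exp ((1 + 2 / h) * order α)) * (K * (6 ^ d * Real.exp (d / h))) := by ring
      _ = _ := by rw [e1, e2, one_mul, one_mul]
  set S : ℝ := ∑' α : MultiIndex d, (1 / 2 : ℝ) ^ order α with hS
  have hS0 : 0 ≤ S := tsum_nonneg fun α => by positivity
  refine Seminorm.continuous' (r := S) ?_
  have hnhds := ContinuousLinearMap.eventually_nhds_zero_mapsTo (𝕜₁ := ℂ) (𝕜₂ := ℂ)
    (σ := RingHom.id ℂ) (F := ℂ) hBb (Metric.ball_mem_nhds (0 : ℂ) one_pos)
  filter_upwards [hnhds] with u hu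
  rw [Seminorm.mem_closedBall_zero]
  refine seminorm_bargmannLinear_le hp u fun s => ?_
  refine (Finset.sum_le_sum fun α _ => ?_).trans
    (summable_half_pow_order.sum_le_tsum s fun α _ => by positivity)
  have hp0 : (0 : ℝ) ≤ p (monomialAPrime α) := apply_nonneg _ _
  -- Since `|u| < 1` on the bounded set, `|u(h_α)| p(e_α) < 2^{-|α|}`.
  have h1 := hu (Set.mem_range_self α)
  rw [mem_ball_zero_iff, map_smul, smul_eq_mul, norm_mul, Complex.norm_real,
    Real.norm_of_nonneg (by positivity)] at h1
  rw [one_div, inv_pow, ← one_div, le_div_iff₀ (by positivity)]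
  refine le_trans (le_of_eq ?_) h1.le
  rw [hermiteExpansion]
  ring

-- Nonnegative elements for the order of `ℂ` are real, so both notions of convexity involve the same
-- combinations. The complex version gives access to gauge seminorms that are homogeneous over `ℂ`.
open scoped ComplexOrder in
lemma convex_complex_of_convex_real {E : Type*} [AddCommGroup E] [Module ℂ E] {s : Set E}
    (hs : Convex ℝ s) : Convex ℂ s := by
  intro x hx y hy a b ha hb hab
  have ha' := Complex.nonneg_iff.1 ha
  have hb' := Complex.nonneg_iff.1 hb
  have ea : a = (a.re : ℂ) := Complex.ext rfl (by simp [← ha'.2])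
  have eb : b = (b.re : ℂ) := Complex.ext rfl (by simp [← hb'.2])
  have h := hs hx hy ha'.1 hb'.1 (by simpa using congrArg Complex.re hab)
  rw [ea, eb, Complex.coe_smul, Complex.coe_smul]
  exact h

open scoped ComplexOrder in
lemma locallyConvexSpace_complex (E : Type*) [AddCommGroup E] [Module ℂ E] [TopologicalSpace E]
    [IsTopologicalAddGroup E] [LocallyConvexSpace ℝ E] : LocallyConvexSpace ℂ E := by
  rw [locallyConvexSpace_iff_exists_convex_subset_zero]
  intro U hU
  obtain ⟨s, hs, hsc, hsU⟩ :=
    (locallyConvexSpace_iff_exists_convex_subset_zero ℝ E).1 inferInstance U hU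
  exact ⟨s, hs, convex_complex_of_convex_real hsc, hsU⟩

-- A locally convex topology is given by its gauge seminorms. Each of these pulls back to a seminorm
-- on `𝒜'` that is continuous on all the normed steps, to which the boundedness argument applies.
-- The arbitrary target `E` allows any competing topology on `𝒜'` to be inserted.
open scoped ComplexOrder in
lemma continuous_comp_bargmannLinear {E : Type*} [AddCommGroup E] [Module ℂ E]
    [TopologicalSpace E] [IsTopologicalAddGroup E] [ContinuousSMul ℂ E] [LocallyConvexSpace ℝ E]
    (j : APrime d →ₗ[ℂ] E)
    (hj : ∀ r : {r : ℝ // 0 < r}, Continuous fun F => j (EntireStep.toAPrime d r F)) :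
    Continuous (j ∘ₗ bargmannLinear d) := by
  have := locallyConvexSpace_complex E
  have : ContinuousSMul ℝ E := IsScalarTower.continuousSMul ℂ
  have hE := with_gaugeSeminormFamily (𝕜 := ℂ) (E := E)
  refine hE.continuous_of_continuous_comp (j ∘ₗ bargmannLinear d) fun i => ?_
  have hi : Continuous (gaugeSeminormFamily ℂ E i) := hE.continuous_seminorm i
  exact continuous_seminorm_comp_bargmannLinear (p := (gaugeSeminormFamily ℂ E i).comp j)
    fun r => exists_le_stepNorm (((gaugeSeminormFamily ℂ E i).comp j).comp
      (EntireStep.toAPrime d r)) (hi.comp (hj r))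

/-- Continuity into the infimum of a set of topologies is continuity into each of them, so no
explicit description of the inductive limit is needed. -/
lemma continuous_bargmannLinear (d : ℕ) : Continuous (bargmannLinear d) := by
  refine continuous_sInf_rng.2 ?_
  rintro t ⟨h1, h2, h3, h4⟩
  exact @continuous_comp_bargmannLinear d (APrime d) _ _ t h1 h2 h3 LinearMap.id h4

lemma bijective_bargmannLinear (d : ℕ) : Function.Bijective (bargmannLinear d) := by
  constructor
  · rw [injective_iff_map_eq_zero]
    intro u hu
    have h1 : ∀ z, HasSum (fun α => hermiteExpansion u α * monomialFun α z) 0 := fun z => by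
      have h := hasSum_bargmannLinear u z
      rw [hu] at h
      exact h
    refine eq_of_hermiteExpansion_eq (funext fun α => ?_)
    -- Cauchy's estimate with constant `0`: a power series with sum zero has zero coefficients.
    have h2 := norm_coeff_le_of_gaussian_growth (C := 0) (r := 0) h1 (by simp) α
    rw [zero_mul, zero_mul, norm_le_zero_iff] at h2
    exact h2
  · intro F
    obtain ⟨hF, r, hr, C, hC⟩ := F.2
    obtain ⟨c, hc⟩ := exists_bargmann_eq hF
    obtain ⟨u, hu⟩ := exists_hermiteExpansion_eq (norm_coeff_le_of_gaussian_growth hc hC)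
    refine ⟨u, APrime.ext fun z => ?_⟩
    have h := hasSum_bargmannLinear u z
    rw [hu] at h
    exact h.unique (hc z)

end Continuity

/-! ### Characterisations of the Pilipović distributions -/

section Characterisation

variable {d : ℕ}

lemma isFormalSTFT_of_hasSum {c : FormalHermite d} {F : Cd d → ℂ}
    (h : ∀ z, HasSum (fun α => c α * monomialFun α z) (F z)) :
    IsFormalSTFT c fun x ξ => stftFactor x ξ * F (bargmannPoint x ξ) := fun x ξ =>
  ((h (bargmannPoint x ξ)).mul_left (stftFactor x ξ)).congr_fun fun α => by
    rw [stft_hermiteFun]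
    ring

lemma hasSum_of_isFormalSTFT {c : FormalHermite d} {V : Rd d → Rd d → ℂ} (h : IsFormalSTFT c V)
    (x ξ : Rd d) : HasSum (fun α => c α * monomialFun α (bargmannPoint x ξ))
      ((stftFactor x ξ)⁻¹ * V x ξ) :=
  ((h x ξ).mul_left (stftFactor x ξ)⁻¹).congr_fun fun α => by
    rw [stft_hermiteFun]
    have := stftFactor_ne_zero x ξ
    field_simp

lemma norm_stftFactor_le_one (x ξ : Rd d) : ‖stftFactor x ξ‖ ≤ 1 := by
  rw [norm_stftFactor]
  have h1 : (2 * Real.pi) ^ (-(d / 2 : ℝ)) ≤ 1 :=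
    Real.rpow_le_one_of_one_le_of_nonpos (by linarith [Real.pi_gt_three])
      (neg_nonpos.2 (by positivity))
  have h2 : Real.exp (-(1 / 4) * (‖x‖ ^ 2 + ‖ξ‖ ^ 2)) ≤ 1 :=
    Real.exp_le_one_iff.2 (by nlinarith [sq_nonneg ‖x‖, sq_nonneg ‖ξ‖])
  exact mul_le_one₀ h1 (Real.exp_pos _).le h2

lemma exists_isFormalSTFT_of_coeff_le {c : FormalHermite d} {r C : ℝ}
    (hc : ∀ α, ‖c α‖ ≤ C * Real.exp (r * order α)) :
    ∃ V : Rd d → Rd d → ℂ, IsFormalSTFT c V ∧ ∃ r : ℝ, 0 < r ∧ ∃ C : ℝ, ∀ x ξ : Rd d,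
      ‖V x ξ‖ ≤ C * Real.exp (r * (‖x‖ ^ 2 + ‖ξ‖ ^ 2)) := by
  obtain ⟨-, D, hD⟩ := bargmannSum_mem hc
  -- The exponent `2 e^{2r}` is halved since the Bargmann point satisfies `|z|² = (|x|² + |ξ|²)/2`.
  refine ⟨_, isFormalSTFT_of_hasSum (hasSum_bargmannSum hc), Real.exp (2 * r), Real.exp_pos _, D,
    fun x ξ => ?_⟩
  rw [norm_mul]
  refine (mul_le_of_le_one_left (norm_nonneg _) (norm_stftFactor_le_one x ξ)).trans
    ((hD _).trans_eq ?_)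
  rw [norm_sq_bargmannPoint]
  ring_nf

/-- Every point of `ℂᵈ` is a Bargmann point, so division by the factor gives the sum of the power
series everywhere, and Cauchy's estimates apply. -/
lemma exists_coeff_le_of_isFormalSTFT {c : FormalHermite d} {V : Rd d → Rd d → ℂ}
    (hV : IsFormalSTFT c V) {r C : ℝ} (hr : 0 < r)
    (hC : ∀ x ξ : Rd d, ‖V x ξ‖ ≤ C * Real.exp (r * (‖x‖ ^ 2 + ‖ξ‖ ^ 2))) :
    ∃ r : ℝ, 0 < r ∧ ∃ C : ℝ, ∀ α : MultiIndex d, ‖c α‖ ≤ C * Real.exp (r * order α) := by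
  choose X Ξ hX using exists_bargmannPoint_eq (d := d)
  have hF : ∀ z, HasSum (fun α => c α * monomialFun α z)
      ((stftFactor (X z) (Ξ z))⁻¹ * V (X z) (Ξ z)) := fun z => by
    have h := hasSum_of_isFormalSTFT hV (X z) (Ξ z)
    rwa [hX] at h
  -- As `|x|² + |ξ|² = 2|z|²`, the bound for `V` contributes `2r`, and dividing by the factor
  -- `e^{-(|x|² + |ξ|²)/4}` contributes `1/2`.
  refine ⟨2 * r + 1 / 2, by positivity, _, norm_coeff_le_of_gaussian_growth hF
    (C := ((2 * Real.pi) ^ (-(d / 2 : ℝ)))⁻¹ * C) fun z => ?_⟩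
  have hz : ‖X z‖ ^ 2 + ‖Ξ z‖ ^ 2 = 2 * ‖z‖ ^ 2 := by
    have h := norm_sq_bargmannPoint (X z) (Ξ z)
    rw [hX] at h
    linarith
  have h1 := hC (X z) (Ξ z)
  rw [hz] at h1
  rw [norm_mul, norm_inv, norm_stftFactor, hz, mul_inv, ← Real.exp_neg]
  refine (mul_le_mul_of_nonneg_left h1 (by positivity)).trans_eq ?_
  have h2 : Real.exp ((2 * r + 1 / 2) * ‖z‖ ^ 2) =
      Real.exp (-(-(1 / 4) * (2 * ‖z‖ ^ 2))) * Real.exp (r * (2 * ‖z‖ ^ 2)) := by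
    rw [← Real.exp_add]
    ring_nf
  rw [h2]
  ring

end Characterisation

end Pilipovic

end

/-! ### The equivalences and the continuous bijection. -/

theorem mainTheorem4 (d : ℕ) :
    (∀ c : Pilipovic.FormalHermite d, List.TFAE [
      -- `f = ∑ c_α h_α` belongs to `𝚺'(ℝᵈ)`
      ∃ u : Pilipovic.PilDual d, Pilipovic.hermiteExpansion u = c,
      -- the Bargmann transform of `f` belongs to `𝒜'(ℂᵈ)`
      ∃ F : Pilipovic.APrime d, Pilipovic.HasEntireSum (Pilipovic.bargmann c) F,
      -- `|c_α| ≲ e^{r|α|}` for some `r > 0`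
      ∃ r : ℝ, 0 < r ∧ ∃ C : ℝ, ∀ α : Pilipovic.MultiIndex d,
        ‖c α‖ ≤ C * Real.exp (r * Pilipovic.order α),
      -- `|V_φ f(x, ξ)| ≲ e^{r(|x|² + |ξ|²)}` for some `r > 0`
      ∃ V : Pilipovic.Rd d → Pilipovic.Rd d → ℂ, Pilipovic.IsFormalSTFT c V ∧
        ∃ r : ℝ, 0 < r ∧ ∃ C : ℝ, ∀ x ξ : Pilipovic.Rd d,
          ‖V x ξ‖ ≤ C * Real.exp (r * (‖x‖ ^ 2 + ‖ξ‖ ^ 2))]) ∧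
    -- the Bargmann transform restricts to a continuous bijection from `𝚺'(ℝᵈ)` to `𝒜'(ℂᵈ)`
    ∃ T : Pilipovic.PilDual d →L[ℂ] Pilipovic.APrime d,
      (∀ u : Pilipovic.PilDual d,
        Pilipovic.HasEntireSum (Pilipovic.bargmann (Pilipovic.hermiteExpansion u)) (T u)) ∧
      Function.Bijective T := by
  refine ⟨fun c => ?_, ⟨Pilipovic.bargmannLinear d, Pilipovic.continuous_bargmannLinear d⟩,
    fun u => Pilipovic.hasEntireSum_bargmann_iff.2 (Pilipovic.hasSum_bargmannLinear u),
    Pilipovic.bijective_bargmannLinear d⟩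
  tfae_have 1 → 2 := by
    rintro ⟨u, rfl⟩
    exact ⟨Pilipovic.bargmannLinear d u,
      Pilipovic.hasEntireSum_bargmann_iff.2 (Pilipovic.hasSum_bargmannLinear u)⟩
  tfae_have 2 → 3 := by
    rintro ⟨F, hF⟩
    obtain ⟨-, r, hr, C, hC⟩ := F.2
    exact ⟨r, hr, _, Pilipovic.norm_coeff_le_of_gaussian_growth
      (Pilipovic.hasEntireSum_bargmann_iff.1 hF) hC⟩
  tfae_have 3 → 1 := by
    rintro ⟨r, -, C, hC⟩
    exact Pilipovic.exists_hermiteExpansion_eq hC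
  tfae_have 3 → 4 := by
    rintro ⟨r, -, C, hC⟩
    exact Pilipovic.exists_isFormalSTFT_of_coeff_le hC
  tfae_have 4 → 3 := by
    rintro ⟨V, hV, r, hr, C, hC⟩
    exact Pilipovic.exists_coeff_le_of_isFormalSTFT hV hr hC
  tfae_finish
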